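/- Let $(\mathcal M,\mathfrak g)$ and $(\mathcal N,\mathfrak h)$ be connected, compact, oriented smooth 2-dimensional Riemannian manifolds, possibly with Lipschitz boundary (realised as compact domains in smooth oriented Riemannian surfaces without boundary), with areas $V_{\mathcal M},V_{\mathcal N}$. Let $\operatorname{Lip}_+^{\rm inj}(\mathcal M,\mathcal N)$ be the set of Lipschitz maps $\phi:\mathcal M\to\mathcal N$ whose Jacobian is non-negative almost everywhere and which are injective almost everywhere, i.e. $|\phi^{-1}(q)|\le 1$ for almost every $q\in\mathcal N$. A map $\phi$ is a homothety if $\phi^*\mathfrak h=\lambda^2\mathfrak g$ for some constant $\lambda>0$, i.e. $\mathfrak h_{\phi(p)}(d\phi_p v,d\phi_p w)=\lambda^2\mathfrak g_p(v,w)$ for every $p\in\mathcal M$ and $v,w\in T_p\mathcal M$. Let $g:\mathbb R\to[0,\infty)$ be continuous, strictly decreasing and strictly convex on $(-\infty,0]$, strictly increasing on $[0,\infty)$, with $g(0)=0$. Set $f(x)=g(\log x)$ for $x>0$, extended to $x=0$ by its limit at $0$, and let $$E_f(\phi)=\frac1{V_{\mathcal M}}\int_{\mathcal M}\bigl(f(\sigma_1(d\phi))+f(\sigma_2(d\phi))\bigr)\in[0,\infty],\qquad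 F_f(s)=\min_{xy=s,\;x,y>0}\bigl(f(x)+f(y)\bigr)\quad(s>0),\qquad F_f(0)=+\infty,$$ where $\sigma_1(d\phi),\sigma_2(d\phi)$ are the singular values of $d\phi$. Then: 1. The minimum defining $F_f(s)$ is attained for every $s>0$. 2. For every $\phi\in\operatorname{Lip}_+^{\rm inj}(\mathcal M,\mathcal N)$ whose image has area $V_{\phi(\mathcal M)}\le V_{\mathcal M}$ (in particular for every such $\phi$ if $V_{\mathcal N}\le V_{\mathcal M}$), $E_f(\phi)\ge F_f(V_{\phi(\mathcal M)}/V_{\mathcal M})$; and if $V_{\phi(\mathcal M)}>0$, equality holds if and only if $\phi$ is a homothety. 3. If $\phi\in\operatorname{Lip}_+^{\rm inj}(\mathcal M,\mathcal N)$ is a homothety with $V_{\phi(\mathcal M)}\le V_{\mathcal M}$, then $E_f(\phi)\le E_f(\psi)$ for every $\psi\in\operatorname{Lip}_+^{\rm inj}(\mathcal M,\mathcal N)$ with $V_{\psi(\mathcal M)}=V_{\phi(\mathcal M)}$. 4. If $V_{\mathcal N}\le V_{\mathcal M}$, then $E_f(\phi)\ge F_f(V_{\mathcal N}/V_{\mathcal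 M})$ for every $\phi\in\operatorname{Lip}_+^{\rm inj}(\mathcal M,\mathcal N)$, with equality if and only if $\phi$ is a surjective homothety. Consequently there is no phase transition: if $V_{\mathcal N}\le V_{\mathcal M}$ and $\operatorname{Lip}_+^{\rm inj}(\mathcal M,\mathcal N)$ contains a surjective homothety, then the minimizers of $E_f$ in this class are exactly the surjective homotheties in it. -/

import Mathlib

open Set Filter Topology MeasureTheory Manifold Bundle
open scoped ENNReal NNReal ContDiff

/-- The Euclidean plane, on which all surfaces are modelled. -/
abbrev Plane : Type := EuclideanSpace ℝ (Fin 2)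

/-- The model `𝓘(ℝ, ℝ²)` of smooth surfaces without boundary. -/
local notation "𝓘₂" => modelWithCornersSelf ℝ Plane

namespace SurfaceDistortion

noncomputable section

/-! ### Oriented Riemannian surfaces and their area measure -/

/-- The charts of the surface `X` form an oriented atlas: every change of charts has positive
Jacobian determinant. The tangent plane at `x` is `ℝ²`, identified through the preferred chart at
`x`, and its orientation is then the standard orientation of `ℝ²`. -/
class OrientedAtlas (X : Type*) [TopologicalSpace X] [ChartedSpace Plane X] : Prop where
  det_pos : ∀ e ∈ atlas Plane X, ∀ e' ∈ atlas Plane X, ∀ u ∈ (e.symm.trans e').source,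
    0 < (fderiv ℝ (e.symm.trans e') u).det

section Area

variable (X : Type*) [EMetricSpace X] [ChartedSpace Plane X]
  [RiemannianBundle (fun x : X => TangentSpace 𝓘₂ x)]

/-- The Gram matrix `(g_{ij})` of the metric, at the point with coordinates `u` in the preferred
chart at `x₀`: `g_{ij} = ⟨∂_i, ∂_j⟩`, with `∂_i` the coordinate vector fields of that chart. -/
def chartGram (x₀ : X) (u : Plane) : Matrix (Fin 2) (Fin 2) ℝ :=
  Matrix.of fun i j => inner ℝ
    (mfderiv 𝓘₂ 𝓘₂ (chartAt Plane x₀).symm u (EuclideanSpace.single i (1 : ℝ)))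
    (mfderiv 𝓘₂ 𝓘₂ (chartAt Plane x₀).symm u (EuclideanSpace.single j (1 : ℝ)))

variable [MeasurableSpace X]

/-- The Riemannian area on the domain of the preferred chart at `x₀`, that is, the measure
`√(det g_{ij}) du₁ du₂` carried over from the chart; it vanishes off the domain of the chart. -/
def chartArea (x₀ : X) : Measure X :=
  (((volume : Measure Plane).restrict (chartAt Plane x₀).target).withDensity
    fun u => ENNReal.ofReal (Real.sqrt (chartGram X x₀ u).det)).map (chartAt Plane x₀).symm

/-- The Riemannian area measure of a surface. The measures `chartArea x₀` agree on overlaps of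
charts, so that the least measure above all of them is the measure which is given by
`√(det g_{ij}) du₁ du₂` in every chart. -/
def area : Measure X := ⨆ x₀ : X, chartArea X x₀

end Area

/-! ### Compact domains with Lipschitz boundary -/

/-- The set `K` has a (possibly empty) Lipschitz boundary: near each of its boundary points, in a
suitable smooth chart, it is the region above the graph of a Lipschitz function. -/
def HasLipschitzBoundary {X : Type*} [TopologicalSpace X] [ChartedSpace Plane X]
    (K : Set X) : Prop :=
  ∀ p ∈ frontier K, ∃ e ∈ IsManifold.maximalAtlas 𝓘₂ ∞ X, p ∈ e.source ∧
    ∃ (γ : ℝ → ℝ) (C : ℝ≥0), LipschitzWith C γ ∧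
      ∀ q ∈ e.source, (q ∈ K ↔ γ (e q 0) ≤ e q 1)

/-- A connected compact surface, possibly with Lipschitz boundary, realised as a domain of a
surface `X` without boundary (`K = univ` is the case of a closed surface). -/
structure IsCompactDomain {X : Type*} [TopologicalSpace X] [ChartedSpace Plane X]
    (K : Set X) : Prop where
  isCompact : IsCompact K
  isConnected : IsConnected K
  lipschitzBoundary : HasLipschitzBoundary K

/-! ### Maps, homotheties and distortion energies -/

section Maps

variable {X : Type*} [EMetricSpace X] [ChartedSpace Plane X]
  {Y : Type*} [EMetricSpace Y] [ChartedSpace Plane Y]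

/-- The determinant of a linear map between tangent planes, in the coordinates of the preferred
charts. For oriented atlases its sign is that of the Jacobian. -/
def tangentDet {x : X} {y : Y} (A : TangentSpace 𝓘₂ x →L[ℝ] TangentSpace 𝓘₂ y) : ℝ :=
  ContinuousLinearMap.det (show Plane →L[ℝ] Plane from A)

variable [RiemannianBundle (fun x : X => TangentSpace 𝓘₂ x)]
  [RiemannianBundle (fun y : Y => TangentSpace 𝓘₂ y)]

/-- The class of Lipschitz maps `φ : K → L` with almost everywhere non-negative Jacobian which are
injective almost everywhere: almost every point of `L` has at most one preimage in `K`. Only the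
values of `φ` on `K` matter. -/
structure IsLipInj [MeasurableSpace X] [MeasurableSpace Y]
    (K : Set X) (L : Set Y) (φ : X → Y) : Prop where
  mapsTo : MapsTo φ K L
  lipschitz : ∃ C : ℝ≥0, LipschitzOnWith C φ K
  jacobian_nonneg : ∀ᵐ p ∂(area X).restrict K, 0 ≤ tangentDet (mfderivWithin 𝓘₂ 𝓘₂ φ K p)
  injective_ae : ∀ᵐ q ∂(area Y).restrict L, (K ∩ φ ⁻¹' {q}).Subsingleton

/-- The map `φ` is a homothety on `K`: the metric of the target pulls back to a positive constant
multiple `r²` of the metric of the source, at every point of `K`. -/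
def IsHomothety (K : Set X) (φ : X → Y) : Prop :=
  MDifferentiableOn 𝓘₂ 𝓘₂ φ K ∧ ∃ r : ℝ, 0 < r ∧
    ∀ p ∈ K, ∀ v w : TangentSpace 𝓘₂ p,
      inner ℝ (mfderivWithin 𝓘₂ 𝓘₂ φ K p v) (mfderivWithin 𝓘₂ 𝓘₂ φ K p w) = r ^ 2 * inner ℝ v w

/-- The cost `f(x)` of a singular value `x ≥ 0`, with values in `[0,∞]`; the function
`f : (0,∞) → [0,∞)` is extended to `x = 0` by its limit at `0`. -/
def cost (f : ℝ → ℝ) (x : ℝ) : ℝ≥0∞ :=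
  if 0 < x then ENNReal.ofReal (f x) else liminf (fun t => ENNReal.ofReal (f t)) (𝓝[>] 0)

instance {p : X} : FiniteDimensional ℝ (TangentSpace 𝓘₂ p) :=
  inferInstanceAs (FiniteDimensional ℝ Plane)

/-- The `i`-th singular value (`i = 0, 1`) of the differential of `φ : K → Y` at `p`. -/
def sigma (K : Set X) (φ : X → Y) (i : ℕ) (p : X) : ℝ :=
  LinearMap.singularValues (mfderivWithin 𝓘₂ 𝓘₂ φ K p).toLinearMap i

/-- The distortion energy `E_f(φ)`, the average over `K` of `f(σ₁(dφ)) + f(σ₂(dφ))`. -/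
def energy [MeasurableSpace X] (f : ℝ → ℝ) (K : Set X) (φ : X → Y) : ℝ≥0∞ :=
  (∫⁻ p in K, (cost f (sigma K φ 0 p) + cost f (sigma K φ 1 p)) ∂(area X)) / area X K

end Maps

/-- The bound `F_f(s)`: the infimum of `f(x) + f(y)` over `x, y > 0` with `x y = s`. For `s ≤ 0`
there are no such `x, y` and the value is `∞`. -/
def lowerBound (f : ℝ → ℝ) (s : ℝ) : ℝ≥0∞ :=
  sInf {t | ∃ x y : ℝ, 0 < x ∧ 0 < y ∧ x * y = s ∧ t = ENNReal.ofReal (f x + f y)}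

end

end SurfaceDistortion

set_option linter.unusedSectionVars false

/-! A single pointwise inequality does the work of Jensen's inequality. For `0 < m ≤ 1` there is `k
≥ 0` such that `f x + f y + k x y`, over `x, y ≥ 0`, is minimal at `x = y = √m` and nowhere else
(`exists_tilt`). In logarithmic variables a subgradient of `g` at `log √m ≤ 0` gives linear lower
bounds for both costs, and the tangent line of the exponential term cancels their slopes; positive
logarithms are truncated to `0`, which only lowers the expression. Let `m` be the mean of `σ₁σ₂`.
Integration gives `E_f ≥ 2 f(√m) = F_f(m)`, and equality forces `σ₁ = σ₂ = √m` almost everywhere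
(`lowerBound_meanJacobian_le`). The area formula for almost everywhere injective maps bounds `m` by
the ratio of the areas of image and source, and `F_f` decreases strictly on `(0, 1]`, so the bound
in terms of the image follows. Degenerate maps cost infinitely much because `g` tends to infinity at
`-∞`.

The equality case is a rigidity theorem: a Lipschitz, almost everywhere injective map whose
differential is almost everywhere `r` times an isometry is differentiable up to the boundary, with
such a differential at every point. Injectivity rules out folding, and it enters through areas. On a
disc of radius `R` in a chart, with both metrics frozen at the centre, the differential is isometric
up to a factor `1 + O(R)`. Averaging over translations turns this into a Lipschitz bound
(`norm_sub_le_of_ae_norm_fderiv_le`). If two points came too close together, the images of two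
disjoint discs around them would overlap and have too little area, so distances shrink at most by a
factor `1 - O(√R)` (`norm_sub_ge_of_ae_almost_isometric`). By polarization the map is linear up to
an error `O(R^{1/4}) R` (`exists_linear_approx`). Comparing scales yields a differential that is
Hölder continuous with exponent `1/4`, and chains of balls shrinking geometrically towards a
Lipschitz boundary extend it to the boundary (`exists_hasFDerivWithinAt_of_ae_isometric`).

Conversely, the energy of a homothety is a direct computation. For the bound in terms of the target,
strict monotonicity forces the image to have full area; being compact, it is then the whole target,
whose points are all limits of interior points. -/

namespace SurfaceDistortion

noncomputable section

/-! ### The scalar inequality behind Jensen's inequality -/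

/-- The standing assumptions on the function `g`, where `f = g ∘ log` is the cost. -/
structure IsProfile (g : ℝ → ℝ) : Prop where
  nonneg : ∀ x, 0 ≤ g x
  cont : Continuous g
  anti : StrictAntiOn g (Iic 0)
  conv : StrictConvexOn ℝ (Iic 0) g
  mono : StrictMonoOn g (Ici 0)
  zero : g 0 = 0

namespace IsProfile

variable {g : ℝ → ℝ} (hg : IsProfile g)
include hg

theorem pos_of_ne {a : ℝ} (ha : a ≠ 0) : 0 < g a := by
  rcases ha.lt_or_gt with h | h
  · simpa [hg.zero] using hg.anti h.le (mem_Iic.2 le_rfl) h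
  · simpa [hg.zero] using hg.mono (mem_Ici.2 le_rfl) h.le h

/-- A strict subgradient of `g` on the negative half line. -/
theorem exists_subgradient {c : ℝ} (hc : c ≤ 0) :
    ∃ κ : ℝ, 0 ≤ κ ∧ ∀ a ≤ 0, a ≠ c → g c - κ * (a - c) < g a := by
  -- At the endpoint `c = 0` slope zero serves, since `0` is the strict minimum of `g`. For `c < 0`
  -- the right derivative is used; comparison with `g 0 = 0 ≤ g c` shows that it is negative.
  rcases hc.eq_or_lt with rfl | hc
  · exact ⟨0, le_rfl, fun a _ hne => by simpa [hg.zero] using hg.pos_of_ne hne⟩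
  have hint : c ∈ interior (Iic (0 : ℝ)) := by simpa using hc
  have hcv := hg.conv.convexOn
  have key : ∀ a ≤ 0, a ≠ c → g c + derivWithin g (Ioi c) c * (a - c) < g a := by
    intro a ha hne
    rcases hne.lt_or_gt with h | h
    · have h1 := hg.conv.slope_lt_leftDeriv (mem_Iic.2 ha) (mem_Iic.2 hc.le) h
        (hcv.differentiableWithinAt_Iio_of_mem_interior hint)
      have h2 := h1.trans_le (hcv.leftDeriv_le_rightDeriv_of_mem_interior hint)
      rw [slope_def_field, div_lt_iff₀ (by linarith)] at h2
      linarith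
    · have h1 := hg.conv.rightDeriv_lt_slope (mem_Iic.2 hc.le) (mem_Iic.2 ha) h
        (hcv.differentiableWithinAt_Ioi_of_mem_interior hint)
      rw [slope_def_field, lt_div_iff₀ (by linarith)] at h1
      linarith
  refine ⟨-derivWithin g (Ioi c) c, ?_, fun a ha hne => by linarith [key a ha hne]⟩
  have h0 := key 0 le_rfl hc.ne'
  have h1 := hg.nonneg c
  rw [hg.zero] at h0
  by_contra! h
  nlinarith [mul_pos (neg_lt_zero.1 h) (neg_pos.2 hc)]

/-- The logarithmic form of the tilted inequality. -/
theorem exists_tilt_log {c : ℝ} (hc : c ≤ 0) :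
    ∃ k : ℝ, 0 ≤ k ∧ ∀ a b : ℝ,
      2 * g c + k * Real.exp (2 * c) ≤ g a + g b + k * Real.exp (a + b) ∧
      (g a + g b + k * Real.exp (a + b) = 2 * g c + k * Real.exp (2 * c) → a = c ∧ b = c) := by
  obtain ⟨κ, hκ, hsub⟩ := hg.exists_subgradient hc
  have hsub' : ∀ a ≤ 0, g c - κ * (a - c) ≤ g a := by
    intro a ha
    by_cases h : a = c
    · simp [h]
    · exact (hsub a ha h).le
  -- With this `k` the function `s ↦ k * exp s` has slope `κ` at `s = 2c`, so its tangent line there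
  -- cancels the terms `-κ (a - c) - κ (b - c)` of the two subgradient bounds.
  set k := κ * Real.exp (-(2 * c)) with hk
  have hk0 : 0 ≤ k := by positivity
  have hexp : ∀ s, k * Real.exp (2 * c) + κ * (s - 2 * c) ≤ k * Real.exp s := by
    intro s
    have h1 : k * Real.exp (2 * c) = κ := by
      rw [hk, mul_assoc, ← Real.exp_add]; simp
    have h2 : k * Real.exp s = κ * Real.exp (s - 2 * c) := by
      rw [hk, mul_assoc, ← Real.exp_add]; congr 2; ring
    rw [h1, h2]
    nlinarith [Real.add_one_le_exp (s - 2 * c)]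
  have hneg : ∀ a ≤ 0, ∀ b ≤ 0,
      2 * g c + k * Real.exp (2 * c) ≤ g a + g b + k * Real.exp (a + b) ∧
      (g a + g b + k * Real.exp (a + b) = 2 * g c + k * Real.exp (2 * c) → a = c ∧ b = c) := by
    intro a ha b hb
    have h1 := hexp (a + b)
    have h2 := hsub' a ha
    have h3 := hsub' b hb
    refine ⟨by linarith, fun h => ?_⟩
    by_contra hne
    rw [not_and_or] at hne
    rcases hne with hne | hne
    · have := hsub a ha hne; linarith
    · have := hsub b hb hne; linarith
  -- Replacing a positive argument by `0` strictly lowers `g` and does not raise the exponential, so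
  -- the case of nonpositive arguments suffices, also for equality.
  have htrunc : ∀ a, g (min a 0) ≤ g a ∧ (0 < a → g (min a 0) < g a) := by
    intro a
    rcases le_or_gt a 0 with h | h
    · simp [h]
    · rw [min_eq_right h.le, hg.zero]
      exact ⟨hg.nonneg a, fun _ => hg.pos_of_ne h.ne'⟩
  refine ⟨k, hk0, fun a b => ?_⟩
  have h := hneg (min a 0) (min_le_right _ _) (min b 0) (min_le_right _ _)
  have he : k * Real.exp (min a 0 + min b 0) ≤ k * Real.exp (a + b) :=
    mul_le_mul_of_nonneg_left (Real.exp_le_exp.2 (add_le_add (min_le_left _ _) (min_le_left _ _)))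
      hk0
  refine ⟨by linarith [(htrunc a).1, (htrunc b).1, h.1], fun heq => ?_⟩
  have ha : a ≤ 0 := by
    by_contra! hpos
    linarith [(htrunc a).2 hpos, (htrunc b).1, h.1]
  have hb : b ≤ 0 := by
    by_contra! hpos
    linarith [(htrunc b).2 hpos, (htrunc a).1, h.1]
  exact (hneg a ha b hb).2 heq

/-- The subgradient at `-1` has strictly positive slope because `0 ≤ g (-1)` and `g 0 = 0`, so `g`
lies above a line that tends to infinity at `-∞`. -/
theorem tendsto_atBot : Tendsto g atBot atTop := by
  obtain ⟨κ, hκ, hsub⟩ := hg.exists_subgradient (c := -1) (by norm_num)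
  have hκ' : 0 < κ := by
    have h0 := hsub 0 le_rfl (by norm_num)
    rw [hg.zero] at h0
    linarith [hg.nonneg (-1)]
  have hlin : Tendsto (fun a : ℝ => g (-1) - κ * (a - -1)) atBot atTop := by
    have h1 : Tendsto (fun a : ℝ => -κ * a) atBot atTop :=
      tendsto_id.const_mul_atBot_of_neg (neg_neg_of_pos hκ')
    have h2 := tendsto_atTop_add_const_left atBot (g (-1) - κ) h1
    refine h2.congr fun a => by ring
  refine tendsto_atTop_mono' _ ?_ hlin
  filter_upwards [eventually_lt_atBot (-1)] with a ha
  exact (hsub a (by linarith) ha.ne).le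

/-- The function whose minimum defines the lower bound attains its minimum. -/
theorem exists_min_add (t : ℝ) : ∃ a, ∀ b, g a + g (t - a) ≤ g b + g (t - b) := by
  have hcont : Continuous fun a => g a + g (t - a) :=
    hg.cont.add (hg.cont.comp (continuous_const.sub continuous_id))
  have hbot : Tendsto (fun a => g a + g (t - a)) atBot atTop :=
    tendsto_atTop_mono (fun a => by linarith [hg.nonneg (t - a)]) hg.tendsto_atBot
  have htop : Tendsto (fun a => g a + g (t - a)) atTop atTop := by
    have h1 : Tendsto (fun a : ℝ => t - a) atTop atBot := by
      simpa [sub_eq_add_neg] using tendsto_atBot_add_const_left atTop t tendsto_neg_atTop_atBot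
    exact tendsto_atTop_mono (fun a => by simpa using hg.nonneg a) (hg.tendsto_atBot.comp h1)
  refine hcont.exists_forall_le ?_
  rw [cocompact_eq_atBot_atTop]
  exact hbot.sup htop

end IsProfile

/-! ### The cost of singular values and the bound `F_f` -/

section Cost

variable {g f : ℝ → ℝ} (hg : IsProfile g) (hf : ∀ x, 0 < x → f x = g (Real.log x))
include hg hf

theorem f_nonneg {x : ℝ} (hx : 0 < x) : 0 ≤ f x := by rw [hf x hx]; exact hg.nonneg _

/-- Writing `x = exp a` turns the constraint into `y = exp (log s - a)`, so a minimum over the line,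
which exists by coercivity of `g` at `-∞`, gives the minimizer. -/
theorem lowerBound_attained {s : ℝ} (hs : 0 < s) :
    ∃ x y : ℝ, 0 < x ∧ 0 < y ∧ x * y = s ∧ lowerBound f s = ENNReal.ofReal (f x + f y) := by
  obtain ⟨a, ha⟩ := hg.exists_min_add (Real.log s)
  have hxy : Real.exp a * Real.exp (Real.log s - a) = s := by
    rw [← Real.exp_add, add_sub_cancel, Real.exp_log hs]
  refine ⟨Real.exp a, Real.exp (Real.log s - a), Real.exp_pos _, Real.exp_pos _, hxy, ?_⟩
  refine le_antisymm (sInf_le ⟨_, _, Real.exp_pos _, Real.exp_pos _, hxy, rfl⟩) (le_sInf ?_)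
  rintro _ ⟨x, y, hx, hy, rfl, rfl⟩
  apply ENNReal.ofReal_le_ofReal
  rw [hf _ (Real.exp_pos _), hf _ (Real.exp_pos _), Real.log_exp, Real.log_exp, hf x hx, hf y hy]
  have := ha (Real.log x)
  rwa [show Real.log (x * y) - Real.log x = Real.log y by
    rw [Real.log_mul hx.ne' hy.ne']; ring] at this

/-- The limit of `f` at `0` is the limit of `g` at `-∞`. Hence maps with degenerate differential on
a set of positive area have infinite energy. -/
theorem cost_zero : cost f 0 = ⊤ := by
  rw [cost, if_neg (lt_irrefl _)]
  apply Tendsto.liminf_eq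
  have h1 : Tendsto (fun t => ENNReal.ofReal (g (Real.log t))) (𝓝[>] 0) (𝓝 ⊤) :=
    ENNReal.tendsto_ofReal_atTop.comp (hg.tendsto_atBot.comp Real.tendsto_log_nhdsGT_zero)
  refine h1.congr' ?_
  filter_upwards [self_mem_nhdsWithin] with t ht
  rw [hf t ht]

omit hg hf in
theorem cost_of_pos {x : ℝ} (hx : 0 < x) : cost f x = ENNReal.ofReal (f x) := if_pos hx

theorem measurable_cost : Measurable (cost f) := by
  have h1 : Measurable fun x : ℝ => ENNReal.ofReal (g (Real.log x)) :=
    (hg.cont.measurable.comp Real.measurable_log).ennreal_ofReal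
  have : cost f = fun x => if 0 < x then ENNReal.ofReal (g (Real.log x)) else
      liminf (fun t => ENNReal.ofReal (f t)) (𝓝[>] 0) := by
    ext x
    rw [cost]
    split_ifs with h
    · rw [hf x h]
    · rfl
  rw [this]
  exact Measurable.ite measurableSet_Ioi h1 measurable_const

/-- The tilted cost `f(x) + f(y) + k x y` is minimal exactly at `x = y = √m`. -/
theorem exists_tilt {m : ℝ} (hm : 0 < m) (hm1 : m ≤ 1) :
    ∃ k : ℝ, 0 ≤ k ∧ ∀ x y : ℝ, 0 ≤ x → 0 ≤ y →
      ENNReal.ofReal (2 * f (√m) + k * m) ≤ cost f x + cost f y + ENNReal.ofReal (k * (x * y)) ∧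
      (cost f x + cost f y + ENNReal.ofReal (k * (x * y)) = ENNReal.ofReal (2 * f (√m) + k * m) →
        x = √m ∧ y = √m) := by
  have hsm : 0 < √m := Real.sqrt_pos.2 hm
  have hlog : Real.log (√m) ≤ 0 := Real.log_nonpos hsm.le (Real.sqrt_le_one.2 hm1)
  obtain ⟨k, hk, h⟩ := hg.exists_tilt_log hlog
  have hexp : Real.exp (2 * Real.log (√m)) = m := by
    rw [two_mul, Real.exp_add, Real.exp_log hsm, Real.mul_self_sqrt hm.le]
  refine ⟨k, hk, fun x y hx hy => ?_⟩
  rcases hx.eq_or_lt with rfl | hx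
  · simp [cost_zero hg hf]
  rcases hy.eq_or_lt with rfl | hy
  · simp [cost_zero hg hf]
  rw [cost_of_pos hx, cost_of_pos hy, ← ENNReal.ofReal_add (f_nonneg hg hf hx)
    (f_nonneg hg hf hy), ← ENNReal.ofReal_add (add_nonneg (f_nonneg hg hf hx) (f_nonneg hg hf hy))
    (by positivity)]
  obtain ⟨h1, h2⟩ := h (Real.log x) (Real.log y)
  rw [Real.exp_add, Real.exp_log hx, Real.exp_log hy, hexp, ← hf x hx, ← hf y hy, ← hf _ hsm] at h1 h2
  refine ⟨ENNReal.ofReal_le_ofReal h1, fun heq => ?_⟩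
  rw [ENNReal.ofReal_eq_ofReal_iff] at heq
  · obtain ⟨h3, h4⟩ := h2 heq
    exact ⟨Real.log_injOn_pos hx hsm h3, Real.log_injOn_pos hy hsm h4⟩
  · have := f_nonneg hg hf hx
    have := f_nonneg hg hf hy
    positivity
  · have := f_nonneg hg hf hsm
    positivity

/-- On the curve `x y = s` the tilt `k x y` is constant and cancels, so the unconstrained minimizer
`x = y = √s` of the tilted cost also solves the constrained problem. The condition `s ≤ 1` puts `log
√s` in the region of convexity. -/
theorem lowerBound_eq {s : ℝ} (hs : 0 < s) (hs1 : s ≤ 1) :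
    lowerBound f s = ENNReal.ofReal (2 * f (√s)) := by
  have hsm : 0 < √s := Real.sqrt_pos.2 hs
  refine le_antisymm (sInf_le ⟨√s, √s, hsm, hsm, Real.mul_self_sqrt hs.le, by rw [two_mul]⟩)
    (le_sInf ?_)
  rintro _ ⟨x, y, hx, hy, hxy, rfl⟩
  obtain ⟨k, hk, h⟩ := exists_tilt hg hf hs hs1
  have h1 := (h x y hx.le hy.le).1
  rw [hxy, cost_of_pos hx, cost_of_pos hy, ENNReal.ofReal_add
    (by have := f_nonneg hg hf hsm; positivity) (by positivity)] at h1
  rw [ENNReal.ofReal_add (f_nonneg hg hf hx) (f_nonneg hg hf hy)]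
  exact (ENNReal.add_le_add_iff_right ENNReal.ofReal_ne_top).1 h1

theorem f_strictAnti {s t : ℝ} (hs : 0 < s) (hst : s < t) (ht : t ≤ 1) : f t < f s := by
  rw [hf s hs, hf t (hs.trans hst)]
  exact hg.anti (Real.log_nonpos hs.le (hst.le.trans ht)) (Real.log_nonpos (hs.trans hst).le ht)
    (Real.log_lt_log hs hst)

theorem lowerBound_strictAnti {s t : ℝ} (hs : 0 < s) (hst : s < t) (ht : t ≤ 1) :
    lowerBound f t < lowerBound f s := by
  rw [lowerBound_eq hg hf hs (hst.le.trans ht), lowerBound_eq hg hf (hs.trans hst) ht]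
  have h := f_strictAnti hg hf (Real.sqrt_pos.2 hs) (Real.sqrt_lt_sqrt hs.le hst)
    (Real.sqrt_le_one.2 ht)
  rw [ENNReal.ofReal_lt_ofReal_iff_of_nonneg]
  · linarith
  · have := f_nonneg hg hf (Real.sqrt_pos.2 (hs.trans hst)); positivity

omit hg hf in
theorem lowerBound_of_nonpos {s : ℝ} (hs : s ≤ 0) : lowerBound f s = ⊤ := by
  rw [lowerBound, sInf_eq_top]
  rintro _ ⟨x, y, hx, hy, rfl, rfl⟩
  exact absurd (mul_pos hx hy) (not_lt.2 hs)

theorem lowerBound_anti {s t : ℝ} (hst : s ≤ t) (ht : t ≤ 1) :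
    lowerBound f t ≤ lowerBound f s := by
  rcases le_or_gt s 0 with h | h
  · rw [lowerBound_of_nonpos h]; exact le_top
  rcases hst.eq_or_lt with rfl | hst
  · rfl
  exact (lowerBound_strictAnti hg hf h hst ht).le

end Cost


/-! ### Singular values in dimension two -/

section SingularValues

variable {V W : Type*} [NormedAddCommGroup V] [InnerProductSpace ℝ V] [FiniteDimensional ℝ V]
  [NormedAddCommGroup W] [InnerProductSpace ℝ W] [FiniteDimensional ℝ W]

/-- An eigenbasis of `T* T` diagonalizes the quadratic form `‖T v‖ ^ 2`; the facts below relating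
singular values to norms are read off from this formula. -/
theorem exists_singular_basis (hV : Module.finrank ℝ V = 2) (T : V →ₗ[ℝ] W) :
    ∃ b : OrthonormalBasis (Fin 2) ℝ V, ∀ v, ‖T v‖ ^ 2 =
      T.singularValues 0 ^ 2 * inner ℝ (b 0) v ^ 2 + T.singularValues 1 ^ 2 * inner ℝ (b 1) v ^ 2 := by
  have hS := T.isSymmetric_adjoint_comp_self
  refine ⟨hS.eigenvectorBasis hV, fun v => ?_⟩
  set b := hS.eigenvectorBasis hV
  have h1 : ‖T v‖ ^ 2 = inner ℝ ((LinearMap.adjoint T ∘ₗ T) v) v := by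
    rw [LinearMap.comp_apply, LinearMap.adjoint_inner_left, real_inner_self_eq_norm_sq]
  have h2 : ∀ i : Fin 2, inner ℝ ((LinearMap.adjoint T ∘ₗ T) v) (b i) =
      T.singularValues i ^ 2 * inner ℝ (b i) v := by
    intro i
    rw [hS v (b i), hS.apply_eigenvectorBasis hV i, T.sq_singularValues_fin hV i,
      real_inner_comm]
    simp [inner_smul_left, b]
  rw [h1, ← b.sum_inner_mul_inner, Fin.sum_univ_two, h2, h2]
  simp only [Fin.val_zero, Fin.val_one]
  ring

theorem normDet_eq_mul_singularValues (hV : Module.finrank ℝ V = 2) (T : V →ₗ[ℝ] W) :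
    T.normDet = T.singularValues 0 * T.singularValues 1 := by
  rw [T.normDet_eq_prod_singularValues, hV, Finset.prod_range_succ, Finset.prod_range_one]

omit [FiniteDimensional ℝ V] in
theorem norm_sq_eq_inner_sq_add (b : OrthonormalBasis (Fin 2) ℝ V) (v : V) :
    ‖v‖ ^ 2 = inner ℝ (b 0) v ^ 2 + inner ℝ (b 1) v ^ 2 := by
  rw [← b.sum_sq_inner_right v, Fin.sum_univ_two]

theorem exists_norm_eq_singularValues (hV : Module.finrank ℝ V = 2) (T : V →ₗ[ℝ] W) :
    (∃ v, ‖v‖ = 1 ∧ ‖T v‖ = T.singularValues 0) ∧ ∃ v, ‖v‖ = 1 ∧ ‖T v‖ = T.singularValues 1 := by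
  obtain ⟨b, hb⟩ := exists_singular_basis hV T
  refine ⟨⟨b 0, b.norm_eq_one 0, ?_⟩, ⟨b 1, b.norm_eq_one 1, ?_⟩⟩
  · rw [← sq_eq_sq₀ (norm_nonneg _) (T.singularValues_nonneg _), hb, b.inner_eq_one,
      b.inner_eq_zero (by decide)]
    ring
  · rw [← sq_eq_sq₀ (norm_nonneg _) (T.singularValues_nonneg _), hb, b.inner_eq_one,
      b.inner_eq_zero (by decide)]
    ring

theorem singularValues_zero_le_iff (hV : Module.finrank ℝ V = 2) (T : V →ₗ[ℝ] W) {c : ℝ}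
    (hc : 0 ≤ c) : T.singularValues 0 ≤ c ↔ ∀ v, ‖T v‖ ≤ c * ‖v‖ := by
  constructor
  · intro h v
    obtain ⟨b, hb⟩ := exists_singular_basis hV T
    have h0 := T.singularValues_nonneg 0
    have h1 := T.singularValues_nonneg 1
    have h10 : T.singularValues 1 ≤ c := (T.singularValues_antitone zero_le_one).trans h
    rw [← sq_le_sq₀ (norm_nonneg _) (by positivity), mul_pow, hb, norm_sq_eq_inner_sq_add b, mul_add]
    gcongr
  · intro h
    obtain ⟨⟨v, hv, hv'⟩, -⟩ := exists_norm_eq_singularValues hV T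
    have := h v
    rwa [hv', hv, mul_one] at this

theorem singularValues_eq_iff (hV : Module.finrank ℝ V = 2) (T : V →ₗ[ℝ] W) {r : ℝ} (hr : 0 ≤ r) :
    (T.singularValues 0 = r ∧ T.singularValues 1 = r) ↔ ∀ v, ‖T v‖ = r * ‖v‖ := by
  constructor
  · rintro ⟨h0, h1⟩ v
    obtain ⟨b, hb⟩ := exists_singular_basis hV T
    rw [← sq_eq_sq₀ (norm_nonneg _) (by positivity), mul_pow, hb, norm_sq_eq_inner_sq_add b, h0, h1,
      mul_add]
  · intro h
    obtain ⟨⟨v, hv, hv'⟩, ⟨w, hw, hw'⟩⟩ := exists_norm_eq_singularValues hV T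
    rw [← hv', ← hw', h, h, hv, hw, mul_one]
    simp

omit [FiniteDimensional ℝ V] [FiniteDimensional ℝ W] in
theorem inner_map_eq_of_norm_map_eq (T : V →ₗ[ℝ] W) {r : ℝ} (h : ∀ v, ‖T v‖ = r * ‖v‖) (v w : V) :
    inner ℝ (T v) (T w) = r ^ 2 * inner ℝ v w := by
  have h1 := norm_add_sq_real (T v) (T w)
  have h2 := norm_add_sq_real v w
  rw [← map_add, h, h, h, mul_pow, mul_pow, mul_pow, h2] at h1
  linarith

omit [FiniteDimensional ℝ V] [FiniteDimensional ℝ W] in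
theorem norm_map_eq_of_inner_map_eq (T : V →ₗ[ℝ] W) {r : ℝ} (hr : 0 ≤ r)
    (h : ∀ v w, inner ℝ (T v) (T w) = r ^ 2 * inner ℝ v w) (v : V) : ‖T v‖ = r * ‖v‖ := by
  rw [← sq_eq_sq₀ (norm_nonneg _) (by positivity), mul_pow, ← real_inner_self_eq_norm_sq,
    ← real_inner_self_eq_norm_sq, h]

theorem finrank_plane : Module.finrank ℝ Plane = 2 := by simp

omit [FiniteDimensional ℝ V] in
-- Identifies the area density `√(det g_{ij})` with the Jacobian of the coordinate frame, so that
-- multiplicativity of `normDet` governs changes of charts.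
theorem normDet_of_plane (T : Plane →ₗ[ℝ] V) :
    T.normDet = √(Matrix.of fun i j : Fin 2 => inner ℝ (T (EuclideanSpace.single i (1 : ℝ)))
      (T (EuclideanSpace.single j (1 : ℝ)))).det := by
  have h := T.normDet_sq_eq_det_gram (EuclideanSpace.basisFun (Fin 2) ℝ)
  rw [← Real.sqrt_sq T.normDet_nonneg]
  congr 1
  simpa [Matrix.gram, Matrix.of] using h

theorem sq_le_abs_det {A : Plane →L[ℝ] Plane} {c : ℝ} (hc : 0 ≤ c) (h : ∀ w, c * ‖w‖ ≤ ‖A w‖) :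
    c ^ 2 ≤ |A.det| := by
  obtain ⟨⟨v, hv, hv'⟩, ⟨w, hw, hw'⟩⟩ := exists_norm_eq_singularValues finrank_plane A.toLinearMap
  have h1 : A.toLinearMap.normDet = |A.det| := LinearMap.normDet_eq_abs_det _
  rw [← h1, normDet_eq_mul_singularValues finrank_plane, ← hv', ← hw', sq]
  have h2 := h v
  have h3 := h w
  rw [hv, mul_one] at h2
  rw [hw, mul_one] at h3
  exact mul_le_mul h2 h3 hc (norm_nonneg _)

end SingularValues

/-! ### The area formula in the plane -/

section PlaneArea

/-- The area formula for a differentiable map which is injective up to a null set of the target. -/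
theorem lintegral_image_of_injOn_diff_null {s Q : Set Plane} {F : Plane → Plane}
    {F' : Plane → Plane →L[ℝ] Plane} (hs : MeasurableSet s) (hQ : MeasurableSet Q)
    (hQ0 : volume Q = 0) (hF : ∀ u ∈ s, HasFDerivWithinAt F (F' u) s u)
    (hinj : InjOn F (s \ F ⁻¹' Q)) (g : Plane → ℝ≥0∞) :
    NullMeasurableSet (F '' s) ∧
    ∫⁻ u in s, ENNReal.ofReal |(F' u).det| * g (F u) = ∫⁻ z in F '' s, g z := by
  have hcont : ContinuousOn F s := fun u hu => (hF u hu).continuousWithinAt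
  -- The preimage `t` of the exceptional values need not be null. Its image is, so the Jacobian must
  -- vanish almost everywhere on it, and off `t` the usual change of variables applies.
  set t := s ∩ F ⁻¹' Q with ht_def
  have ht : MeasurableSet t := by
    obtain ⟨v, hv⟩ := (measurable_id.comp (hcont.domRestrict.measurable) :
      Measurable (s.domRestrict F)) hQ
    have : t = s ∩ v := by
      ext u
      have h2 := congrArg (fun A : Set s => ∃ h : u ∈ s, (⟨u, h⟩ : s) ∈ A) hv.2
      simp only [mem_preimage, eq_iff_iff] at h2
      constructor
      · rintro ⟨h3, h4⟩; exact ⟨h3, (h2.2 ⟨h3, h4⟩).2⟩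
      · rintro ⟨h3, h4⟩; exact ⟨h3, (h2.1 ⟨h3, h4⟩).2⟩
    rw [this]
    exact hs.inter hv.1
  have hst : s \ F ⁻¹' Q = s \ t := by ext u; simp [t]
  have hd : MeasurableSet (s \ t) := hs.diff ht
  have hts : t ⊆ s := inter_subset_left
  have hFd : ∀ u ∈ s \ t, HasFDerivWithinAt F (F' u) (s \ t) u :=
    fun u hu => (hF u hu.1).mono sdiff_subset
  rw [hst] at hinj
  have himt : volume (F '' t) = 0 :=
    measure_mono_null (image_subset_iff.2 inter_subset_right) hQ0
  have hunion : F '' s = F '' (s \ t) ∪ F '' t := by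
    rw [← image_union, sdiff_union_of_subset hts]
  have hae : F '' s =ᵐ[volume] F '' (s \ t) := by
    rw [hunion]
    exact union_ae_eq_left_of_ae_eq_empty (ae_eq_empty.2 himt)
  have hmeas : MeasurableSet (F '' (s \ t)) := measurable_image_of_fderivWithin hd hFd hinj
  refine ⟨hmeas.nullMeasurableSet.congr hae.symm, ?_⟩
  -- the Jacobian vanishes almost everywhere on `t`
  have hdet : ∫⁻ u in t, ENNReal.ofReal |(F' u).det| * g (F u) = 0 := by
    have hr : ∀ A : Plane →L[ℝ] Plane, ∃ δ : ℝ≥0, 0 < δ ∧ ∀ (w : Set Plane),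
        ApproximatesLinearOn F A w δ → A.det ≠ 0 → InjOn F w := by
      intro A
      by_cases hA : A.det = 0
      · exact ⟨1, one_pos, fun w _ h => absurd hA h⟩
      · let B := A.toContinuousLinearEquivOfDetNeZero hA
        have hB : (B : Plane →L[ℝ] Plane) = A := A.coe_toContinuousLinearEquivOfDetNeZero hA
        have hpos : 0 < ‖(B.symm : Plane →L[ℝ] Plane)‖₊⁻¹ := by
          rw [inv_pos]
          exact B.nnnorm_symm_pos
        refine ⟨‖(B.symm : Plane →L[ℝ] Plane)‖₊⁻¹ / 2, half_pos hpos, fun w hw _ => ?_⟩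
        rw [← hB] at hw
        exact hw.injOn (Or.inr (half_lt_self hpos))
    choose r hr0 hr using hr
    have hmeasdet := aemeasurable_ofReal_abs_det_fderivWithin volume ht
      (fun u hu => (hF u (hts hu)).mono hts)
    suffices h : ∫⁻ u in t, ENNReal.ofReal |(F' u).det| = 0 by
      rw [lintegral_eq_zero_iff' hmeasdet] at h
      apply lintegral_eq_zero_of_ae_eq_zero
      filter_upwards [h] with u hu
      simp [show ENNReal.ofReal |(F' u).det| = 0 from hu]
    have hF'm : AEMeasurable F' (volume.restrict t) :=
      aemeasurable_fderivWithin volume ht (fun u hu => (hF u (hts hu)).mono hts)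
    set Z := toMeasurable (volume.restrict t) {u | F' u ≠ hF'm.mk F' u} with hZ
    have hZm : MeasurableSet Z := measurableSet_toMeasurable _ _
    have hZ0 : volume.restrict t Z = 0 := by
      rw [hZ, measure_toMeasurable]
      exact hF'm.ae_eq_mk
    have hZmem : ∀ u, u ∉ Z → F' u = hF'm.mk F' u := fun u hu => by
      by_contra h
      exact hu (subset_toMeasurable _ _ h)
    -- Off the null set `Z` the derivative agrees with a measurable version, which makes `t'`
    -- measurable. On `t'` the derivative is invertible, and `t'` splits into countably many pieces
    -- on which `F` is so close to an invertible linear map that it is injective. There the integral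
    -- of `|det F'|` is the area of a subset of the null set `F '' t`.
    set t' := (t \ Z) ∩ {u | (hF'm.mk F' u).det ≠ 0} with ht'
    have ht'm : MeasurableSet t' := (ht.diff hZm).inter
      ((ContinuousLinearMap.continuous_det.measurable.comp hF'm.measurable_mk)
        (measurableSet_singleton (0 : ℝ)).compl)
    have ht't : t' ⊆ t := inter_subset_left.trans sdiff_subset
    have hzero : ∀ u ∈ t \ Z, u ∉ t' → (F' u).det = 0 := by
      intro u hu hut
      by_contra h
      exact hut ⟨hu, by rw [mem_ofPred_eq, ← hZmem u hu.2]; exact h⟩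
    obtain ⟨p, A, hpd, hpm, hpc, hpA, hAy⟩ :=
      exists_partition_approximatesLinearOn_of_hasFDerivWithinAt F t' F'
        (fun u hu => (hF u (hts (ht't hu))).mono (ht't.trans hts)) r (fun A => (hr0 A).ne')
    have hpiece : ∀ n, ∫⁻ u in t' ∩ p n, ENNReal.ofReal |(F' u).det| = 0 := by
      intro n
      rcases (t' ∩ p n).eq_empty_or_nonempty with h | h
      · simp [h]
      obtain ⟨y, hy, hAn⟩ := hAy (h.mono inter_subset_left) n
      have hinj' : InjOn F (t' ∩ p n) := hr (A n) _ (hpA n) (by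
        rw [hAn, hZmem y hy.1.2]; exact hy.2)
      rw [lintegral_abs_det_fderiv_eq_addHaar_image volume (ht'm.inter (hpm n))
        (fun u hu => (hF u (hts (ht't hu.1))).mono (inter_subset_left.trans (ht't.trans hts))) hinj']
      exact measure_mono_null (image_mono (inter_subset_left.trans ht't)) himt
    have ht'0 : ∫⁻ u in t', ENNReal.ofReal |(F' u).det| = 0 := by
      have : t' = ⋃ n, t' ∩ p n := by
        rw [← inter_iUnion, inter_eq_left.2 hpc]
      rw [this, ← nonpos_iff_eq_zero]
      refine (lintegral_iUnion_le _ _).trans ?_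
      simp [hpiece]
    rw [← lintegral_inter_add_sdiff _ t ht'm, inter_eq_right.2 ht't, ht'0, zero_add]
    rw [lintegral_eq_zero_iff' (hmeasdet.mono_set sdiff_subset)]
    have h3 : ∀ᵐ u ∂volume.restrict (t \ t'), u ∉ Z :=
      ae_mono (Measure.restrict_mono sdiff_subset le_rfl) (measure_eq_zero_iff_ae_notMem.1 hZ0)
    filter_upwards [h3, ae_restrict_mem (ht.diff ht'm)] with u hu hut
    simp [hzero u ⟨hut.1, hu⟩ hut.2]
  have h1 : ∫⁻ u in s, ENNReal.ofReal |(F' u).det| * g (F u) =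
      ∫⁻ u in s \ t, ENNReal.ofReal |(F' u).det| * g (F u) := by
    rw [← lintegral_inter_add_sdiff _ s ht, inter_eq_right.2 hts, hdet, zero_add]
  rw [h1, setLIntegral_congr hae,
    lintegral_image_eq_lintegral_abs_det_fderiv_mul volume hd hFd hinj]

end PlaneArea


/-! ### Almost isometric maps of the plane -/

section AlmostIsometric

open Metric

/-- Trades uniqueness of preimages of almost every value for genuine injectivity off the preimage of
a measurable null set of values, the form in which the planar area formula uses it. -/
theorem exists_null_injOn {α β : Type*} [MeasurableSpace β] {μ : Measure β} {S : Set α} {F : α → β}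
    (h : ∀ᵐ z ∂μ, (S ∩ F ⁻¹' {z}).Subsingleton) :
    ∃ Q, MeasurableSet Q ∧ μ Q = 0 ∧ InjOn F (S \ F ⁻¹' Q) := by
  refine ⟨toMeasurable μ {z | ¬ (S ∩ F ⁻¹' {z}).Subsingleton}, measurableSet_toMeasurable _ _,
    by rw [measure_toMeasurable]; exact h, fun x hx y hy hxy => ?_⟩
  have h1 : (S ∩ F ⁻¹' {F x}).Subsingleton := by
    by_contra h2
    exact hx.2 (subset_toMeasurable μ _ h2)
  exact h1 ⟨hx.1, rfl⟩ ⟨hy.1, hxy.symm⟩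

/-- The area formula with the Jacobian bounded below. This is the point where injectivity enters the
rigidity argument. -/
theorem mul_volume_le_volume_image {S : Set Plane} (hS : MeasurableSet S) {F : Plane → Plane} {c : ℝ}
    (hder : ∀ᵐ u : Plane, u ∈ S → ∃ A : Plane →L[ℝ] Plane, HasFDerivWithinAt F A S u ∧ c ≤ |A.det|)
    (hinj : ∀ᵐ z : Plane, (S ∩ F ⁻¹' {z}).Subsingleton) :
    ENNReal.ofReal c * volume S ≤ volume (F '' S) := by
  obtain ⟨Q, hQm, hQ0, hQ⟩ := exists_null_injOn hinj
  set Z := toMeasurable volume {u | ¬ (u ∈ S → ∃ A : Plane →L[ℝ] Plane,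
    HasFDerivWithinAt F A S u ∧ c ≤ |A.det|)} with hZ
  have hZ0 : volume Z = 0 := by rw [hZ, measure_toMeasurable]; exact hder
  have hZm : MeasurableSet Z := measurableSet_toMeasurable _ _
  have hex : ∀ u, ∃ A : Plane →L[ℝ] Plane, u ∈ S \ Z → HasFDerivWithinAt F A S u ∧ c ≤ |A.det| := by
    intro u
    by_cases hu : u ∈ S \ Z
    · have : ∃ A : Plane →L[ℝ] Plane, HasFDerivWithinAt F A S u ∧ c ≤ |A.det| := by
        by_contra h
        exact hu.2 (subset_toMeasurable volume _ (fun h' => h (h' hu.1)))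
      obtain ⟨A, hA⟩ := this
      exact ⟨A, fun _ => hA⟩
    · exact ⟨0, fun h => absurd h hu⟩
  choose F' hF' using hex
  have h1 := (lintegral_image_of_injOn_diff_null (hS.diff hZm) hQm hQ0
    (fun u hu => (hF' u hu).1.mono sdiff_subset)
    (hQ.mono (sdiff_subset_sdiff_left sdiff_subset)) (fun _ => 1)).2
  simp only [mul_one, lintegral_one, Measure.restrict_apply_univ] at h1
  calc ENNReal.ofReal c * volume S = ENNReal.ofReal c * volume (S \ Z) := by
        rw [measure_sdiff_null hZ0]
    _ = ∫⁻ u in S \ Z, ENNReal.ofReal c := by rw [setLIntegral_const]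
    _ ≤ ∫⁻ u in S \ Z, ENNReal.ofReal |(F' u).det| :=
        setLIntegral_mono' (hS.diff hZm) fun u hu => ENNReal.ofReal_le_ofReal (hF' u hu).2
    _ = volume (F '' (S \ Z)) := h1
    _ ≤ volume (F '' S) := measure_mono (image_mono sdiff_subset)

/-- A Lipschitz map whose differential is almost everywhere bounded by `C` is `C`-Lipschitz on
balls. -/
theorem norm_sub_le_of_ae_norm_fderiv_le {F : Plane → Plane} {x₀ : Plane} {R C : ℝ} {K : ℝ≥0}
    (hF : LipschitzOnWith K F (ball x₀ R))
    (hder : ∀ᵐ u : Plane, u ∈ ball x₀ R →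
      ∃ A : Plane →L[ℝ] Plane, HasFDerivAt F A u ∧ ∀ w, ‖A w‖ ≤ C * ‖w‖)
    {x y : Plane} (hx : x ∈ ball x₀ R) (hy : y ∈ ball x₀ R) :
    ‖F y - F x‖ ≤ C * ‖y - x‖ := by
  -- The extension makes averages over translates available everywhere. Its Lipschitz constant `L`
  -- may be large, but it disappears with `d`.
  obtain ⟨G, hG, hFG⟩ := hF.extend_finite_dimension
  set L := lipschitzExtensionConstant Plane * K
  have hderG : ∀ᵐ u : Plane, u ∈ ball x₀ R →
      DifferentiableAt ℝ G u ∧ ∀ w, ‖fderiv ℝ G u w‖ ≤ C * ‖w‖ := by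
    filter_upwards [hder] with u hu hmem
    obtain ⟨A, hA, hAw⟩ := hu hmem
    have h1 : HasFDerivAt G A u := hA.congr_of_eventuallyEq <| by
      filter_upwards [isOpen_ball.mem_nhds hmem] with z hz using (hFG hz).symm
    exact ⟨h1.differentiableAt, by rw [h1.fderiv]; exact hAw⟩
  set v := y - x with hv
  apply le_of_forall_pos_le_add
  intro ε hε
  obtain ⟨d, hd0, hdR, hdε⟩ : ∃ d : ℝ, 0 < d ∧ (dist x x₀ < R - d ∧ dist y x₀ < R - d) ∧
      2 * L * d ≤ ε := by
    have hx' := mem_ball.1 hx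
    have hy' := mem_ball.1 hy
    have hL : (0 : ℝ) < 2 * L + 1 := by positivity
    refine ⟨min (min ((R - dist x x₀) / 2) ((R - dist y x₀) / 2)) (ε / (2 * L + 1)), ?_, ?_, ?_⟩
    · have : 0 < ε / (2 * L + 1) := by positivity
      refine lt_min (lt_min ?_ ?_) this <;> linarith
    · have h1 := min_le_left (min ((R - dist x x₀) / 2) ((R - dist y x₀) / 2)) (ε / (2 * L + 1))
      have h2 := min_le_left ((R - dist x x₀) / 2) ((R - dist y x₀) / 2)
      have h3 := min_le_right ((R - dist x x₀) / 2) ((R - dist y x₀) / 2)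
      constructor <;> linarith
    · have h1 := min_le_right (min ((R - dist x x₀) / 2) ((R - dist y x₀) / 2)) (ε / (2 * L + 1))
      calc 2 * (L : ℝ) * _ ≤ 2 * L * (ε / (2 * L + 1)) := by gcongr
        _ ≤ (2 * L + 1) * (ε / (2 * L + 1)) := by gcongr; linarith
        _ = ε := by field_simp
  have hseg : ∀ t ∈ Icc (0 : ℝ) 1, x + t • v ∈ ball x₀ (R - d) := fun t ht =>
    (convex_ball x₀ (R - d)).add_smul_sub_mem (mem_ball.2 hdR.1) (mem_ball.2 hdR.2) ht
  have hsegz : ∀ t ∈ Icc (0 : ℝ) 1, ∀ z ∈ ball (0 : Plane) d, x + t • v + z ∈ ball x₀ R := by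
    intro t ht z hz0
    have h2 : ‖x + t • v - x₀‖ < R - d := by rw [← dist_eq_norm]; exact mem_ball.1 (hseg t ht)
    have h3 : ‖z‖ < d := by simpa using hz0
    rw [mem_ball, dist_eq_norm]
    calc ‖x + t • v + z - x₀‖ = ‖(x + t • v - x₀) + z‖ := by congr 1; abel
      _ ≤ ‖x + t • v - x₀‖ + ‖z‖ := norm_add_le _ _
      _ < R := by linarith
  -- A bound valid almost everywhere says nothing about a single segment, which is a null set.
  -- Averaging `G` over the translates by vectors of length less than `d` gives a differentiable
  -- function of `t` whose derivative sees only almost every point.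
  set μ := (volume : Measure Plane).restrict (ball 0 d) with hμ
  have hμfin : IsFiniteMeasure μ := ⟨by
    rw [hμ, Measure.restrict_apply_univ]; exact measure_ball_lt_top⟩
  have hint : ∀ a : Plane, Integrable (fun z => G (a + z)) μ := fun a =>
    ((hG.continuous.comp (continuous_const.add continuous_id)).continuousOn.integrableOn_compact
      (isCompact_closedBall (0 : Plane) d)).mono_set ball_subset_closedBall
  have hψ : ∀ t ∈ Icc (0 : ℝ) 1, HasDerivAt (fun t : ℝ => ∫ z, G (x + t • v + z) ∂μ)
      (∫ z, fderiv ℝ G (x + t • v + z) v ∂μ) t := by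
    intro t ht
    refine (hasDerivAt_integral_of_dominated_loc_of_lip (s := univ)
      (bound := fun _ => L * ‖v‖) univ_mem ?_ (hint _) ?_ ?_ ?_ ?_).2
    · exact Eventually.of_forall fun s => (hint _).aestronglyMeasurable
    · exact ((measurable_fderiv_apply_const ℝ G v).comp
        (measurable_const.add measurable_id)).aestronglyMeasurable
    · refine Eventually.of_forall fun z => ?_
      rw [lipschitzOnWith_univ]
      refine LipschitzWith.of_dist_le_mul fun s s' => ?_
      refine (hG.dist_le_mul _ _).trans ?_
      rw [Real.coe_nnabs, abs_of_nonneg (by positivity), dist_add_right, dist_add_left, mul_assoc,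
        dist_eq_norm, ← sub_smul, norm_smul, mul_comm ‖s - s'‖, dist_eq_norm, mul_comm ‖v‖]
    · exact integrable_const _
    · have h1 : ∀ᵐ z : Plane, x + t • v + z ∈ ball x₀ R → DifferentiableAt ℝ G (x + t • v + z) := by
        have := (measurePreserving_add_left volume (x + t • v)).quasiMeasurePreserving.ae hderG
        filter_upwards [this] with z hz hmem using (hz hmem).1
      rw [hμ, ae_restrict_iff' measurableSet_ball]
      filter_upwards [h1] with z hz hz0
      have hmem := hsegz t ht z hz0
      have h4 : HasDerivAt (fun s : ℝ => x + s • v + z) v t := by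
        simpa using (((hasDerivAt_id t).smul_const v).const_add x).add_const z
      exact (hz hmem).hasFDerivAt.comp_hasDerivAt t h4
  have hbound : ∀ t ∈ Ico (0 : ℝ) 1, ‖∫ z, fderiv ℝ G (x + t • v + z) v ∂μ‖ ≤
      C * ‖v‖ * (volume (ball (0 : Plane) d)).toReal := by
    intro t ht
    have h0 : ∀ᵐ z ∂μ, ‖fderiv ℝ G (x + t • v + z) v‖ ≤ C * ‖v‖ := by
      have := (measurePreserving_add_left volume (x + t • v)).quasiMeasurePreserving.ae hderG
      rw [hμ, ae_restrict_iff' measurableSet_ball]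
      filter_upwards [this] with z hz hz0
      have hmem := hsegz t (Ico_subset_Icc_self ht) z hz0
      exact (hz hmem).2 v
    refine (norm_integral_le_of_norm_le_const h0).trans ?_
    rw [hμ, measureReal_restrict_apply_univ]
    rfl
  have hmv := norm_image_sub_le_of_norm_deriv_le_segment_01'
    (fun t ht => (hψ t ht).hasDerivWithinAt) hbound
  simp only [one_smul, zero_smul, add_zero] at hmv
  rw [show x + v = y by rw [hv]; abel] at hmv
  set m := (volume (ball (0 : Plane) d)).toReal with hm
  have hm0 : 0 < m := ENNReal.toReal_pos (measure_ball_pos _ _ hd0).ne' measure_ball_lt_top.ne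
  -- The average differs from the value at the centre by at most `L d`, so two endpoints cost `2 L d
  -- ≤ ε`.
  have hclose : ∀ a : Plane, ‖(∫ z, G (a + z) ∂μ) - m • G a‖ ≤ L * d * m := by
    intro a
    have h1 : m • G a = ∫ z, G a ∂μ := by
      rw [integral_const, hμ, measureReal_restrict_apply_univ]; rfl
    rw [h1, ← integral_sub (hint a) (integrable_const _)]
    have h0 : ∀ᵐ z ∂μ, ‖G (a + z) - G a‖ ≤ L * d := by
      rw [hμ, ae_restrict_iff' measurableSet_ball]
      refine Eventually.of_forall fun z hz => ?_
      have h3 : ‖z‖ < d := by simpa using hz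
      have h4 := hG.dist_le_mul (a + z) a
      rw [dist_eq_norm, dist_eq_norm, add_sub_cancel_left] at h4
      exact h4.trans (by gcongr)
    refine (norm_integral_le_of_norm_le_const h0).trans ?_
    rw [hμ, measureReal_restrict_apply_univ]
    rfl
  have h5 : ‖m • (G y - G x)‖ ≤ C * ‖v‖ * m + 2 * (L * d * m) := by
    have h6 : m • (G y - G x) = ((∫ z, G (y + z) ∂μ) - ∫ z, G (x + z) ∂μ) +
        (-((∫ z, G (y + z) ∂μ) - m • G y) + ((∫ z, G (x + z) ∂μ) - m • G x)) := by
      rw [smul_sub]; abel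
    rw [h6]
    refine (norm_add_le _ _).trans (add_le_add hmv ((norm_add_le _ _).trans ?_))
    rw [norm_neg, two_mul]
    exact add_le_add (hclose y) (hclose x)
  rw [norm_smul, Real.norm_of_nonneg hm0.le] at h5
  have h7 : ‖G y - G x‖ ≤ C * ‖v‖ + 2 * (L * d) := by
    rw [← mul_le_mul_iff_right₀ hm0]
    linarith
  rw [← hFG hx, ← hFG hy] at h7
  linarith

/-- Packing two discs: a map which almost preserves areas and does not increase distances much
almost preserves distances. -/
theorem norm_sub_ge_of_ae_almost_isometric {F : Plane → Plane} {x₀ : Plane} {R δ : ℝ} {K : ℝ≥0}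
    (hδ0 : 0 ≤ δ) (hδ1 : δ ≤ 1) (hF : LipschitzOnWith K F (ball x₀ R))
    (hder : ∀ᵐ u : Plane, u ∈ ball x₀ R → ∃ A : Plane →L[ℝ] Plane, HasFDerivAt F A u ∧
      (∀ w, (1 - δ) * ‖w‖ ≤ ‖A w‖) ∧ ∀ w, ‖A w‖ ≤ (1 + δ) * ‖w‖)
    (hinj : ∀ᵐ z : Plane, (ball x₀ R ∩ F ⁻¹' {z}).Subsingleton)
    {x y : Plane} (hx : x ∈ ball x₀ (R / 2)) (hy : y ∈ ball x₀ (R / 2)) :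
    (1 - √(8 * δ)) * ‖y - x‖ ≤ ‖F y - F x‖ := by
  rcases eq_or_ne x y with rfl | hxy
  · simp
  -- With half the distance as radius, the discs around `x` and `y` are disjoint, and each is mapped
  -- into the disc of radius `t' = (1 + δ) t` around the image of its centre.
  set t := ‖y - x‖ / 2 with ht
  have ht0 : 0 < t := by
    rw [ht]; exact half_pos (norm_pos_iff.2 (sub_ne_zero.2 hxy.symm))
  have hdist : dist x y = 2 * t := by rw [ht, dist_comm, dist_eq_norm]; ring
  have htR : t < R / 2 := by
    have h1 := dist_triangle_right x y x₀
    have h2 := mem_ball.1 hx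
    have h3 := mem_ball.1 hy
    linarith
  have hsub : ∀ a ∈ ball x₀ (R / 2), ball a t ⊆ ball x₀ R := fun a ha =>
    ball_subset_ball' (by have := mem_ball.1 ha; linarith)
  have hlip : ∀ a ∈ ball x₀ R, ∀ b ∈ ball x₀ R, ‖F b - F a‖ ≤ (1 + δ) * ‖b - a‖ := by
    intro a ha b hb
    refine norm_sub_le_of_ae_norm_fderiv_le hF ?_ ha hb
    filter_upwards [hder] with u hu hmem
    obtain ⟨A, h1, -, h3⟩ := hu hmem
    exact ⟨A, h1, h3⟩
  set t' := (1 + δ) * t with ht'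
  have ht'0 : 0 < t' := by positivity
  have himg : ∀ a ∈ ball x₀ (R / 2), F '' ball a t ⊆ ball (F a) t' := by
    rintro a ha _ ⟨b, hb, rfl⟩
    have haR : a ∈ ball x₀ R := hsub a ha (mem_ball_self ht0)
    rw [mem_ball, dist_eq_norm]
    refine (hlip a haR b (hsub a ha hb)).trans_lt ?_
    rw [ht']
    have : ‖b - a‖ < t := by rwa [mem_ball, dist_eq_norm] at hb
    gcongr
  set S := ball x t ∪ ball y t with hS
  have hSsub : S ⊆ ball x₀ R := union_subset (hsub x hx) (hsub y hy)
  have hSm : MeasurableSet S := measurableSet_ball.union measurableSet_ball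
  have hdisj : Disjoint (ball x t) (ball y t) := ball_disjoint_ball (by linarith)
  have hvol := mul_volume_le_volume_image (c := (1 - δ) ^ 2) hSm (F := F) (by
      filter_upwards [hder] with u hu hmem
      obtain ⟨A, h1, h2, -⟩ := hu (hSsub hmem)
      exact ⟨A, h1.hasFDerivWithinAt, sq_le_abs_det (by linarith) h2⟩) (by
      filter_upwards [hinj] with z hz using hz.anti (inter_subset_inter_left _ hSsub))
  set κ := (volume (ball (0 : Plane) 1)).toReal with hκ
  have hκ0 : 0 < κ := ENNReal.toReal_pos (measure_ball_pos _ _ one_pos).ne' measure_ball_lt_top.ne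
  have hball : ∀ (a : Plane) (r : ℝ), 0 ≤ r → volume.real (ball a r) = r ^ 2 * κ := by
    intro a r hr
    rw [Measure.real, Measure.addHaar_ball volume a hr, finrank_plane, ENNReal.toReal_mul,
      ENNReal.toReal_ofReal (by positivity)]
  have hfin : ∀ (a : Plane) (r : ℝ), volume (ball a r) ≠ ⊤ := fun a r => measure_ball_lt_top.ne
  have hupper : ‖F y - F x‖ ≤ 2 * t' := by
    have h1 := hlip x (hsub x hx (mem_ball_self ht0)) y (hsub y hy (mem_ball_self ht0))
    rw [← dist_eq_norm y x, dist_comm, hdist] at h1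
    rw [ht']; linarith
  -- The relative amount by which the image centres are closer than `2 t'`. The image discs then
  -- share a disc of radius `ε t'` around the midpoint, which removes at least `ε ^ 2` times the
  -- area of one disc from their union.
  set ε := 1 - ‖F y - F x‖ / (2 * t') with hε
  have hε0 : 0 ≤ ε := by
    rw [hε, sub_nonneg, div_le_one (by positivity)]; exact hupper
  have hFε : ‖F y - F x‖ = 2 * t' * (1 - ε) := by
    rw [hε]; field_simp; ring
  -- the overlap of the two image discs
  set mid := midpoint ℝ (F x) (F y) with hmid
  have hoverlap : ball mid (ε * t') ⊆ ball (F x) t' ∩ ball (F y) t' := by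
    have h1 : dist mid (F x) = t' * (1 - ε) := by
      rw [hmid, dist_midpoint_left, dist_comm, dist_eq_norm, hFε]; norm_num; ring
    have h2 : dist mid (F y) = t' * (1 - ε) := by
      rw [hmid, dist_midpoint_right, dist_comm, dist_eq_norm, hFε]; norm_num; ring
    exact subset_inter (ball_subset_ball' (by rw [h1]; linarith))
      (ball_subset_ball' (by rw [h2]; linarith))
  have hunion : volume.real (ball (F x) t' ∪ ball (F y) t') ≤ (2 - ε ^ 2) * t' ^ 2 * κ := by
    have h1 := measureReal_union_add_inter (μ := volume) (s := ball (F x) t') (t := ball (F y) t')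
      measurableSet_ball (hfin _ _) (hfin _ _)
    have h2 : volume.real (ball mid (ε * t')) ≤ volume.real (ball (F x) t' ∩ ball (F y) t') :=
      measureReal_mono hoverlap (measure_ne_top_of_subset inter_subset_left (hfin _ _))
    rw [hball _ _ (by positivity)] at h2
    rw [hball _ _ ht'0.le, hball _ _ ht'0.le] at h1
    nlinarith
  have hlower : (1 - δ) ^ 2 * (2 * t ^ 2 * κ) ≤ volume.real (ball (F x) t' ∪ ball (F y) t') := by
    have hSv : volume.real S = 2 * t ^ 2 * κ := by
      rw [hS, measureReal_union hdisj measurableSet_ball (hfin _ _) (hfin _ _), hball _ _ ht0.le,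
        hball _ _ ht0.le]
      ring
    rw [← hSv, Measure.real, Measure.real]
    rw [← ENNReal.toReal_ofReal (sq_nonneg (1 - δ)), ← ENNReal.toReal_mul]
    refine ENNReal.toReal_mono ?_ (hvol.trans (measure_mono ?_))
    · exact (measure_union_lt_top measure_ball_lt_top measure_ball_lt_top).ne
    · rw [hS, image_union]
      exact union_subset_union (himg x hx) (himg y hy)
  have hkey : (1 - δ) ^ 2 * 2 ≤ (2 - ε ^ 2) * (1 + δ) ^ 2 := by
    have h1 := hlower.trans hunion
    have h2 : 0 < t ^ 2 * κ := by positivity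
    rw [ht'] at h1
    rw [← mul_le_mul_iff_left₀ h2]
    linarith
  -- Comparison of areas gives `ε ^ 2 (1 + δ) ^ 2 ≤ 2 ((1 + δ) ^ 2 - (1 - δ) ^ 2) = 8 δ`.
  have hεδ : ε ^ 2 ≤ 8 * δ := by
    have h1 : ε ^ 2 * (1 + δ) ^ 2 ≤ 8 * δ * (1 + δ) ^ 2 := by nlinarith [sq_nonneg (1 + δ), mul_nonneg hδ0 (sq_nonneg δ), mul_nonneg hδ0 hδ0]
    exact le_of_mul_le_mul_right h1 (by positivity)
  have hε8 : ε ≤ √(8 * δ) := Real.le_sqrt_of_sq_le hεδ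
  have h2t : ‖y - x‖ = 2 * t := by rw [← dist_eq_norm, dist_comm, hdist]
  have hε1 : 0 ≤ 1 - ε := by
    have h1 : 0 ≤ 2 * t' * (1 - ε) := hFε ▸ norm_nonneg _
    exact nonneg_of_mul_nonneg_right h1 (by positivity)
  rw [hFε, h2t]
  have htt' : t ≤ t' := by rw [ht']; nlinarith
  nlinarith [mul_le_mul_of_nonneg_right hε8 ht0.le, mul_le_mul_of_nonneg_right htt' hε1]

end AlmostIsometric


/-! ### Linear approximation and limits across scales -/

section LinearApproximation

open Metric

/-- An almost isometric map of a disc is close to a linear map. -/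
theorem exists_linear_approx {F : Plane → Plane} {x₀ : Plane} {h η : ℝ} (hh : 0 < h) (hη0 : 0 ≤ η)
    (hη1 : η ≤ 1)
    (hup : ∀ x ∈ closedBall x₀ h, ∀ y ∈ closedBall x₀ h, ‖F y - F x‖ ≤ (1 + η) * ‖y - x‖)
    (hlow : ∀ x ∈ closedBall x₀ h, ∀ y ∈ closedBall x₀ h, (1 - η) * ‖y - x‖ ≤ ‖F y - F x‖) :
    ∃ A : Plane →L[ℝ] Plane, ∀ x ∈ closedBall x₀ h, ‖F x - F x₀ - A (x - x₀)‖ ≤ 9 * √η * h := by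
  have hx₀ : x₀ ∈ closedBall x₀ h := mem_closedBall_self hh.le
  have hsq : ∀ x ∈ closedBall x₀ h, ∀ y ∈ closedBall x₀ h,
      |‖F y - F x‖ ^ 2 - ‖y - x‖ ^ 2| ≤ 3 * η * ‖y - x‖ ^ 2 := by
    intro x hx y hy
    have h1 := hup x hx y hy
    have h2 := hlow x hx y hy
    have h3 := norm_nonneg (y - x)
    have h4 : ‖F y - F x‖ ^ 2 ≤ ((1 + η) * ‖y - x‖) ^ 2 := by gcongr
    have h5 : ((1 - η) * ‖y - x‖) ^ 2 ≤ ‖F y - F x‖ ^ 2 :=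
      pow_le_pow_left₀ (mul_nonneg (by linarith) h3) h2 2
    have h6 := sq_nonneg ‖y - x‖
    have h7 : η ^ 2 ≤ η := by nlinarith
    rw [abs_le]
    constructor
    · nlinarith [mul_nonneg hη0 h6, mul_nonneg (sq_nonneg η) h6]
    · nlinarith [mul_le_mul_of_nonneg_right h7 h6]
  -- Polarization: two squared lengths at most `h ^ 2` and one at most `4 h ^ 2`, each with relative
  -- error `3 η`, give half of `(3 + 3 + 12) η h ^ 2`.
  have hinner : ∀ v w : Plane, ‖v‖ ≤ h → ‖w‖ ≤ h →
      |inner ℝ (F (x₀ + v) - F x₀) (F (x₀ + w) - F x₀) - inner ℝ v w| ≤ 9 * η * h ^ 2 := by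
    intro v w hv hw
    have hv' : x₀ + v ∈ closedBall x₀ h := by simpa [dist_eq_norm] using hv
    have hw' : x₀ + w ∈ closedBall x₀ h := by simpa [dist_eq_norm] using hw
    have h1 := hsq x₀ hx₀ _ hv'
    have h2 := hsq x₀ hx₀ _ hw'
    have h3 := hsq _ hw' _ hv'
    rw [add_sub_cancel_left] at h1 h2
    rw [add_sub_add_left_eq_sub] at h3
    have h4 := norm_sub_sq_real (F (x₀ + v) - F x₀) (F (x₀ + w) - F x₀)
    have h5 := norm_sub_sq_real v w
    rw [sub_sub_sub_cancel_right] at h4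
    have hv2 : ‖v‖ ^ 2 ≤ h ^ 2 := by gcongr
    have hw2 : ‖w‖ ^ 2 ≤ h ^ 2 := by gcongr
    have hvw : ‖v - w‖ ^ 2 ≤ 4 * h ^ 2 := by
      have : ‖v - w‖ ≤ 2 * h := (norm_sub_le _ _).trans (by linarith)
      calc ‖v - w‖ ^ 2 ≤ (2 * h) ^ 2 := by gcongr
        _ = 4 * h ^ 2 := by ring
    have h1' : |‖F (x₀ + v) - F x₀‖ ^ 2 - ‖v‖ ^ 2| ≤ 3 * η * h ^ 2 := h1.trans (by gcongr)
    have h2' : |‖F (x₀ + w) - F x₀‖ ^ 2 - ‖w‖ ^ 2| ≤ 3 * η * h ^ 2 := h2.trans (by gcongr)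
    have h3' : |‖F (x₀ + v) - F (x₀ + w)‖ ^ 2 - ‖v - w‖ ^ 2| ≤ 3 * η * (4 * h ^ 2) :=
      h3.trans (by gcongr)
    rw [abs_le] at h1' h2' h3' ⊢
    constructor <;> linarith [h1'.1, h1'.2, h2'.1, h2'.2, h3'.1, h3'.2]
  set e : Fin 2 → Plane := fun i => EuclideanSpace.single i 1 with he
  have hnorm : ∀ i, ‖h • e i‖ ≤ h := fun i => by
    rw [norm_smul, Real.norm_of_nonneg hh.le]; simp [he]
  set p : Fin 2 → Plane := fun i => F (x₀ + h • e i) - F x₀ with hp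
  -- The linear map that agrees with the increments of `F` along the two coordinate vectors of
  -- length `h`.
  set A : Plane →L[ℝ] Plane :=
    (EuclideanSpace.proj 0 : Plane →L[ℝ] ℝ).smulRight (h⁻¹ • p 0) +
      (EuclideanSpace.proj 1 : Plane →L[ℝ] ℝ).smulRight (h⁻¹ • p 1) with hA
  refine ⟨A, fun x hx => ?_⟩
  set v := x - x₀ with hv
  have hvh : ‖v‖ ≤ h := by rwa [mem_closedBall, dist_eq_norm] at hx
  have hxv : x = x₀ + v := by rw [hv]; abel
  set a := F x - F x₀ with ha
  have hAv : h • (a - A v) = h • a - (v 0 • p 0 + v 1 • p 1) := by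
    have : h • A v = v 0 • p 0 + v 1 • p 1 := by
      simp only [hA, add_apply, ContinuousLinearMap.smulRight_apply,
        smul_add]
      change h • v 0 • h⁻¹ • p 0 + h • v 1 • h⁻¹ • p 1 = _
      rw [smul_comm h (v 0), smul_comm h (v 1), smul_inv_smul₀ hh.ne', smul_inv_smul₀ hh.ne']
    rw [smul_sub, this]
  have hvi : ∀ i, |v i| ≤ h := fun i => (PiLp.norm_apply_le v i).trans hvh
  have hpp : ∀ i j, |inner ℝ (p i) (p j) - h ^ 2 * inner ℝ (e i) (e j)| ≤ 9 * η * h ^ 2 := by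
    intro i j
    have := hinner (h • e i) (h • e j) (hnorm i) (hnorm j)
    rwa [real_inner_smul_left, real_inner_smul_right, ← mul_assoc, ← sq] at this
  have hap : ∀ i, |inner ℝ a (p i) - h * v i| ≤ 9 * η * h ^ 2 := by
    intro i
    have := hinner v (h • e i) hvh (hnorm i)
    rw [real_inner_smul_right, ← hxv] at this
    simpa [he, EuclideanSpace.inner_single_right] using this
  have haa : |inner ℝ a a - ‖v‖ ^ 2| ≤ 9 * η * h ^ 2 := by
    have := hinner v v hvh hvh
    rwa [← hxv, real_inner_self_eq_norm_sq v] at this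
  have hv2 : ‖v‖ ^ 2 = v 0 ^ 2 + v 1 ^ 2 := by
    rw [EuclideanSpace.norm_sq_eq, Fin.sum_univ_two]; simp
  have h00 := hpp 0 0
  have h11 := hpp 1 1
  have h01 := hpp 0 1
  have he00 : inner ℝ (e 0) (e 0) = (1 : ℝ) := by simp [he]
  have he11 : inner ℝ (e 1) (e 1) = (1 : ℝ) := by simp [he]
  have he01 : inner ℝ (e 0) (e 1) = (0 : ℝ) := by simp [he, EuclideanSpace.inner_single_left]
  rw [he00, mul_one] at h00
  rw [he11, mul_one] at h11
  rw [he01, mul_zero, sub_zero] at h01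
  -- The squared error involves only inner products of increments of `F`. If these are replaced by
  -- the Euclidean ones, the sum vanishes; the replacements cost nine times `E h ^ 2`, counted with
  -- multiplicity.
  have hexp : ‖h • (a - A v)‖ ^ 2 = h ^ 2 * inner ℝ a a + v 0 ^ 2 * inner ℝ (p 0) (p 0) +
      v 1 ^ 2 * inner ℝ (p 1) (p 1) - 2 * h * v 0 * inner ℝ a (p 0) - 2 * h * v 1 * inner ℝ a (p 1) +
      2 * v 0 * v 1 * inner ℝ (p 0) (p 1) := by
    rw [hAv, ← real_inner_self_eq_norm_sq]
    simp only [inner_sub_left, inner_sub_right, inner_add_left, inner_add_right,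
      real_inner_smul_left, real_inner_smul_right]
    rw [real_inner_comm a (p 0), real_inner_comm a (p 1), real_inner_comm (p 0) (p 1)]
    ring
  set E := 9 * η * h ^ 2 with hE
  have hE0 : 0 ≤ E := by positivity
  have hbound : ‖h • (a - A v)‖ ^ 2 ≤ (9 * √η * h * h) ^ 2 := by
    have hrhs : (9 * √η * h * h) ^ 2 = 9 * E * h ^ 2 := by
      rw [mul_pow, mul_pow, mul_pow, Real.sq_sqrt hη0, hE]; ring
    have key : ∀ c X Y : ℝ, |X - Y| ≤ E → |c| ≤ h ^ 2 → c * X ≤ c * Y + h ^ 2 * E := by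
      intro c X Y h1 h2
      have h3 : c * (X - Y) ≤ |c| * |X - Y| := by rw [← abs_mul]; exact le_abs_self _
      have h4 : |c| * |X - Y| ≤ h ^ 2 * E := mul_le_mul h2 h1 (abs_nonneg _) (sq_nonneg _)
      linarith
    have hm : ∀ x y : ℝ, |x| ≤ h → |y| ≤ h → |x * y| ≤ h ^ 2 := fun x y hx hy => by
      rw [abs_mul, sq]; exact mul_le_mul hx hy (abs_nonneg _) hh.le
    have hhh : |h| ≤ h := (abs_of_pos hh).le
    have hneg : ∀ i, |-v i| ≤ h := fun i => by rw [abs_neg]; exact hvi i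
    have k1 := key (h * h) _ _ haa (hm _ _ hhh hhh)
    have k2 := key (v 0 * v 0) _ _ h00 (hm _ _ (hvi 0) (hvi 0))
    have k3 := key (v 1 * v 1) _ _ h11 (hm _ _ (hvi 1) (hvi 1))
    have k4 := key (h * -v 0) _ _ (hap 0) (hm _ _ hhh (hneg 0))
    have k5 := key (h * -v 1) _ _ (hap 1) (hm _ _ hhh (hneg 1))
    have k6 := key (v 0 * v 1) _ 0 (by simpa using h01) (hm _ _ (hvi 0) (hvi 1))
    rw [hexp, hrhs]
    rw [hv2] at k1
    linarith
  have h1 := (sq_le_sq₀ (norm_nonneg _) (by positivity)).1 hbound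
  rw [norm_smul, Real.norm_of_nonneg hh.le, mul_comm] at h1
  exact le_of_mul_le_mul_right h1 hh

/-- The modulus of continuity `t ^ (1/4)`. -/
def fourthRoot (t : ℝ) : ℝ := √(√t)

theorem fourthRoot_nonneg (t : ℝ) : 0 ≤ fourthRoot t := Real.sqrt_nonneg _

theorem fourthRoot_mono {s t : ℝ} (h : s ≤ t) : fourthRoot s ≤ fourthRoot t :=
  Real.sqrt_le_sqrt (Real.sqrt_le_sqrt h)

theorem fourthRoot_mul {s : ℝ} (hs : 0 ≤ s) (t : ℝ) :
    fourthRoot (s * t) = fourthRoot s * fourthRoot t := by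
  rw [fourthRoot, Real.sqrt_mul hs, Real.sqrt_mul (Real.sqrt_nonneg _)]; rfl

theorem fourthRoot_lt_one {s : ℝ} (hs : s < 1) : fourthRoot s < 1 := by
  rw [fourthRoot, Real.sqrt_lt' one_pos, one_pow, Real.sqrt_lt' one_pos, one_pow]
  exact hs

theorem continuous_fourthRoot : Continuous fourthRoot :=
  Real.continuous_sqrt.comp Real.continuous_sqrt

theorem fourthRoot_zero : fourthRoot 0 = 0 := by simp [fourthRoot]

/-- A function with geometrically decaying increments towards `0` has a limit, with a rate. -/
theorem exists_limit_of_chain {E : Type*} [NormedAddCommGroup E] [CompleteSpace E] {h : ℝ → E}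
    {C R κ : ℝ} (hC : 0 ≤ C) (hR : 0 < R) (hκ0 : 0 < κ) (hκ1 : κ < 1)
    (hh : ∀ t, 0 < t → t ≤ R → ∀ t', κ * t ≤ t' → t' ≤ t → ‖h t - h t'‖ ≤ C * fourthRoot t) :
    ∃ A : E, (∀ t, 0 < t → t ≤ R → ‖h t - A‖ ≤ C / (1 - fourthRoot κ) * fourthRoot t) ∧
      Tendsto h (𝓝[>] 0) (𝓝 A) := by
  have hd : 0 < 1 - fourthRoot κ := by linarith [fourthRoot_lt_one hκ1]
  set C' := C / (1 - fourthRoot κ) with hC'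
  have hC'0 : 0 ≤ C' := by positivity
  -- The sum `C'` of the geometric series reproduces itself after one step, which closes the
  -- induction over the number of steps.
  have hCC' : C + C' * fourthRoot κ = C' := by rw [hC']; field_simp; ring
  have hCle : C ≤ C' := by
    have := mul_nonneg hC'0 (fourthRoot_nonneg κ); linarith
  have hchain : ∀ n : ℕ, ∀ t, 0 < t → t ≤ R → ∀ t', κ ^ n * t ≤ t' → t' ≤ t →
      ‖h t - h t'‖ ≤ C' * fourthRoot t := by
    intro n
    induction n with
    | zero =>
      intro t ht htR t' h1 h2
      have : t' = t := le_antisymm h2 (by simpa using h1)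
      rw [this, sub_self, norm_zero]
      exact mul_nonneg hC'0 (fourthRoot_nonneg _)
    | succ n ih =>
      intro t ht htR t' h1 h2
      rcases le_total (κ * t) t' with h3 | h3
      · exact (hh t ht htR t' h3 h2).trans (mul_le_mul_of_nonneg_right hCle (fourthRoot_nonneg _))
      · have hκt : κ * t ≤ t := by nlinarith
        have h4 := hh t ht htR (κ * t) le_rfl hκt
        have h5 := ih (κ * t) (by positivity) (hκt.trans htR) t' (by rw [← mul_assoc, ← pow_succ]; exact h1) h3
        rw [fourthRoot_mul hκ0.le] at h5
        calc ‖h t - h t'‖ ≤ ‖h t - h (κ * t)‖ + ‖h (κ * t) - h t'‖ := norm_sub_le_norm_sub_add_norm_sub _ _ _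
          _ ≤ C * fourthRoot t + C' * (fourthRoot κ * fourthRoot t) := add_le_add h4 h5
          _ = (C + C' * fourthRoot κ) * fourthRoot t := by ring
          _ = C' * fourthRoot t := by rw [hCC']
  have hall : ∀ t, 0 < t → t ≤ R → ∀ t', 0 < t' → t' ≤ t → ‖h t - h t'‖ ≤ C' * fourthRoot t := by
    intro t ht htR t' ht' h1
    obtain ⟨n, hn⟩ := exists_pow_lt_of_lt_one (div_pos ht' ht) hκ1
    exact hchain n t ht htR t' ((lt_div_iff₀ ht).1 hn).le h1
  have htend0 : Tendsto (fun t => C' * fourthRoot t) (𝓝[>] 0) (𝓝 0) := by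
    have h0 : Continuous fun t => C' * fourthRoot t := continuous_const.mul continuous_fourthRoot
    have h1 : Tendsto (fun t => C' * fourthRoot t) (𝓝 0) (𝓝 (C' * fourthRoot 0)) := h0.tendsto 0
    rw [fourthRoot_zero, mul_zero] at h1
    exact h1.mono_left nhdsWithin_le_nhds
  have hcau : Cauchy (map h (𝓝[>] (0 : ℝ))) := by
    rw [Metric.cauchy_iff]
    refine ⟨inferInstance, fun ε hε => ?_⟩
    have h1 : ∀ᶠ t in 𝓝[>] (0 : ℝ), C' * fourthRoot t < ε / 2 :=
      htend0.eventually (gt_mem_nhds (half_pos hε))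
    have h2 : ∀ᶠ t in 𝓝[>] (0 : ℝ), t ∈ Ioc 0 R := Ioc_mem_nhdsGT hR
    obtain ⟨t, ht, ht'⟩ := (h1.and h2).exists
    refine ⟨h '' Ioc 0 t, image_mem_map (Ioc_mem_nhdsGT ht'.1), ?_⟩
    rintro _ ⟨a, ha, rfl⟩ _ ⟨b, hb, rfl⟩
    have h3 := hall t ht'.1 ht'.2 a ha.1 ha.2
    have h4 := hall t ht'.1 ht'.2 b hb.1 hb.2
    rw [dist_eq_norm]
    calc ‖h a - h b‖ ≤ ‖h a - h t‖ + ‖h t - h b‖ := norm_sub_le_norm_sub_add_norm_sub _ _ _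
      _ < ε := by rw [norm_sub_rev (h a)]; linarith
  obtain ⟨A, hA⟩ := cauchy_map_iff_exists_tendsto.1 hcau
  refine ⟨A, fun t ht htR => ?_, hA⟩
  refine le_of_tendsto ((tendsto_const_nhds (x := h t)).sub hA).norm ?_
  filter_upwards [Ioc_mem_nhdsGT ht] with t' ht'
  exact hall t ht htR t' ht'.1 ht'.2

theorem opNorm_le_of_forall_ball {B : Plane →L[ℝ] Plane} {ε M : ℝ} (hε : 0 < ε) (hM : 0 ≤ M)
    (h : ∀ v, ‖v‖ ≤ ε → ‖B v‖ ≤ M) : ‖B‖ ≤ M / ε := by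
  refine B.opNorm_le_bound (by positivity) fun w => ?_
  rcases eq_or_ne w 0 with rfl | hw
  · simp
  have hw' : 0 < ‖w‖ := norm_pos_iff.2 hw
  have h1 := h ((ε / ‖w‖) • w) (by
    rw [norm_smul, Real.norm_of_nonneg (by positivity), div_mul_cancel₀ _ hw'.ne'])
  rw [map_smul, norm_smul, Real.norm_of_nonneg (by positivity), div_mul_eq_mul_div, div_le_iff₀ hw'] at h1
  rw [div_mul_eq_mul_div, le_div_iff₀ hε]
  linarith

end LinearApproximation


/-! ### Infinitesimally isometric maps between planar domains with variable metrics -/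

section PlaneRigidity

open Metric

/-- The functions `q u`, for `u ∈ U`, are squared Euclidean norms which are uniformly equivalent to
the standard one, and whose ratios are Lipschitz close to `1`. -/
structure PlaneMetric (q : Plane → Plane → ℝ) (U : Set Plane) (c C ℓ : ℝ) : Prop where
  c_pos : 0 < c
  C_pos : 0 < C
  lip_nonneg : 0 ≤ ℓ
  frame : ∀ u ∈ U, ∃ P : Plane ≃L[ℝ] Plane, ∀ v, q u v = ‖P v‖ ^ 2
  lower : ∀ u ∈ U, ∀ v, c ^ 2 * ‖v‖ ^ 2 ≤ q u v
  upper : ∀ u ∈ U, ∀ v, q u v ≤ C ^ 2 * ‖v‖ ^ 2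
  ratio : ∀ u ∈ U, ∀ u' ∈ U, ∀ v, q u v ≤ (1 + ℓ * ‖u - u'‖) * q u' v

theorem PlaneMetric.mono {q : Plane → Plane → ℝ} {U V : Set Plane} {c C ℓ : ℝ}
    (h : PlaneMetric q U c C ℓ) (hV : V ⊆ U) : PlaneMetric q V c C ℓ :=
  ⟨h.c_pos, h.C_pos, h.lip_nonneg, fun u hu => h.frame u (hV hu), fun u hu => h.lower u (hV hu),
    fun u hu => h.upper u (hV hu), fun u hu u' hu' => h.ratio u (hV hu) u' (hV hu')⟩

theorem PlaneMetric.const_mul {q : Plane → Plane → ℝ} {U : Set Plane} {c C ℓ : ℝ}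
    (h : PlaneMetric q U c C ℓ) {r : ℝ} (hr : 0 < r) :
    PlaneMetric (fun u v => r ^ 2 * q u v) U (r * c) (r * C) ℓ where
  c_pos := mul_pos hr h.c_pos
  C_pos := mul_pos hr h.C_pos
  lip_nonneg := h.lip_nonneg
  frame u hu := by
    obtain ⟨P, hP⟩ := h.frame u hu
    refine ⟨P.trans (ContinuousLinearEquiv.smulLeft (Units.mk0 r hr.ne')), fun v => ?_⟩
    have : (P.trans (ContinuousLinearEquiv.smulLeft (Units.mk0 r hr.ne'))) v = r • P v := rfl
    rw [this, norm_smul, mul_pow, hP, Real.norm_of_nonneg hr.le]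
  lower u hu v := by
    have := mul_le_mul_of_nonneg_left (h.lower u hu v) (sq_nonneg r); linarith
  upper u hu v := by
    have := mul_le_mul_of_nonneg_left (h.upper u hu v) (sq_nonneg r); linarith
  ratio u hu u' hu' v := by
    have := mul_le_mul_of_nonneg_left (h.ratio u hu u' hu' v) (sq_nonneg r); linarith

/-- Frames `P` and `Q` make the metrics frozen at `u` and at `F u` Euclidean. On a ball of radius
`R` both metrics vary by a factor `1 + O(R)`, so `Q ∘ F ∘ P⁻¹` is almost isometric with `δ = Λ R`.
Packing gives `η = √(8 δ)`, and the linear approximation has relative error of order `√η`, which is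
the source of the exponent `1/4`. -/
theorem exists_affine_approx {q q' : Plane → Plane → ℝ} {U U' Ω : Set Plane} {c C ℓ c' C' ℓ' : ℝ}
    (hq : PlaneMetric q U c C ℓ) (hq' : PlaneMetric q' U' c' C' ℓ') {F : Plane → Plane} {K : ℝ≥0}
    (hΩ : Ω ⊆ U) (hmaps : MapsTo F Ω U') (hF : LipschitzOnWith K F Ω)
    (hder : ∀ᵐ u : Plane, u ∈ Ω → ∃ A : Plane →L[ℝ] Plane, HasFDerivAt F A u ∧
      ∀ w, q' (F u) (A w) = q u w)
    (hinj : ∀ᵐ z : Plane, (Ω ∩ F ⁻¹' {z}).Subsingleton) :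
    ∃ C₀ θ R₀ : ℝ, 0 ≤ C₀ ∧ 0 < θ ∧ θ ≤ 1 ∧ 0 < R₀ ∧ ∀ u R, 0 < R → R ≤ R₀ → ball u R ⊆ Ω →
      ∃ A : Plane →L[ℝ] Plane, ∀ x ∈ ball u (θ * R),
        ‖F x - F u - A (x - u)‖ ≤ C₀ * fourthRoot R * R := by
  have hc := hq.c_pos
  have hC := hq.C_pos
  have hc' := hq'.c_pos
  have hℓ := hq.lip_nonneg
  have hℓ' := hq'.lip_nonneg
  set Λ := ℓ' * K + ℓ with hΛ
  have hΛ0 : 0 ≤ Λ := by positivity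
  -- The radius `R₀` ensures `8 δ ≤ 1`. The factor `c / (4 C)` makes `P` send the smaller ball into
  -- the disc of radius `c R / 4`, well inside the disc of radius `c R / 2` on which the lower
  -- distance bound holds; the division by `c'` undoes `Q`.
  refine ⟨9 / c' * fourthRoot (8 * Λ) * (c / 4), min 1 (c / (4 * C)), 1 / (8 * Λ + 1),
    ?_, lt_min one_pos (by positivity), min_le_left _ _, by positivity, fun u R hR hRR₀ hball => ?_⟩
  · have := fourthRoot_nonneg (8 * Λ); positivity
  have huΩ : u ∈ Ω := hball (mem_ball_self hR)
  obtain ⟨P, hP⟩ := hq.frame u (hΩ huΩ)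
  obtain ⟨Q, hQ⟩ := hq'.frame (F u) (hmaps huΩ)
  have hPle : ∀ v, ‖P v‖ ≤ C * ‖v‖ := fun v => by
    rw [← sq_le_sq₀ (norm_nonneg _) (by positivity), mul_pow, ← hP]; exact hq.upper u (hΩ huΩ) v
  have hPge : ∀ v, c * ‖v‖ ≤ ‖P v‖ := fun v => by
    rw [← sq_le_sq₀ (by positivity) (norm_nonneg _), mul_pow, ← hP]; exact hq.lower u (hΩ huΩ) v
  have hQge : ∀ v, c' * ‖v‖ ≤ ‖Q v‖ := fun v => by
    rw [← sq_le_sq₀ (by positivity) (norm_nonneg _), mul_pow, ← hQ]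
    exact hq'.lower _ (hmaps huΩ) v
  set δ := Λ * R with hδ
  have hδ0 : 0 ≤ δ := by positivity
  have h8δ : 8 * δ ≤ 1 := by
    rw [le_div_iff₀ (by positivity)] at hRR₀
    rw [hδ]; nlinarith
  set G : Plane → Plane := fun w => Q (F (P.symm w)) with hG
  set y₀ := P u with hy₀
  have hmapsP : MapsTo P.symm (ball y₀ (c * R)) (ball u R) := by
    intro w hw
    have h1 := hPge (P.symm w - u)
    rw [map_sub, P.apply_symm_apply, ← hy₀] at h1
    rw [mem_ball, dist_eq_norm] at hw ⊢
    exact lt_of_mul_lt_mul_left (h1.trans_lt hw) hc.le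
  have hGlip : LipschitzOnWith (‖(Q : Plane →L[ℝ] Plane)‖₊ * (K * ‖(P.symm : Plane →L[ℝ] Plane)‖₊)) G
      (ball y₀ (c * R)) :=
    (Q : Plane →L[ℝ] Plane).lipschitz.comp_lipschitzOnWith ((hF.mono hball).comp
      (P.symm : Plane →L[ℝ] Plane).lipschitz.lipschitzOnWith hmapsP)
  have hlinae : ∀ (L : Plane ≃L[ℝ] Plane) {p : Plane → Prop}, (∀ᵐ z, p z) → ∀ᵐ z, p (L z) := by
    intro L p hp
    rw [ae_iff] at hp ⊢
    have h1 : {z | ¬ p (L z)} = L ⁻¹' {z | ¬ p z} := rfl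
    rw [h1, Measure.addHaar_preimage_continuousLinearEquiv, hp, mul_zero]
  have hGder : ∀ᵐ w : Plane, w ∈ ball y₀ (c * R) → ∃ A : Plane →L[ℝ] Plane, HasFDerivAt G A w ∧
      (∀ v, (1 - δ) * ‖v‖ ≤ ‖A v‖) ∧ ∀ v, ‖A v‖ ≤ (1 + δ) * ‖v‖ := by
    filter_upwards [hlinae P.symm hder] with w hw hmem
    set u' := P.symm w with hu'
    have hu'b : u' ∈ ball u R := hmapsP hmem
    obtain ⟨A, hA, hAq⟩ := hw (hball hu'b)
    refine ⟨(Q : Plane →L[ℝ] Plane) ∘L A ∘L (P.symm : Plane →L[ℝ] Plane), ?_, ?_⟩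
    · exact (Q : Plane →L[ℝ] Plane).hasFDerivAt.comp w (hA.comp w
        (P.symm : Plane →L[ℝ] Plane).hasFDerivAt)
    have hdu : ‖u - u'‖ ≤ R := by
      rw [norm_sub_rev, ← dist_eq_norm]; exact (mem_ball.1 hu'b).le
    have hdF : ‖F u - F u'‖ ≤ K * R := by
      have := hF.dist_le_mul u huΩ u' (hball hu'b)
      rw [dist_eq_norm, dist_eq_norm] at this
      exact this.trans (by gcongr)
    -- Each of the two metrics contributes a factor of at most `1 + δ` to squared lengths, hence a
    -- total of `1 + δ` for lengths.
    have hfac : (1 + ℓ' * (K * R)) * (1 + ℓ * R) ≤ (1 + δ) ^ 2 := by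
      have h1 : ℓ' * (K * R) ≤ δ := by rw [hδ, hΛ]; nlinarith [mul_nonneg hℓ hR.le]
      have h2 : ℓ * R ≤ δ := by
        rw [hδ, hΛ]; nlinarith [mul_nonneg (mul_nonneg hℓ' K.coe_nonneg) hR.le]
      have h3 : 0 ≤ ℓ' * (K * R) := by positivity
      have h4 : 0 ≤ ℓ * R := by positivity
      nlinarith
    have hnn : ∀ v, 0 ≤ q' (F u) v := fun v => by rw [hQ]; positivity
    have hnn2 : ∀ v, 0 ≤ q u v := fun v => by rw [hP]; positivity
    have hval : ∀ v, ‖((Q : Plane →L[ℝ] Plane) ∘L A ∘L (P.symm : Plane →L[ℝ] Plane)) v‖ ^ 2 =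
        q' (F u) (A (P.symm v)) := fun v => (hQ _).symm
    have hup : ∀ v, q' (F u) (A (P.symm v)) ≤ (1 + δ) ^ 2 * ‖v‖ ^ 2 := by
      intro v
      have hv : ‖v‖ ^ 2 = q u (P.symm v) := by rw [hP, P.apply_symm_apply]
      have h1 := hq'.ratio (F u) (hmaps huΩ) (F u') (hmaps (hball hu'b)) (A (P.symm v))
      have h2 := hq.ratio u' (hΩ (hball hu'b)) u (hΩ huΩ) (P.symm v)
      rw [norm_sub_rev] at h2
      rw [hAq] at h1
      calc q' (F u) (A (P.symm v)) ≤ (1 + ℓ' * ‖F u - F u'‖) * q u' (P.symm v) := h1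
        _ ≤ (1 + ℓ' * ‖F u - F u'‖) * ((1 + ℓ * ‖u - u'‖) * q u (P.symm v)) := by gcongr
        _ ≤ (1 + ℓ' * (K * R)) * ((1 + ℓ * R) * q u (P.symm v)) := by
            have := hnn2 (P.symm v)
            gcongr
        _ = (1 + ℓ' * (K * R)) * (1 + ℓ * R) * q u (P.symm v) := by ring
        _ ≤ (1 + δ) ^ 2 * q u (P.symm v) := mul_le_mul_of_nonneg_right hfac (hnn2 _)
        _ = _ := by rw [hv]
    have hlo : ∀ v, ‖v‖ ^ 2 ≤ (1 + δ) ^ 2 * q' (F u) (A (P.symm v)) := by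
      intro v
      have hv : ‖v‖ ^ 2 = q u (P.symm v) := by rw [hP, P.apply_symm_apply]
      have h1 := hq'.ratio (F u') (hmaps (hball hu'b)) (F u) (hmaps huΩ) (A (P.symm v))
      have h2 := hq.ratio u (hΩ huΩ) u' (hΩ (hball hu'b)) (P.symm v)
      rw [norm_sub_rev] at h1
      rw [hAq] at h1
      calc ‖v‖ ^ 2 ≤ (1 + ℓ * ‖u - u'‖) * q u' (P.symm v) := hv ▸ h2
        _ ≤ (1 + ℓ * ‖u - u'‖) * ((1 + ℓ' * ‖F u - F u'‖) * q' (F u) (A (P.symm v))) := by gcongr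
        _ ≤ (1 + ℓ * R) * ((1 + ℓ' * (K * R)) * q' (F u) (A (P.symm v))) := by
            have := hnn (A (P.symm v))
            gcongr
        _ = (1 + ℓ' * (K * R)) * (1 + ℓ * R) * q' (F u) (A (P.symm v)) := by ring
        _ ≤ _ := mul_le_mul_of_nonneg_right hfac (hnn _)
    refine ⟨fun v => ?_, fun v => ?_⟩
    · have h1 : ‖v‖ ≤ (1 + δ) * ‖((Q : Plane →L[ℝ] Plane) ∘L A ∘L (P.symm : Plane →L[ℝ] Plane)) v‖ := by
        rw [← sq_le_sq₀ (norm_nonneg _) (by positivity), mul_pow, hval]; exact hlo v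
      have h2 := norm_nonneg (((Q : Plane →L[ℝ] Plane) ∘L A ∘L (P.symm : Plane →L[ℝ] Plane)) v)
      have h3 : 0 ≤ 1 - δ := by linarith
      nlinarith [mul_le_mul_of_nonneg_left h1 h3, mul_nonneg (sq_nonneg δ) h2]
    · rw [← sq_le_sq₀ (norm_nonneg _) (by positivity), mul_pow, hval]; exact hup v
  have hGinj : ∀ᵐ z : Plane, (ball y₀ (c * R) ∩ G ⁻¹' {z}).Subsingleton := by
    filter_upwards [hlinae Q.symm hinj] with z hz a ha b hb
    have h1 : ∀ w ∈ ball y₀ (c * R) ∩ G ⁻¹' {z}, P.symm w ∈ Ω ∩ F ⁻¹' {Q.symm z} := by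
      rintro w ⟨hw, hwz⟩
      refine ⟨hball (hmapsP hw), ?_⟩
      rw [mem_preimage, mem_singleton_iff, ← show G w = z from hwz, hG]
      exact (Q.symm_apply_apply _).symm
    exact P.symm.injective (hz (h1 a ha) (h1 b hb))
  set η := √(8 * δ) with hη
  have hη1 : η ≤ 1 := Real.sqrt_le_one.2 h8δ
  have hδη : δ ≤ η := Real.le_sqrt_of_sq_le (by nlinarith)
  have hh : 0 < c * R / 4 := by positivity
  have hcb : closedBall y₀ (c * R / 4) ⊆ ball y₀ (c * R / 2) :=
    closedBall_subset_ball (by linarith [mul_pos hc hR])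
  have hbb : ball y₀ (c * R / 2) ⊆ ball y₀ (c * R) :=
    ball_subset_ball (by linarith [mul_pos hc hR])
  obtain ⟨B, hB⟩ := exists_linear_approx (F := G) (x₀ := y₀) hh (Real.sqrt_nonneg (8 * δ)) hη1
    (fun x hx y hy => (norm_sub_le_of_ae_norm_fderiv_le hGlip (by
      filter_upwards [hGder] with w hw hmem
      obtain ⟨A, h1, -, h3⟩ := hw hmem
      exact ⟨A, h1, h3⟩) (hbb (hcb hx)) (hbb (hcb hy))).trans (by gcongr))
    (fun x hx y hy => norm_sub_ge_of_ae_almost_isometric hδ0 (by linarith) hGlip hGder hGinj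
      (hcb hx) (hcb hy))
  refine ⟨(Q.symm : Plane →L[ℝ] Plane) ∘L B ∘L (P : Plane →L[ℝ] Plane), fun x hx => ?_⟩
  have hPx : P x ∈ closedBall y₀ (c * R / 4) := by
    rw [mem_closedBall, dist_eq_norm, hy₀, ← map_sub]
    rw [mem_ball, dist_eq_norm] at hx
    calc ‖P (x - u)‖ ≤ C * ‖x - u‖ := hPle _
      _ ≤ C * (min 1 (c / (4 * C)) * R) := by gcongr
      _ ≤ C * (c / (4 * C) * R) := by gcongr; exact min_le_right _ _
      _ = c * R / 4 := by field_simp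
  have h1 := hB (P x) hPx
  have h2 : Q (F x - F u - (Q.symm : Plane →L[ℝ] Plane) (B (P (x - u)))) =
      G (P x) - G y₀ - B (P x - y₀) := by
    simp [hG, hy₀, map_sub]
  have h3 := hQge (F x - F u - (Q.symm : Plane →L[ℝ] Plane) (B (P (x - u))))
  rw [h2] at h3
  have h4 : √η = fourthRoot (8 * Λ) * fourthRoot R := by
    rw [← fourthRoot_mul (by positivity), hη, hδ, ← mul_assoc]; rfl
  rw [← hη, h4] at h1
  have h5 := h3.trans h1
  calc ‖F x - F u - (Q.symm : Plane →L[ℝ] Plane) (B (P (x - u)))‖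
      ≤ (9 * (fourthRoot (8 * Λ) * fourthRoot R) * (c * R / 4)) / c' := by
        rw [le_div_iff₀ hc']; linarith
    _ = _ := by ring

section Holder

variable {F : Plane → Plane} {Ω : Set Plane} {C₀ θ R₀ : ℝ} (hC₀ : 0 ≤ C₀) (hθ0 : 0 < θ)
  (hθ1 : θ ≤ 1)
  (happ : ∀ u R, 0 < R → R ≤ R₀ → ball u R ⊆ Ω →
      ∃ A : Plane →L[ℝ] Plane, ∀ x ∈ ball u (θ * R),
        ‖F x - F u - A (x - u)‖ ≤ C₀ * fourthRoot R * R)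
include hC₀ hθ0 happ

/-- A Campanato argument: the linear approximations at comparable scales `t' ≤ t` both fit `F` on a
common ball, so they differ by `O(t^{1/4})`. They converge as the scale tends to zero, and the limit
is the derivative, with a rate. -/
theorem exists_hasFDerivAt_of_affine_approx :
    ∃ C₁, 0 ≤ C₁ ∧ ∀ u R, 0 < R → R ≤ R₀ → ball u R ⊆ Ω →
      HasFDerivAt F (fderiv ℝ F u) u ∧ ∀ x, ‖x - u‖ ≤ θ / 2 * R →
        ‖F x - F u - fderiv ℝ F u (x - u)‖ ≤ C₁ * fourthRoot ‖x - u‖ * ‖x - u‖ := by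
  set C' := 8 * C₀ / θ / (1 - fourthRoot (1 / 2)) with hC'
  have hd : 0 < 1 - fourthRoot (1 / 2) := by linarith [fourthRoot_lt_one (s := 1 / 2) (by norm_num)]
  have hC'0 : 0 ≤ C' := by positivity
  have hω0 := fourthRoot_nonneg (2 / θ)
  refine ⟨fourthRoot (2 / θ) * (C₀ * (2 / θ) + C'), by positivity, fun u R hR hRR₀ hball => ?_⟩
  have hex : ∀ t, ∃ A : Plane →L[ℝ] Plane, 0 < t → t ≤ R → ∀ x ∈ ball u (θ * t),
      ‖F x - F u - A (x - u)‖ ≤ C₀ * fourthRoot t * t := by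
    intro t
    by_cases ht : 0 < t ∧ t ≤ R
    · obtain ⟨A, hA⟩ := happ u t ht.1 (ht.2.trans hRR₀) ((ball_subset_ball ht.2).trans hball)
      exact ⟨A, fun _ _ => hA⟩
    · exact ⟨0, fun h1 h2 => absurd ⟨h1, h2⟩ ht⟩
  choose h hh using hex
  obtain ⟨A, hA, -⟩ := exists_limit_of_chain (h := h) (C := 8 * C₀ / θ) (R := R) (κ := 1 / 2)
    (by positivity) hR (by norm_num) (by norm_num) (by
      intro t ht htR t' h1 h2
      have ht' : 0 < t' := by linarith
      have hb := opNorm_le_of_forall_ball (B := h t - h t') (ε := θ * t' / 2)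
        (M := 2 * (C₀ * fourthRoot t * t)) (by positivity)
        (by have := fourthRoot_nonneg t; positivity) (by
          intro v hv
          have hv' : ‖v‖ < θ * t' := by linarith [mul_pos hθ0 ht']
          have e1 := hh t ht htR (u + v) (by
            rw [mem_ball, dist_eq_norm, add_sub_cancel_left]
            exact hv'.trans_le (by gcongr))
          have e2 := hh t' ht' (h2.trans htR) (u + v) (by
            rw [mem_ball, dist_eq_norm, add_sub_cancel_left]; exact hv')
          rw [add_sub_cancel_left] at e1 e2
          have e3 : C₀ * fourthRoot t' * t' ≤ C₀ * fourthRoot t * t := by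
            have := fourthRoot_mono h2
            have := fourthRoot_nonneg t
            gcongr
          have e4 : (h t - h t') v = (F (u + v) - F u - h t' v) - (F (u + v) - F u - h t v) := by
            rw [sub_apply]; abel
          rw [e4]
          refine (norm_sub_le _ _).trans ?_
          linarith)
      refine hb.trans ?_
      have h3 := fourthRoot_nonneg t
      rw [div_le_iff₀ (by positivity)]
      have h4 : 8 * C₀ / θ * fourthRoot t * (θ * t' / 2) = 4 * C₀ * fourthRoot t * t' := by
        field_simp; ring
      rw [h4]
      nlinarith [mul_nonneg hC₀ h3])
  have hest : ∀ x, ‖x - u‖ ≤ θ / 2 * R → ‖F x - F u - A (x - u)‖ ≤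
      fourthRoot (2 / θ) * (C₀ * (2 / θ) + C') * fourthRoot ‖x - u‖ * ‖x - u‖ := by
    intro x hx
    rcases eq_or_ne x u with rfl | hne
    · simp
    set s := ‖x - u‖ with hs
    have hs0 : 0 < s := norm_pos_iff.2 (sub_ne_zero.2 hne)
    -- The scale at which `x` lies at half the radius of the ball of approximation.
    set t := 2 / θ * s with ht
    have ht0 : 0 < t := by positivity
    have htR : t ≤ R := by
      calc t ≤ 2 / θ * (θ / 2 * R) := by rw [ht]; gcongr
        _ = R := by field_simp
    have hθt : θ * t = 2 * s := by rw [ht]; field_simp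
    have h1 := hh t ht0 htR x (by rw [mem_ball, dist_eq_norm, hθt]; linarith)
    have h2 := hA t ht0 htR
    have h3 : ‖(h t - A) (x - u)‖ ≤ C' * fourthRoot t * s :=
      ((h t - A).le_opNorm _).trans (by gcongr)
    have h4 : F x - F u - A (x - u) = (F x - F u - h t (x - u)) + (h t - A) (x - u) := by
      rw [sub_apply]; abel
    have h5 : fourthRoot t = fourthRoot (2 / θ) * fourthRoot s := fourthRoot_mul (by positivity) _
    rw [h4]
    refine (norm_add_le _ _).trans ((add_le_add h1 h3).trans ?_)
    rw [h5, ht]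
    exact le_of_eq (by ring)
  set C₁ := fourthRoot (2 / θ) * (C₀ * (2 / θ) + C') with hC₁
  have hderiv : HasFDerivAt F A u := by
    rw [hasFDerivAt_iff_isLittleO, Asymptotics.isLittleO_iff]
    intro ε hε
    have h1 : Tendsto (fun x => C₁ * fourthRoot ‖x - u‖) (𝓝 u) (𝓝 0) := by
      have h0 : Continuous fun x => C₁ * fourthRoot ‖x - u‖ :=
        continuous_const.mul (continuous_fourthRoot.comp (continuous_id.sub continuous_const).norm)
      have := h0.tendsto u
      rwa [sub_self, norm_zero, fourthRoot_zero, mul_zero] at this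
    have h2 : ∀ᶠ x in 𝓝 u, x ∈ ball u (θ / 2 * R) := ball_mem_nhds _ (by positivity)
    filter_upwards [h1.eventually (gt_mem_nhds hε), h2] with x hx hxb
    rw [mem_ball, dist_eq_norm] at hxb
    exact (hest x hxb.le).trans (by gcongr)
  rw [hderiv.fderiv]
  exact ⟨hderiv, hest⟩

include hθ1 in
-- The first-order expansions at `u` and `u'` are compared at the points `u' + v` with `‖v‖ ≤ s =
-- ‖u' - u‖`. The three remainders amount to `4 + 1 + 1` times `C₁ * fourthRoot s * s`.
theorem exists_holder_fderiv_of_affine_approx :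
    ∃ C₂, 0 ≤ C₂ ∧ ∀ u u' R, 0 < R → R ≤ R₀ → ball u R ⊆ Ω → ‖u' - u‖ ≤ θ * R / 8 →
      ‖fderiv ℝ F u - fderiv ℝ F u'‖ ≤ C₂ * fourthRoot ‖u' - u‖ := by
  obtain ⟨C₁, hC₁, h⟩ := exists_hasFDerivAt_of_affine_approx hC₀ hθ0 happ
  refine ⟨6 * C₁, by positivity, fun u u' R hR hRR₀ hball hs => ?_⟩
  rcases eq_or_ne u' u with rfl | hne
  · simp [fourthRoot_zero]
  set s := ‖u' - u‖ with hs_def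
  have hs0 : 0 < s := norm_pos_iff.2 (sub_ne_zero.2 hne)
  have hθR : θ * R ≤ R := by nlinarith
  have hball' : ball u' (R / 2) ⊆ Ω :=
    (ball_subset_ball' (by rw [dist_eq_norm]; linarith)).trans hball
  obtain ⟨-, h1⟩ := h u R hR hRR₀ hball
  obtain ⟨-, h2⟩ := h u' (R / 2) (by positivity) (by linarith) hball'
  have hω := fourthRoot_nonneg s
  have hω2 : fourthRoot (2 * s) ≤ 2 * fourthRoot s := by
    have h4 : fourthRoot 2 ≤ 2 := by
      rw [fourthRoot, Real.sqrt_le_left (by norm_num), Real.sqrt_le_left (by norm_num)]; norm_num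
    rw [fourthRoot_mul (by norm_num)]
    gcongr
  refine (opNorm_le_of_forall_ball (ε := s) (M := 6 * C₁ * fourthRoot s * s) hs0 (by positivity)
    fun v hv => ?_).trans (by rw [mul_div_assoc, div_self hs0.ne', mul_one])
  have e1 := h1 (u' + v) (by
    calc ‖u' + v - u‖ = ‖(u' - u) + v‖ := by congr 1; abel
      _ ≤ s + s := (norm_add_le _ _).trans (add_le_add le_rfl hv)
      _ ≤ θ / 2 * R := by linarith [mul_pos hθ0 hR])
  have e2 := h1 u' (by linarith [mul_pos hθ0 hR])
  have e3 := h2 (u' + v) (by rw [add_sub_cancel_left]; linarith [mul_pos hθ0 hR])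
  rw [add_sub_cancel_left] at e3
  have hn : ‖u' + v - u‖ ≤ 2 * s := by
    calc ‖u' + v - u‖ = ‖(u' - u) + v‖ := by congr 1; abel
      _ ≤ 2 * s := (norm_add_le _ _).trans (by linarith)
  have f1 : C₁ * fourthRoot ‖u' + v - u‖ * ‖u' + v - u‖ ≤ C₁ * (2 * fourthRoot s) * (2 * s) := by
    have := (fourthRoot_mono hn).trans hω2
    gcongr
  have f3 : C₁ * fourthRoot ‖v‖ * ‖v‖ ≤ C₁ * fourthRoot s * s := by
    have := fourthRoot_mono hv
    gcongr
  have e4 : (fderiv ℝ F u - fderiv ℝ F u') v =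
      (F (u' + v) - F u' - fderiv ℝ F u' v) + (F u' - F u - fderiv ℝ F u (u' - u)) -
        (F (u' + v) - F u - fderiv ℝ F u (u' + v - u)) := by
    rw [show u' + v - u = (u' - u) + v by abel, map_add, sub_apply]; abel
  rw [e4]
  refine (norm_sub_le _ _).trans ((add_le_add (norm_add_le _ _) le_rfl).trans ?_)
  linarith

end Holder

end PlaneRigidity


/-! ### Rigidity up to a Lipschitz boundary -/

section BoundaryRigidity

open Metric

/-- The vertical unit vector. -/
def vert : Plane := EuclideanSpace.single 1 1

theorem norm_vert : ‖vert‖ = 1 := by simp [vert]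

/-- A uniform interior cone: with `β = 1 / (1 + Γ)`, a displacement less than `β t` loses less than
`β t` in height while the graph rises by at most `Γ β t`, and the two add up to `t`. -/
theorem ball_add_vert_subset {γ : ℝ → ℝ} {Γ : ℝ≥0} (hγ : LipschitzWith Γ γ) {x : Plane}
    (hx : γ (x 0) ≤ x 1) {t : ℝ} :
    ball (x + t • vert) ((1 + (Γ : ℝ))⁻¹ * t) ⊆ {u : Plane | γ (u 0) < u 1} := by
  intro u hu
  rw [mem_ball, dist_eq_norm] at hu
  set β := (1 + (Γ : ℝ))⁻¹ with hβ
  have hβΓ : β * t * (1 + Γ) = t := by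
    rw [hβ]; field_simp
  have h0 : |u 0 - x 0| ≤ ‖u - (x + t • vert)‖ := by
    have := PiLp.norm_apply_le (u - (x + t • vert)) 0
    simpa [vert] using this
  have h1 : |u 1 - (x 1 + t)| ≤ ‖u - (x + t • vert)‖ := by
    have := PiLp.norm_apply_le (u - (x + t • vert)) 1
    simpa [vert] using this
  have h2 := hγ.dist_le_mul (u 0) (x 0)
  rw [Real.dist_eq, Real.dist_eq] at h2
  have h3 := (abs_le.1 h2).2
  have h4 := (abs_le.1 h1).1
  have h5 : (Γ : ℝ) * |u 0 - x 0| ≤ Γ * ‖u - (x + t • vert)‖ := by gcongr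
  have h6 : (Γ : ℝ) * ‖u - (x + t • vert)‖ ≤ Γ * (β * t) := by gcongr
  change γ (u 0) < u 1
  nlinarith

variable {γ : ℝ → ℝ} {Γ : ℝ≥0} {S : Set Plane} {p : Plane} {r : ℝ}

/-- The domain contains a truncated open cone with vertex `p`, so derivatives within it are
determined even at boundary points. -/
theorem uniqueDiffWithinAt_of_graph (hr : 0 < r) (hγ : LipschitzWith Γ γ) (hp : p ∈ S)
    (hS : ∀ u ∈ ball p r, (u ∈ S ↔ γ (u 0) ≤ u 1)) : UniqueDiffWithinAt ℝ S p := by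
  have hβ : (0 : ℝ) < (1 + (Γ : ℝ))⁻¹ := by positivity
  have hpγ := (hS p (mem_ball_self hr)).1 hp
  -- the open cone with vertex `p` around the vertical direction
  set Co : Set Plane := {u | ∃ t : ℝ, 0 < t ∧ u ∈ ball (p + t • vert) ((1 + (Γ : ℝ))⁻¹ * t)} with hCo
  have hconv : Convex ℝ Co := by
    rintro u ⟨t, ht, hu⟩ v ⟨s, hs, hv⟩ a b ha hb hab
    have hpos : 0 < a * t + b * s := by
      rcases ha.eq_or_lt with rfl | ha
      · have : b = 1 := by linarith
        subst this; linarith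
      · have := mul_pos ha ht
        have := mul_nonneg hb hs.le
        linarith
    refine ⟨a * t + b * s, hpos, ?_⟩
    rw [mem_ball, dist_eq_norm] at hu hv ⊢
    have h1 : a • u + b • v - (p + (a * t + b * s) • vert) =
        a • (u - (p + t • vert)) + b • (v - (p + s • vert)) := by
      have : p = (a + b) • p := by rw [hab, one_smul]
      nth_rewrite 1 [this]
      module
    rw [h1]
    refine (norm_add_le _ _).trans_lt ?_
    rw [norm_smul, norm_smul, Real.norm_of_nonneg ha, Real.norm_of_nonneg hb]
    rcases ha.eq_or_lt with rfl | ha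
    · have : b = 1 := by linarith
      subst this; linarith
    · have h3 := mul_lt_mul_of_pos_left hu ha
      have h4 := mul_le_mul_of_nonneg_left hv.le hb
      linarith
  have hsub : Co ∩ ball p r ⊆ S := by
    rintro u ⟨⟨t, ht, hu⟩, hur⟩
    exact (hS u hur).2 (ball_add_vert_subset hγ hpγ hu).le
  have hmem : ∀ t : ℝ, 0 < t → p + t • vert ∈ Co := fun t ht =>
    ⟨t, ht, mem_ball_self (by positivity)⟩
  refine UniqueDiffWithinAt.mono (s := Co ∩ ball p r) ?_ hsub
  refine uniqueDiffWithinAt_convex (hconv.inter (convex_ball _ _)) ?_ ?_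
  · have hopen : IsOpen Co := by
      have : Co = ⋃ (t : ℝ) (_ : 0 < t), ball (p + t • vert) ((1 + (Γ : ℝ))⁻¹ * t) := by
        ext u; simp [hCo]
      rw [this]
      exact isOpen_iUnion fun t => isOpen_iUnion fun _ => isOpen_ball
    rw [(hopen.inter isOpen_ball).interior_eq]
    refine ⟨p + (r / 2) • vert, hmem _ (by positivity), ?_⟩
    rw [mem_ball, dist_eq_norm, add_sub_cancel_left, norm_smul, norm_vert, mul_one,
      Real.norm_of_nonneg (by positivity)]
    linarith
  · have h1 : Tendsto (fun t : ℝ => p + t • vert) (𝓝[>] 0) (𝓝 p) := by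
      have h0 : Continuous fun t : ℝ => p + t • vert := by fun_prop
      have h2 : Tendsto (fun t : ℝ => p + t • vert) (𝓝 0) (𝓝 (p + (0 : ℝ) • vert)) := h0.tendsto 0
      rw [zero_smul, add_zero] at h2
      exact h2.mono_left nhdsWithin_le_nhds
    refine mem_closure_of_tendsto h1 ?_
    filter_upwards [self_mem_nhdsWithin, h1.eventually (ball_mem_nhds p hr)] with t ht htr
    exact ⟨hmem t ht, htr⟩

/-- If the derivative of a map has a limit at a point of a domain with Lipschitz boundary, then the
map is differentiable there. -/
theorem hasFDerivWithinAt_of_tendsto_fderiv (hr : 0 < r) (hγ : LipschitzWith Γ γ) (hp : p ∈ S)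
    (hS : ∀ u ∈ ball p r, (u ∈ S ↔ γ (u 0) ≤ u 1)) {F : Plane → Plane}
    (hF : ContinuousOn F (S ∩ ball p r))
    (hdiff : ∀ u ∈ ball p r, γ (u 0) < u 1 → DifferentiableAt ℝ F u) {A : Plane →L[ℝ] Plane}
    (hA : ∀ ε > 0, ∃ d > 0, ∀ u ∈ ball p d, u ∈ ball p r → γ (u 0) < u 1 →
      ‖fderiv ℝ F u - A‖ ≤ ε) :
    HasFDerivWithinAt F A S p := by
  set β := (1 + (Γ : ℝ))⁻¹ with hβ_def
  have hβ : 0 < β := by positivity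
  have hβ1 : β ≤ 1 := inv_le_one_of_one_le₀ (by linarith [Γ.coe_nonneg])
  -- At height `T = M ‖x - p‖` above `p` there is room for a ball of radius `β T = 2 ‖x - p‖`, which
  -- contains the point at height `T` above `x`.
  set M := 2 / β with hM
  have hM2 : 2 ≤ M := by rw [hM, le_div_iff₀ hβ]; linarith
  rw [hasFDerivWithinAt_iff_isLittleO, Asymptotics.isLittleO_iff]
  intro ε hε
  -- The segment from `p` to `x` may leave the domain. The detour up, across and down has length `2
  -- T + ‖x - p‖ = (2 M + 1) ‖x - p‖`, hence the divisor.
  obtain ⟨d, hd, hAd⟩ := hA (ε / (2 * M + 1)) (by positivity)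
  set d' := min d r with hd'
  have hd'0 : 0 < d' := lt_min hd hr
  set Ω := {u : Plane | γ (u 0) < u 1} ∩ ball p d' with hΩ
  have hΩd : ∀ u ∈ Ω, HasFDerivAt (fun x => F x - A x) (fderiv ℝ F u - A) u ∧
      ‖fderiv ℝ F u - A‖ ≤ ε / (2 * M + 1) := by
    rintro u ⟨hu, hub⟩
    have hur : u ∈ ball p r := ball_subset_ball (min_le_right _ _) hub
    have hud : u ∈ ball p d := ball_subset_ball (min_le_left _ _) hub
    exact ⟨(hdiff u hur hu).hasFDerivAt.sub A.hasFDerivAt, hAd u hud hur hu⟩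
  have hseg : ∀ W : Set Plane, Convex ℝ W → W ⊆ Ω → ∀ a ∈ W, ∀ b ∈ W,
      ‖(F b - A b) - (F a - A a)‖ ≤ ε / (2 * M + 1) * ‖b - a‖ := by
    intro W hW hWΩ a ha b hb
    exact hW.norm_image_sub_le_of_norm_hasFDerivWithin_le
      (fun u hu => (hΩd u (hWΩ hu)).1.hasFDerivWithinAt) (fun u hu => (hΩd u (hWΩ hu)).2) ha hb
  have hvert : ∀ x ∈ S, x ∈ ball p d' → ∀ T, 0 < T → ‖x - p‖ + T < d' →
      ‖(F (x + T • vert) - A (x + T • vert)) - (F x - A x)‖ ≤ ε / (2 * M + 1) * T := by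
    intro x hxS hxb T hT hxT
    have hxγ : γ (x 0) ≤ x 1 := (hS x (ball_subset_ball (min_le_right _ _) hxb)).1 hxS
    have hin : ∀ t, 0 < t → t ≤ T → x + t • vert ∈ Ω := by
      intro t ht htT
      refine ⟨ball_add_vert_subset hγ hxγ (mem_ball_self (by positivity : 0 < (1 + (Γ : ℝ))⁻¹ * t)), ?_⟩
      rw [mem_ball, dist_eq_norm]
      calc ‖x + t • vert - p‖ = ‖(x - p) + t • vert‖ := by congr 1; abel
        _ ≤ ‖x - p‖ + t := (norm_add_le _ _).trans (by
            rw [norm_smul, norm_vert, mul_one, Real.norm_of_nonneg ht.le])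
        _ < d' := by linarith
    have hcontx : ContinuousWithinAt (fun u => F u - A u) (S ∩ ball p r) x :=
      (hF x ⟨hxS, ball_subset_ball (min_le_right _ _) hxb⟩).sub A.continuous.continuousWithinAt
    have h1 : Tendsto (fun t : ℝ => x + t • vert) (𝓝[>] 0) (𝓝[S ∩ ball p r] x) := by
      refine tendsto_nhdsWithin_iff.2 ⟨?_, ?_⟩
      · have h0 : Continuous fun t : ℝ => x + t • vert := by fun_prop
        have h2 : Tendsto (fun t : ℝ => x + t • vert) (𝓝 0) (𝓝 (x + (0 : ℝ) • vert)) := h0.tendsto 0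
        rw [zero_smul, add_zero] at h2
        exact h2.mono_left nhdsWithin_le_nhds
      · filter_upwards [Ioc_mem_nhdsGT hT] with t ht
        have h3 := hin t ht.1 ht.2
        have h4 : x + t • vert ∈ ball p r := ball_subset_ball (min_le_right _ _) h3.2
        exact ⟨(hS _ h4).2 (le_of_lt h3.1), h4⟩
    -- The lower endpoint may lie on the graph, where `F` is only continuous; the estimate is proved
    -- from height `t` upwards and `t` tends to `0`.
    have h2 := hcontx.tendsto.comp h1
    refine le_of_tendsto ((tendsto_const_nhds
      (x := F (x + T • vert) - A (x + T • vert))).sub h2).norm ?_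
    filter_upwards [Ioc_mem_nhdsGT hT] with t ht
    have hsub : segment ℝ (x + t • vert) (x + T • vert) ⊆ Ω := by
      rw [segment_eq_image']
      rintro _ ⟨s, hs, rfl⟩
      have h5 : x + t • vert + s • (x + T • vert - (x + t • vert)) = x + (t + s * (T - t)) • vert := by
        module
      simp only [h5]
      have h6 : 0 ≤ s * (T - t) := mul_nonneg hs.1 (by linarith [ht.2])
      have h7 : s * (T - t) ≤ T - t := mul_le_of_le_one_left (by linarith [ht.2]) hs.2
      exact hin _ (by linarith [ht.1]) (by linarith)
    refine (hseg _ (convex_segment _ _) hsub _ (left_mem_segment _ _ _) _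
      (right_mem_segment _ _ _)).trans ?_
    have h8 : x + T • vert - (x + t • vert) = (T - t) • vert := by module
    rw [h8, norm_smul, norm_vert, mul_one, Real.norm_of_nonneg (by linarith [ht.2])]
    gcongr
    linarith [ht.1]
  rw [eventually_nhdsWithin_iff]
  filter_upwards [ball_mem_nhds p (show 0 < d' / (2 * M + 2) by positivity)] with x hx hxS
  rcases eq_or_ne x p with rfl | hne
  · simp
  set s := ‖x - p‖ with hs_def
  have hs0 : 0 < s := norm_pos_iff.2 (sub_ne_zero.2 hne)
  have hsd : s * (2 * M + 2) < d' := by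
    rw [mem_ball, dist_eq_norm, ← hs_def, lt_div_iff₀ (by positivity)] at hx
    exact hx
  have hxb : x ∈ ball p d' := by
    rw [mem_ball, dist_eq_norm, ← hs_def]
    nlinarith
  set T := M * s with hT_def
  have hT0 : 0 < T := by positivity
  have hβT : β * T = 2 * s := by rw [hT_def, hM]; field_simp
  have hpb : p ∈ ball p d' := mem_ball_self hd'0
  have e1 := hvert x hxS hxb T hT0 (by rw [← hs_def, hT_def]; nlinarith)
  have e2 := hvert p hp hpb T hT0 (by rw [sub_self, norm_zero, hT_def]; nlinarith)
  have hpγ := (hS p (mem_ball_self hr)).1 hp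
  have hWsub : ball (p + T • vert) (β * T) ⊆ Ω := by
    refine subset_inter (ball_add_vert_subset hγ hpγ) (ball_subset_ball' ?_)
    rw [dist_eq_norm, add_sub_cancel_left, norm_smul, norm_vert, mul_one,
      Real.norm_of_nonneg hT0.le, hβT, hT_def]
    nlinarith
  have hxpT : x + T • vert - (p + T • vert) = x - p := by abel
  have e3 := hseg _ (convex_ball _ _) hWsub (p + T • vert) (mem_ball_self (by positivity))
    (x + T • vert) (by rw [mem_ball, dist_eq_norm, hxpT, ← hs_def, hβT]; linarith)
  rw [hxpT, ← hs_def] at e3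
  have e4 : F x - F p - A (x - p) =
      -((F (x + T • vert) - A (x + T • vert)) - (F x - A x)) +
      (((F (x + T • vert) - A (x + T • vert)) - (F (p + T • vert) - A (p + T • vert))) +
      ((F (p + T • vert) - A (p + T • vert)) - (F p - A p))) := by
    rw [map_sub]; abel
  rw [e4]
  refine (norm_add_le _ _).trans ((add_le_add le_rfl (norm_add_le _ _)).trans ?_)
  rw [norm_neg]
  have e5 : ε / (2 * M + 1) * T + (ε / (2 * M + 1) * s + ε / (2 * M + 1) * T) = ε * s := by
    rw [hT_def]; field_simp; ring
  linarith

/-- Joint continuity in base point and vector: the ratio bound in both directions squeezes `q (z a)`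
between multiples of `q z₀` with factors tending to `1`. -/
theorem PlaneMetric.tendsto {q : Plane → Plane → ℝ} {U : Set Plane} {c C ℓ : ℝ}
    (hq : PlaneMetric q U c C ℓ) {α : Type*} {l : Filter α} {z w : α → Plane} {z₀ w₀ : Plane}
    (hz₀ : z₀ ∈ U) (hz : Tendsto z l (𝓝 z₀)) (hzU : ∀ᶠ a in l, z a ∈ U) (hw : Tendsto w l (𝓝 w₀)) :
    Tendsto (fun a => q (z a) (w a)) l (𝓝 (q z₀ w₀)) := by
  obtain ⟨P, hP⟩ := hq.frame z₀ hz₀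
  have h1 : Tendsto (fun a => q z₀ (w a)) l (𝓝 (q z₀ w₀)) := by
    simp only [hP]
    exact ((P.continuous.tendsto w₀).comp hw).norm.pow 2
  have h2 : Tendsto (fun a => 1 + ℓ * ‖z a - z₀‖) l (𝓝 1) := by
    have h3 : Tendsto (fun a => 1 + ℓ * ‖z a - z₀‖) l (𝓝 (1 + ℓ * ‖z₀ - z₀‖)) :=
      tendsto_const_nhds.add (tendsto_const_nhds.mul (hz.sub tendsto_const_nhds).norm)
    rwa [sub_self, norm_zero, mul_zero, add_zero] at h3
  have hpos : ∀ a, 0 < 1 + ℓ * ‖z a - z₀‖ := fun a => by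
    have := mul_nonneg hq.lip_nonneg (norm_nonneg (z a - z₀)); linarith
  have h3 : Tendsto (fun a => q z₀ (w a) / (1 + ℓ * ‖z a - z₀‖)) l (𝓝 (q z₀ w₀)) := by
    have h3 := h1.div h2 one_ne_zero
    rwa [div_one] at h3
  have h4 : Tendsto (fun a => (1 + ℓ * ‖z a - z₀‖) * q z₀ (w a)) l (𝓝 (q z₀ w₀)) := by
    have h4 := h2.mul h1
    rwa [one_mul] at h4
  refine tendsto_of_tendsto_of_tendsto_of_le_of_le' h3 h4 ?_ ?_
  · filter_upwards [hzU] with a ha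
    rw [div_le_iff₀ (hpos a), mul_comm, norm_sub_rev]
    exact hq.ratio _ hz₀ _ ha _
  · filter_upwards [hzU] with a ha
    exact hq.ratio _ ha _ hz₀ _

/-- Lipschitz maps between planar domains with Lipschitz boundary which are almost everywhere
infinitesimally isometric and almost everywhere injective are differentiable up to the boundary,
with isometric differential. -/
theorem exists_hasFDerivWithinAt_of_ae_isometric {q q' : Plane → Plane → ℝ} {U' : Set Plane}
    {c C ℓ c' C' ℓ' : ℝ} (hr : 0 < r) (hγ : LipschitzWith Γ γ) (hp : p ∈ S)
    (hS : ∀ u ∈ ball p r, (u ∈ S ↔ γ (u 0) ≤ u 1))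
    (hq : PlaneMetric q (ball p r) c C ℓ) (hq' : PlaneMetric q' U' c' C' ℓ')
    {F : Plane → Plane} {K : ℝ≥0} (hmaps : MapsTo F (S ∩ ball p r) U')
    (hF : LipschitzOnWith K F (S ∩ ball p r))
    (hder : ∀ᵐ u : Plane, u ∈ S ∩ ball p r → ∃ A : Plane →L[ℝ] Plane, HasFDerivWithinAt F A S u ∧
      ∀ w, q' (F u) (A w) = q u w)
    (hinj : ∀ᵐ z : Plane, ((S ∩ ball p r) ∩ F ⁻¹' {z}).Subsingleton) :
    ∃ A : Plane →L[ℝ] Plane, HasFDerivWithinAt F A S p ∧ ∀ w, q' (F p) (A w) = q p w := by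
  have hpγ := (hS p (mem_ball_self hr)).1 hp
  set β := (1 + (Γ : ℝ))⁻¹ with hβ_def
  have hβ : 0 < β := by positivity
  have hβ1 : β ≤ 1 := inv_le_one_of_one_le₀ (by linarith [Γ.coe_nonneg])
  set Ω := {u : Plane | γ (u 0) < u 1} ∩ ball p r with hΩ
  have hΩS : Ω ⊆ S ∩ ball p r := fun u hu => ⟨(hS u hu.2).2 (le_of_lt hu.1), hu.2⟩
  have hΩopen : IsOpen Ω := by
    refine IsOpen.inter (isOpen_lt ?_ ?_) isOpen_ball
    · exact hγ.continuous.comp (by fun_prop)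
    · fun_prop
  have hderΩ : ∀ᵐ u : Plane, u ∈ Ω → ∃ A : Plane →L[ℝ] Plane, HasFDerivAt F A u ∧
      ∀ w, q' (F u) (A w) = q u w := by
    filter_upwards [hder] with u hu hmem
    obtain ⟨A, h1, h2⟩ := hu (hΩS hmem)
    exact ⟨A, h1.hasFDerivAt (mem_of_superset (hΩopen.mem_nhds hmem)
      (hΩS.trans inter_subset_left)), h2⟩
  obtain ⟨C₀, θ, R₀, hC₀, hθ0, hθ1, hR₀, happ⟩ := exists_affine_approx hq hq' (Ω := Ω)
    inter_subset_right (hmaps.mono_left hΩS) (hF.mono hΩS) hderΩ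
    (by filter_upwards [hinj] with z hz using hz.anti (inter_subset_inter_left _ hΩS))
  obtain ⟨C₁, hC₁, hdiff⟩ := exists_hasFDerivAt_of_affine_approx hC₀ hθ0 happ
  obtain ⟨C₂, hC₂, hhol⟩ := exists_holder_fderiv_of_affine_approx hC₀ hθ0 hθ1 happ
  have hdiffΩ : ∀ u ∈ Ω, DifferentiableAt ℝ F u := by
    intro u hu
    obtain ⟨ρ, hρ, hρΩ⟩ := Metric.isOpen_iff.1 hΩopen u hu
    exact (hdiff u (min ρ R₀) (lt_min hρ hR₀) (min_le_right _ _)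
      ((ball_subset_ball (min_le_left _ _)).trans hρΩ)).1.differentiableAt
  have hcontΩ : ∀ u ∈ Ω, Tendsto (fderiv ℝ F) (𝓝 u) (𝓝 (fderiv ℝ F u)) := by
    intro u hu
    obtain ⟨ρ, hρ, hρΩ⟩ := Metric.isOpen_iff.1 hΩopen u hu
    rw [tendsto_iff_norm_sub_tendsto_zero]
    have h0 : Continuous fun x : Plane => C₂ * fourthRoot ‖x - u‖ :=
      continuous_const.mul (continuous_fourthRoot.comp (continuous_id.sub continuous_const).norm)
    have h1 := h0.tendsto u
    rw [sub_self, norm_zero, fourthRoot_zero, mul_zero] at h1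
    refine squeeze_zero' (Eventually.of_forall fun _ => norm_nonneg _) ?_ h1
    have hpos : 0 < θ * min ρ R₀ / 8 := by have := lt_min hρ hR₀; positivity
    filter_upwards [ball_mem_nhds u hpos] with x hx
    rw [mem_ball, dist_eq_norm] at hx
    rw [norm_sub_rev]
    exact hhol u x (min ρ R₀) (lt_min hρ hR₀) (min_le_right _ _)
      ((ball_subset_ball (min_le_left _ _)).trans hρΩ) hx.le
  set t₀ := min (r / 4) R₀ with ht₀
  have ht₀0 : 0 < t₀ := lt_min (by positivity) hR₀
  have hballΩ : ∀ x ∈ S, ‖x - p‖ < r / 4 → ∀ t, 0 < t → t ≤ t₀ → ball (x + t • vert) (β * t) ⊆ Ω := by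
    intro x hxS hx t ht htt
    have hxr : x ∈ ball p r := by rw [mem_ball, dist_eq_norm]; linarith
    refine subset_inter (ball_add_vert_subset hγ ((hS x hxr).1 hxS)) (ball_subset_ball' ?_)
    have h1 : dist (x + t • vert) p ≤ ‖x - p‖ + t := by
      rw [dist_eq_norm]
      calc ‖x + t • vert - p‖ = ‖(x - p) + t • vert‖ := by congr 1; abel
        _ ≤ ‖x - p‖ + t := (norm_add_le _ _).trans (by
            rw [norm_smul, norm_vert, mul_one, Real.norm_of_nonneg ht.le])
    have h2 : t ≤ r / 4 := htt.trans (min_le_left _ _)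
    nlinarith
  -- The ball of radius `β t` around the point at height `t` lies in `Ω`, and the Hölder estimate in
  -- it reaches a distance `θ β t / 8`, that is, down to height `κ t`. Iteration is a geometric
  -- chain to the boundary.
  set κ := 1 - θ * β / 8 with hκ
  have hθβ : 0 < θ * β := by positivity
  have hθβ1 : θ * β ≤ 1 := mul_le_one₀ hθ1 hβ.le hβ1
  have hchain : ∀ x ∈ S, ‖x - p‖ < r / 4 → ∀ t, 0 < t → t ≤ t₀ → ∀ t', κ * t ≤ t' → t' ≤ t →
      ‖fderiv ℝ F (x + t • vert) - fderiv ℝ F (x + t' • vert)‖ ≤ C₂ * fourthRoot t := by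
    intro x hxS hx t ht htt t' h1 h2
    have h3 : x + t' • vert - (x + t • vert) = (t' - t) • vert := by module
    have h4 : ‖x + t' • vert - (x + t • vert)‖ = t - t' := by
      rw [h3, norm_smul, norm_vert, mul_one, Real.norm_of_nonpos (by linarith)]; ring
    refine (hhol (x + t • vert) (x + t' • vert) (β * t) (by positivity) ?_
      (hballΩ x hxS hx t ht htt) ?_).trans ?_
    · have := htt.trans (min_le_right _ _)
      nlinarith
    · rw [h4]
      rw [hκ] at h1
      linarith
    · rw [h4]
      have h5 : t - t' ≤ t := by
        have : 0 ≤ κ * t := mul_nonneg (by rw [hκ]; linarith) ht.le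
        linarith
      exact mul_le_mul_of_nonneg_left (fourthRoot_mono h5) hC₂
  set C₃ := C₂ / (1 - fourthRoot κ) with hC₃
  have hκ0 : 0 < κ := by rw [hκ]; linarith
  have hκ1 : κ < 1 := by rw [hκ]; linarith
  have hC₃0 : 0 ≤ C₃ := div_nonneg hC₂ (by linarith [fourthRoot_lt_one hκ1])
  obtain ⟨A, hA, -⟩ := exists_limit_of_chain hC₂ ht₀0 hκ0 hκ1
    (hchain p hp (by rw [sub_self, norm_zero]; positivity))
  have hint : ∀ x ∈ Ω, ‖x - p‖ < r / 4 → ∀ t, 0 < t → t ≤ t₀ →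
      ‖fderiv ℝ F (x + t • vert) - fderiv ℝ F x‖ ≤ C₃ * fourthRoot t := by
    intro x hx hxr t ht htt
    obtain ⟨B, hB, hB'⟩ := exists_limit_of_chain hC₂ ht₀0 hκ0 hκ1 (hchain x (hΩS hx).1 hxr)
    have h1 : Tendsto (fun t : ℝ => x + t • vert) (𝓝[>] 0) (𝓝 x) := by
      have h0 : Continuous fun t : ℝ => x + t • vert := by fun_prop
      have h2 : Tendsto (fun t : ℝ => x + t • vert) (𝓝 0) (𝓝 (x + (0 : ℝ) • vert)) := h0.tendsto 0
      rw [zero_smul, add_zero] at h2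
      exact h2.mono_left nhdsWithin_le_nhds
    have h3 : B = fderiv ℝ F x := tendsto_nhds_unique hB' ((hcontΩ x hx).comp h1)
    rw [← h3]
    exact hB t ht htt
  -- At height `M ‖x - p‖` the sideways displacement `‖x - p‖` is exactly the range of the Hölder
  -- estimate. The derivative at `x` is compared with `A` by going up, across and down the chain
  -- towards `p`.
  set M := 8 / (θ * β) with hM
  have hM0 : 0 < M := by positivity
  have hlim : ∀ x ∈ Ω, ‖x - p‖ < r / 4 → M * ‖x - p‖ ≤ t₀ →
      ‖fderiv ℝ F x - A‖ ≤ 2 * (C₃ * fourthRoot (M * ‖x - p‖)) + C₂ * fourthRoot ‖x - p‖ := by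
    intro x hx hxr hxM
    rcases eq_or_ne x p with rfl | hne
    · have : fderiv ℝ F x - A = 0 := by
        obtain ⟨B, hB, hB'⟩ := exists_limit_of_chain hC₂ ht₀0 hκ0 hκ1 (hchain x (hΩS hx).1 hxr)
        refine norm_le_zero_iff.1 (le_of_forall_pos_le_add fun ε hε => ?_)
        have h0 : Continuous fun t : ℝ => C₃ * fourthRoot t := continuous_const.mul continuous_fourthRoot
        have h1 : Tendsto (fun t : ℝ => C₃ * fourthRoot t) (𝓝 0) (𝓝 (C₃ * fourthRoot 0)) := h0.tendsto 0
        rw [fourthRoot_zero, mul_zero] at h1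
        have h2 := (h1.mono_left (nhdsWithin_le_nhds (s := Ioi 0))).eventually (gt_mem_nhds (half_pos hε))
        obtain ⟨t, ht, ht'⟩ := (h2.and (Ioc_mem_nhdsGT ht₀0)).exists
        have h3 := hint x hx hxr t ht'.1 ht'.2
        have h4 := hA t ht'.1 ht'.2
        rw [norm_sub_rev] at h3
        have := norm_sub_le_norm_sub_add_norm_sub (fderiv ℝ F x) (fderiv ℝ F (x + t • vert)) A
        linarith
      rw [this, norm_zero]
      have := fourthRoot_nonneg (M * ‖x - x‖)
      have := fourthRoot_nonneg ‖x - x‖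
      positivity
    set s := ‖x - p‖ with hs
    have hs0 : 0 < s := norm_pos_iff.2 (sub_ne_zero.2 hne)
    have hT0 : 0 < M * s := by positivity
    have h1 := hint x hx hxr _ hT0 hxM
    have h2 := hA _ hT0 hxM
    have h3 := hhol (p + (M * s) • vert) (x + (M * s) • vert) (β * (M * s)) (by positivity) (by
      have := hxM.trans (min_le_right _ _)
      nlinarith) (hballΩ p hp (by rw [sub_self, norm_zero]; positivity) _ hT0 hxM) (by
      rw [show x + (M * s) • vert - (p + (M * s) • vert) = x - p by abel, ← hs, hM]
      apply le_of_eq; field_simp)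
    rw [show x + (M * s) • vert - (p + (M * s) • vert) = x - p by abel, ← hs] at h3
    have h4 : fderiv ℝ F x - A = -(fderiv ℝ F (x + (M * s) • vert) - fderiv ℝ F x) +
        (-(fderiv ℝ F (p + (M * s) • vert) - fderiv ℝ F (x + (M * s) • vert)) +
          (fderiv ℝ F (p + (M * s) • vert) - A)) := by abel
    rw [h4]
    refine (norm_add_le _ _).trans ((add_le_add le_rfl (norm_add_le _ _)).trans ?_)
    rw [norm_neg, norm_neg]
    linarith
  have hA' : ∀ ε > 0, ∃ d > 0, ∀ u ∈ ball p d, u ∈ ball p r → γ (u 0) < u 1 →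
      ‖fderiv ℝ F u - A‖ ≤ ε := by
    intro ε hε
    have h0 : Continuous fun x : Plane => 2 * (C₃ * fourthRoot (M * ‖x - p‖)) +
        C₂ * fourthRoot ‖x - p‖ := by
      have := continuous_fourthRoot
      fun_prop
    have h1 := h0.tendsto p
    rw [sub_self, norm_zero, mul_zero, fourthRoot_zero, mul_zero, mul_zero, mul_zero, add_zero] at h1
    obtain ⟨d, hd, hd'⟩ := Metric.eventually_nhds_iff_ball.1 (h1.eventually (gt_mem_nhds hε))
    refine ⟨min d (min (r / 4) (t₀ / M)), lt_min hd (lt_min (by positivity) (by positivity)), ?_⟩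
    intro u hu hur huγ
    have hu1 := ball_subset_ball (min_le_left _ _) hu
    have hu2 := mem_ball.1 (ball_subset_ball ((min_le_right _ _).trans (min_le_left _ _)) hu)
    have hu3 := mem_ball.1 (ball_subset_ball ((min_le_right _ _).trans (min_le_right _ _)) hu)
    rw [dist_eq_norm] at hu2 hu3
    rw [lt_div_iff₀ hM0, mul_comm] at hu3
    exact (hlim u ⟨huγ, hur⟩ hu2 hu3.le).trans (hd' u hu1).le
  refine ⟨A, hasFDerivWithinAt_of_tendsto_fderiv hr hγ hp hS hF.continuousOn
    (fun u hu huγ => hdiffΩ u ⟨huγ, hu⟩) hA', fun w => ?_⟩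
  -- pass to the limit along points of differentiability
  set Gd := {u : Plane | u ∈ Ω ∧ ∀ w, q' (F u) (fderiv ℝ F u w) = q u w} with hGd
  -- The balls of the interior cone have positive area, so each of them contains a point at which
  -- the isometry relation holds.
  have hpcl : p ∈ closure Gd := by
    rw [Metric.mem_closure_iff]
    intro ε hε
    set t := min t₀ (ε / 2) with ht
    have ht0 : 0 < t := lt_min ht₀0 (half_pos hε)
    have hb := hballΩ p hp (by rw [sub_self, norm_zero]; positivity) t ht0 (min_le_left _ _)
    have hpos : 0 < volume (ball (p + t • vert) (β * t)) := measure_ball_pos _ _ (by positivity)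
    obtain ⟨u, hu, hu'⟩ : ∃ u ∈ ball (p + t • vert) (β * t), u ∈ Ω → ∃ A : Plane →L[ℝ] Plane,
        HasFDerivAt F A u ∧ ∀ w, q' (F u) (A w) = q u w := by
      by_contra! h
      refine hpos.ne' (measure_mono_null (fun u hu => ?_) hderΩ)
      intro h'
      obtain ⟨h1, h2⟩ := h u hu
      obtain ⟨A, hA1, hA2⟩ := h' h1
      obtain ⟨w, hw⟩ := h2 A hA1
      exact hw (hA2 w)
    obtain ⟨B, hB, hBq⟩ := hu' (hb hu)
    refine ⟨u, ⟨hb hu, by rw [hB.fderiv]; exact hBq⟩, ?_⟩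
    rw [mem_ball] at hu
    have h1 : dist (p + t • vert) p = t := by
      rw [dist_eq_norm, add_sub_cancel_left, norm_smul, norm_vert, mul_one,
        Real.norm_of_nonneg ht0.le]
    have h2 := dist_triangle_right p u (p + t • vert)
    have h3 : t ≤ ε / 2 := min_le_right _ _
    rw [dist_comm p (p + t • vert), h1] at h2
    nlinarith
  have hne : (𝓝[Gd] p).NeBot := mem_closure_iff_nhdsWithin_neBot.1 hpcl
  have hGdΩ : ∀ᶠ u in 𝓝[Gd] p, u ∈ Ω :=
    eventually_nhdsWithin_of_forall fun u hu => hu.1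
  have htp : Tendsto (fun u : Plane => u) (𝓝[Gd] p) (𝓝 p) := nhdsWithin_le_nhds
  have hD : Tendsto (fun u => fderiv ℝ F u w) (𝓝[Gd] p) (𝓝 (A w)) := by
    have h1 : Tendsto (fderiv ℝ F) (𝓝[Gd] p) (𝓝 A) := by
      rw [Metric.tendsto_nhds]
      intro ε hε
      obtain ⟨d, hd, hd'⟩ := hA' (ε / 2) (half_pos hε)
      filter_upwards [hGdΩ, nhdsWithin_le_nhds (ball_mem_nhds p hd)] with u hu hud
      rw [dist_eq_norm]
      exact (hd' u hud hu.2 hu.1).trans_lt (half_lt_self hε)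
    exact ((ContinuousLinearMap.apply ℝ Plane w).continuous.tendsto A).comp h1
  have hFp : Tendsto F (𝓝[Gd] p) (𝓝 (F p)) :=
    (hF.continuousOn p ⟨hp, mem_ball_self hr⟩).mono_left
      (nhdsWithin_mono _ fun u hu => hΩS hu.1)
  have hl := hq'.tendsto (hmaps ⟨hp, mem_ball_self hr⟩) hFp
    (by filter_upwards [hGdΩ] with u hu using hmaps (hΩS hu)) hD
  have hr' := hq.tendsto (mem_ball_self hr) htp (by filter_upwards [hGdΩ] with u hu using hu.2)
    (tendsto_const_nhds (x := w))
  refine tendsto_nhds_unique hl (hr'.congr' ?_)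
  exact eventually_nhdsWithin_of_forall fun u hu => (hu.2 w).symm

end BoundaryRigidity


/-! ### Coordinate frames and the metric in charts -/

section CoordinateFrames

variable {X : Type*} [EMetricSpace X] [ChartedSpace Plane X]
  {e : OpenPartialHomeomorph X Plane} {u u₀ : Plane}

/-- The differential of the inverse of a chart, which sends the standard basis of the plane to the
coordinate vector fields. -/
def coordFrame (e : OpenPartialHomeomorph X Plane) (u : Plane) :
    Plane →L[ℝ] TangentSpace 𝓘₂ (e.symm u) :=
  mfderiv 𝓘₂ 𝓘₂ e.symm u

theorem one_le_smooth : (1 : WithTop ℕ∞) ≤ ((⊤ : ℕ∞) : WithTop ℕ∞) := by exact_mod_cast le_top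

theorem one_add_one_le_smooth : (1 : WithTop ℕ∞) + 1 ≤ ((⊤ : ℕ∞) : WithTop ℕ∞) := by
  rw [show (1 : WithTop ℕ∞) + 1 = ((2 : ℕ∞) : WithTop ℕ∞) by norm_num]
  exact_mod_cast le_top

theorem mdifferentiable_of_mem_maximalAtlas (he : e ∈ IsManifold.maximalAtlas 𝓘₂ ∞ X) :
    e.MDifferentiable 𝓘₂ 𝓘₂ :=
  ⟨(contMDiffOn_of_mem_maximalAtlas he).mdifferentiableOn (by simp),
    (contMDiffOn_symm_of_mem_maximalAtlas he).mdifferentiableOn (by simp)⟩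

theorem chartAt_mem_smoothAtlas [IsManifold 𝓘₂ ∞ X] (x : X) : chartAt Plane x ∈ IsManifold.maximalAtlas 𝓘₂ ∞ X :=
  IsManifold.chart_mem_maximalAtlas x

theorem hasMFDerivAt_symm (he : e ∈ IsManifold.maximalAtlas 𝓘₂ ∞ X) (hu : u ∈ e.target) :
    HasMFDerivAt 𝓘₂ 𝓘₂ e.symm u (coordFrame e u) :=
  ((mdifferentiable_of_mem_maximalAtlas he).mdifferentiableAt_symm hu).hasMFDerivAt

/-- The coordinate frame of a chart, as a linear equivalence. -/
theorem exists_coordFrame_equiv (he : e ∈ IsManifold.maximalAtlas 𝓘₂ ∞ X) (hu : u ∈ e.target) :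
    ∃ L : Plane ≃L[ℝ] TangentSpace 𝓘₂ (e.symm u), ∀ v, L v = coordFrame e u v :=
  ⟨(mdifferentiable_of_mem_maximalAtlas he).symm.mfderiv hu, fun _ => rfl⟩

variable [IsManifold 𝓘₂ ∞ X]

theorem contMDiffAt_coordFrame (he : e ∈ IsManifold.maximalAtlas 𝓘₂ ∞ X) (hu : u₀ ∈ e.target)
    (v : Plane) :
    ContMDiffAt 𝓘₂ (ModelWithCorners.prod 𝓘₂ 𝓘₂) 1
      (fun u => (⟨e.symm u, coordFrame e u v⟩ : TangentBundle 𝓘₂ X)) u₀ := by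
  have : IsManifold 𝓘₂ 1 X := IsManifold.of_le (n := ∞) one_le_smooth
  have h1 : ContMDiffAt 𝓘₂ 𝓘₂ ∞ e.symm u₀ :=
    (contMDiffOn_symm_of_mem_maximalAtlas he).contMDiffAt (e.open_target.mem_nhds hu)
  have h2 := h1.mfderiv_const (m := 1) one_add_one_le_smooth
  have h3 : ContMDiffAt 𝓘₂ (ModelWithCorners.prod 𝓘₂ 𝓘₂) 1
      (fun u => (⟨u, v⟩ : TangentBundle 𝓘₂ Plane)) u₀ :=
    contMDiffAt_vectorSpace_iff_contDiffAt.2 contDiffAt_const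
  exact ContMDiffAt.clm_apply_of_inCoordinates (b₁ := fun u : Plane => u) (b₂ := e.symm)
    (E₁ := TangentSpace 𝓘₂ (M := Plane))
    (E₂ := TangentSpace 𝓘₂ (M := X)) (v := fun _ => v) (ϕ := fun u => coordFrame e u) h2 h3 (h1.of_le one_le_smooth)

variable [RiemannianBundle (fun x : X => TangentSpace 𝓘₂ x)]
    [IsContMDiffRiemannianBundle 𝓘₂ ∞ Plane (fun x : X => TangentSpace 𝓘₂ x)]

theorem contDiffAt_inner_coordFrame (he : e ∈ IsManifold.maximalAtlas 𝓘₂ ∞ X)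
    (hu : u₀ ∈ e.target) (v w : Plane) :
    ContDiffAt ℝ 1 (fun u => inner ℝ (coordFrame e u v) (coordFrame e u w)) u₀ := by
  have : IsContMDiffRiemannianBundle 𝓘₂ 1 Plane (fun x : X => TangentSpace 𝓘₂ x) :=
    IsContMDiffRiemannianBundle.of_le (n := ∞) one_le_smooth
  rw [← contMDiffAt_iff_contDiffAt]
  exact (contMDiffAt_coordFrame he hu v).inner_bundle (contMDiffAt_coordFrame he hu w)

omit [IsManifold 𝓘₂ ∞ X] [IsContMDiffRiemannianBundle 𝓘₂ ∞ Plane fun x : X => TangentSpace 𝓘₂ x] in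
/-- The squared norms in the coordinates of a chart. -/
theorem norm_sq_coordFrame (e : OpenPartialHomeomorph X Plane) (u v : Plane) :
    ‖coordFrame e u v‖ ^ 2 = v 0 ^ 2 * inner ℝ (coordFrame e u (EuclideanSpace.single 0 1))
        (coordFrame e u (EuclideanSpace.single 0 1))
      + 2 * (v 0 * v 1) * inner ℝ (coordFrame e u (EuclideanSpace.single 0 1))
        (coordFrame e u (EuclideanSpace.single 1 1))
      + v 1 ^ 2 * inner ℝ (coordFrame e u (EuclideanSpace.single 1 1))
        (coordFrame e u (EuclideanSpace.single 1 1)) := by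
  have hv : v = v 0 • EuclideanSpace.single 0 (1 : ℝ) + v 1 • EuclideanSpace.single 1 (1 : ℝ) := by
    ext i; fin_cases i <;> simp
  conv_lhs => rw [hv]
  rw [← real_inner_self_eq_norm_sq, map_add, map_smul, map_smul, inner_add_left, inner_add_right,
    inner_add_right]
  simp only [real_inner_smul_left, real_inner_smul_right]
  linear_combination v 0 * v 1 * real_inner_comm (coordFrame e u (EuclideanSpace.single 0 1))
    (coordFrame e u (EuclideanSpace.single 1 1))

omit [EMetricSpace X] [ChartedSpace Plane X] [IsManifold 𝓘₂ ∞ X] in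
theorem finrank_tangentPlane {X : Type*} [TopologicalSpace X] [ChartedSpace Plane X] (p : X) :
    Module.finrank ℝ (TangentSpace 𝓘₂ p) = 2 :=
  finrank_plane

omit [IsManifold 𝓘₂ ∞ X] [IsContMDiffRiemannianBundle 𝓘₂ ∞ Plane fun x : X => TangentSpace 𝓘₂ x] in
-- The coordinate frame followed by coordinates in an orthonormal basis of the tangent plane makes
-- the metric at one point Euclidean.
theorem exists_frame (he : e ∈ IsManifold.maximalAtlas 𝓘₂ ∞ X) (hu : u ∈ e.target) :
    ∃ P : Plane ≃L[ℝ] Plane, ∀ v, ‖coordFrame e u v‖ ^ 2 = ‖P v‖ ^ 2 := by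
  obtain ⟨L, hL⟩ := exists_coordFrame_equiv he hu
  let b := (stdOrthonormalBasis ℝ (TangentSpace 𝓘₂ (e.symm u))).reindex
    (finCongr (finrank_tangentPlane (e.symm u)))
  let P : Plane ≃ₗ[ℝ] Plane := L.toLinearEquiv.trans b.repr.toLinearEquiv
  refine ⟨P.toContinuousLinearEquiv, fun v => ?_⟩
  have : P.toContinuousLinearEquiv v = b.repr (L v) := rfl
  rw [this, LinearIsometryEquiv.norm_map, hL]

end CoordinateFrames

/-- An additive Lipschitz bound becomes a bound on ratios once the form is uniformly positive. The
radius is chosen with `L R ≤ c₀ ^ 2 / 2`, so that the form keeps at least half of the lower bound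
`c₀ ^ 2` at the centre. -/
theorem exists_planeMetric_ball {q : Plane → Plane → ℝ} {U : Set Plane} {u₀ : Plane} {L : ℝ}
    (hU : U ∈ 𝓝 u₀) (hL : 0 ≤ L)
    (hframe : ∀ u ∈ U, ∃ P : Plane ≃L[ℝ] Plane, ∀ v, q u v = ‖P v‖ ^ 2)
    (hlip : ∀ u ∈ U, ∀ u' ∈ U, ∀ v, |q u v - q u' v| ≤ L * ‖u - u'‖ * ‖v‖ ^ 2) :
    ∃ R > 0, Metric.ball u₀ R ⊆ U ∧ ∃ c C ℓ, PlaneMetric q (Metric.ball u₀ R) c C ℓ := by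
  obtain ⟨R₀, hR₀, hRU⟩ := Metric.mem_nhds_iff.1 hU
  have hu₀ : u₀ ∈ U := mem_of_mem_nhds hU
  obtain ⟨P, hP⟩ := hframe u₀ hu₀
  obtain ⟨c₀, hc₀, hlow⟩ : ∃ c₀ > 0, ∀ v, c₀ * ‖v‖ ≤ ‖P v‖ := by
    refine ⟨(‖(P.symm : Plane →L[ℝ] Plane)‖ + 1)⁻¹, by positivity, fun v => ?_⟩
    have h1 := (P.symm : Plane →L[ℝ] Plane).le_opNorm (P v)
    rw [ContinuousLinearEquiv.coe_coe, P.symm_apply_apply] at h1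
    rw [inv_mul_le_iff₀ (by positivity)]
    nlinarith [norm_nonneg (P v)]
  set C₀ := ‖(P : Plane →L[ℝ] Plane)‖ with hC₀
  have hup : ∀ v, ‖P v‖ ≤ C₀ * ‖v‖ := fun v => (P : Plane →L[ℝ] Plane).le_opNorm v
  have hC₀0 : 0 ≤ C₀ := norm_nonneg _
  set R := min R₀ (c₀ ^ 2 / (2 * (L + 1))) with hR
  have hR0 : 0 < R := lt_min hR₀ (by positivity)
  have hLR : L * R ≤ c₀ ^ 2 / 2 := by
    have h1 : R ≤ c₀ ^ 2 / (2 * (L + 1)) := min_le_right _ _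
    rw [le_div_iff₀ (by positivity)] at h1
    nlinarith
  have hsub : Metric.ball u₀ R ⊆ U := (Metric.ball_subset_ball (min_le_left _ _)).trans hRU
  have hnear : ∀ u ∈ Metric.ball u₀ R, ∀ v, |q u v - ‖P v‖ ^ 2| ≤ c₀ ^ 2 / 2 * ‖v‖ ^ 2 := by
    intro u hu v
    rw [← hP]
    refine (hlip u (hsub hu) u₀ hu₀ v).trans ?_
    rw [Metric.mem_ball, dist_eq_norm] at hu
    gcongr
    exact (mul_le_mul_of_nonneg_left hu.le hL).trans hLR
  have hlower : ∀ u ∈ Metric.ball u₀ R, ∀ v, (c₀ / 2) ^ 2 * ‖v‖ ^ 2 ≤ q u v := by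
    intro u hu v
    have h1 := (abs_le.1 (hnear u hu v)).1
    have h2 : (c₀ * ‖v‖) ^ 2 ≤ ‖P v‖ ^ 2 := by gcongr; exact hlow v
    nlinarith [sq_nonneg (c₀ * ‖v‖)]
  refine ⟨R, hR0, hsub, c₀ / 2, C₀ + c₀, L / (c₀ / 2) ^ 2, ⟨by positivity, by positivity,
    by positivity, fun u hu => hframe u (hsub hu), fun u hu v => hlower u hu v, ?_, ?_⟩⟩
  · intro u hu v
    have h1 := (abs_le.1 (hnear u hu v)).2
    have h2 : ‖P v‖ ^ 2 ≤ (C₀ * ‖v‖) ^ 2 := by gcongr; exact hup v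
    have h3 : 0 ≤ C₀ * c₀ * ‖v‖ ^ 2 := by positivity
    nlinarith [sq_nonneg (c₀ * ‖v‖)]
  · intro u hu u' hu' v
    have h1 := (abs_le.1 (hlip u (hsub hu) u' (hsub hu') v)).2
    have h2 : L / (c₀ / 2) ^ 2 * ‖u - u'‖ * ((c₀ / 2) ^ 2 * ‖v‖ ^ 2)
        ≤ L / (c₀ / 2) ^ 2 * ‖u - u'‖ * q u' v :=
      mul_le_mul_of_nonneg_left (hlower u' hu' v) (by positivity)
    have h3 : L / (c₀ / 2) ^ 2 * ‖u - u'‖ * ((c₀ / 2) ^ 2 * ‖v‖ ^ 2) = L * ‖u - u'‖ * ‖v‖ ^ 2 := by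
      field_simp
    linarith

section CoordinateMetric

variable {X : Type*} [EMetricSpace X] [ChartedSpace Plane X] [IsManifold 𝓘₂ ∞ X]
  [RiemannianBundle (fun x : X => TangentSpace 𝓘₂ x)]
  [IsContMDiffRiemannianBundle 𝓘₂ ∞ Plane (fun x : X => TangentSpace 𝓘₂ x)]
  {e : OpenPartialHomeomorph X Plane} {u u₀ : Plane}

theorem exists_planeMetric (he : e ∈ IsManifold.maximalAtlas 𝓘₂ ∞ X) (hu : u₀ ∈ e.target) :
    ∃ R > 0, Metric.ball u₀ R ⊆ e.target ∧ ∃ c C ℓ,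
      PlaneMetric (fun u v => ‖coordFrame e u v‖ ^ 2) (Metric.ball u₀ R) c C ℓ := by
  obtain ⟨K₀, t₀, ht₀, h₀⟩ := (contDiffAt_inner_coordFrame he hu (EuclideanSpace.single 0 1)
    (EuclideanSpace.single 0 1)).exists_lipschitzOnWith
  obtain ⟨K₁, t₁, ht₁, h₁⟩ := (contDiffAt_inner_coordFrame he hu (EuclideanSpace.single 0 1)
    (EuclideanSpace.single 1 1)).exists_lipschitzOnWith
  obtain ⟨K₂, t₂, ht₂, h₂⟩ := (contDiffAt_inner_coordFrame he hu (EuclideanSpace.single 1 1)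
    (EuclideanSpace.single 1 1)).exists_lipschitzOnWith
  have hU : (t₀ ∩ t₁ ∩ t₂) ∩ e.target ∈ 𝓝 u₀ :=
    inter_mem (inter_mem (inter_mem ht₀ ht₁) ht₂) (e.open_target.mem_nhds hu)
  obtain ⟨R, hR, hRU, h⟩ := exists_planeMetric_ball (q := fun u v => ‖coordFrame e u v‖ ^ 2)
    (L := K₀ + 2 * K₁ + K₂) hU (by positivity)
    (fun u hu => exists_frame he hu.2) (by
      rintro u ⟨⟨⟨hu0, hu1⟩, hu2⟩, -⟩ u' ⟨⟨⟨hu0', hu1'⟩, hu2'⟩, -⟩ v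
      have a0 := h₀.dist_le_mul u hu0 u' hu0'
      have a1 := h₁.dist_le_mul u hu1 u' hu1'
      have a2 := h₂.dist_le_mul u hu2 u' hu2'
      rw [Real.dist_eq, dist_eq_norm] at a0 a1 a2
      have hv : ‖v‖ ^ 2 = v 0 ^ 2 + v 1 ^ 2 := by
        rw [EuclideanSpace.norm_sq_eq]; simp
      have b0 : v 0 ^ 2 ≤ ‖v‖ ^ 2 := by nlinarith [sq_nonneg (v 1)]
      have b1 : |2 * (v 0 * v 1)| ≤ 2 * ‖v‖ ^ 2 := by
        rw [abs_le]; constructor <;> nlinarith [sq_nonneg (v 0 - v 1), sq_nonneg (v 0 + v 1)]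
      have b2 : v 1 ^ 2 ≤ ‖v‖ ^ 2 := by nlinarith [sq_nonneg (v 0)]
      simp only [norm_sq_coordFrame]
      have c0 : |v 0 ^ 2| ≤ ‖v‖ ^ 2 := by rwa [abs_of_nonneg (sq_nonneg _)]
      have c2 : |v 1 ^ 2| ≤ ‖v‖ ^ 2 := by rwa [abs_of_nonneg (sq_nonneg _)]
      rw [abs_sub_le_iff, sub_le_iff_le_add, sub_le_iff_le_add]
      have d0 := mul_le_mul c0 a0 (abs_nonneg _) (by positivity)
      have d1 := mul_le_mul b1 a1 (abs_nonneg _) (by positivity)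
      have d2 := mul_le_mul c2 a2 (abs_nonneg _) (by positivity)
      rw [← abs_mul] at d0 d1 d2
      have d0 := abs_le.1 d0
      have d1 := abs_le.1 d1
      have d2 := abs_le.1 d2
      constructor <;> linarith [d0.1, d0.2, d1.1, d1.2, d2.1, d2.2])
  exact ⟨R, hR, hRU.trans inter_subset_right, h⟩

end CoordinateMetric


/-! ### The area measure of a chart -/

section ChartMeasure

variable {X : Type*} [EMetricSpace X] [ChartedSpace Plane X]
  [RiemannianBundle (fun x : X => TangentSpace 𝓘₂ x)]
  {e : OpenPartialHomeomorph X Plane} {u u₀ : Plane}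

/-- The area density in the coordinates of a chart. -/
def density (e : OpenPartialHomeomorph X Plane) (u : Plane) : ℝ :=
  (coordFrame e u).toLinearMap.normDet

theorem density_nonneg (e : OpenPartialHomeomorph X Plane) (u : Plane) : 0 ≤ density e u :=
  LinearMap.normDet_nonneg _

theorem density_eq_sqrt (e : OpenPartialHomeomorph X Plane) (u : Plane) :
    density e u = √(Matrix.of fun i j : Fin 2 => inner ℝ
      (coordFrame e u (EuclideanSpace.single i (1 : ℝ)))
      (coordFrame e u (EuclideanSpace.single j (1 : ℝ)))).det :=
  normDet_of_plane _

theorem density_pos (he : e ∈ IsManifold.maximalAtlas 𝓘₂ ∞ X) (hu : u ∈ e.target) :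
    0 < density e u := by
  obtain ⟨L, hL⟩ := exists_coordFrame_equiv he hu
  refine (density_nonneg e u).lt_of_ne' fun h => ?_
  rw [density, LinearMap.normDet_eq_zero_iff_ker_ne_bot] at h
  apply h
  rw [LinearMap.ker_eq_bot]
  intro v w hvw
  apply L.injective
  rw [hL, hL]
  exact hvw

/-- The coordinate frame inverts the differential of the chart, so `B` factors through the plane and
its Jacobian is the density times a planar determinant. -/
theorem normDet_eq_density_mul (he : e ∈ IsManifold.maximalAtlas 𝓘₂ ∞ X) {q : X}
    (hq : q ∈ e.source) (B : Plane →L[ℝ] TangentSpace 𝓘₂ q) :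
    B.toLinearMap.normDet = density e (e q) *
      |ContinuousLinearMap.det ((mfderiv 𝓘₂ 𝓘₂ e q : Plane →L[ℝ] Plane).comp
        (B : Plane →L[ℝ] Plane))| := by
  obtain ⟨z, hz, rfl⟩ : ∃ z ∈ e.target, q = e.symm z := ⟨e q, e.map_source hq, (e.left_inv hq).symm⟩
  rw [e.right_inv hz]
  have h1 := (mdifferentiable_of_mem_maximalAtlas he).symm_comp_deriv hq
  rw [e.right_inv hz] at h1
  set D : Plane →L[ℝ] Plane := mfderiv 𝓘₂ 𝓘₂ e (e.symm z) with hD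
  have h2 : B.toLinearMap = (coordFrame e z).toLinearMap.comp
      (D.comp (B : Plane →L[ℝ] Plane)).toLinearMap := by
    ext v
    have := DFunLike.congr_fun h1 (B v)
    exact this.symm
  rw [h2, LinearMap.normDet_comp_of_finrank_eq, LinearMap.normDet_eq_abs_det]
  · rfl
  · rfl

theorem norm_eq_norm_coordFrame (he : e ∈ IsManifold.maximalAtlas 𝓘₂ ∞ X) {q : X}
    (hq : q ∈ e.source) (w : TangentSpace 𝓘₂ q) :
    ‖w‖ = ‖coordFrame e (e q) (mfderiv 𝓘₂ 𝓘₂ e q w)‖ := by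
  obtain ⟨z, hz, rfl⟩ : ∃ z ∈ e.target, q = e.symm z := ⟨e q, e.map_source hq, (e.left_inv hq).symm⟩
  have h1 := (mdifferentiable_of_mem_maximalAtlas he).symm_comp_deriv hq
  rw [e.right_inv hz] at h1 ⊢
  exact (congrArg (fun w' : TangentSpace 𝓘₂ (e.symm z) => ‖w'‖) (DFunLike.congr_fun h1 w)).symm

variable [IsManifold 𝓘₂ ∞ X]
    [IsContMDiffRiemannianBundle 𝓘₂ ∞ Plane (fun x : X => TangentSpace 𝓘₂ x)]

theorem continuousOn_density (he : e ∈ IsManifold.maximalAtlas 𝓘₂ ∞ X) :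
    ContinuousOn (density e) e.target := by
  intro u hu
  have h := fun v w => (contDiffAt_inner_coordFrame he hu v w).continuousAt
  refine ContinuousAt.continuousWithinAt ?_
  simp only [funext (density_eq_sqrt e), Matrix.det_fin_two, Matrix.of_apply]
  exact (((h _ _).mul (h _ _)).sub ((h _ _).mul (h _ _))).sqrt

variable [MeasurableSpace X]

/-- The area measure on the domain of a chart. -/
def chartMeasure (e : OpenPartialHomeomorph X Plane) : Measure X :=
  (((volume : Measure Plane).restrict e.target).withDensity
    fun u => ENNReal.ofReal (density e u)).map e.symm

theorem chartArea_eq_chartMeasure (x₀ : X) :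
    chartArea X x₀ = chartMeasure (chartAt Plane x₀) := by
  simp only [chartMeasure, density_eq_sqrt]
  rfl

theorem image_inter_source (e : OpenPartialHomeomorph X Plane) (s : Set X) :
    e '' (s ∩ e.source) = e.symm ⁻¹' s ∩ e.target := by
  rw [inter_comm, e.image_source_inter_eq', inter_comm]

variable [BorelSpace X]

theorem aemeasurable_symm (e : OpenPartialHomeomorph X Plane) :
    AEMeasurable e.symm ((volume : Measure Plane).restrict e.target) :=
  e.continuousOn_symm.aemeasurable e.open_target.measurableSet

theorem measurableSet_inter_preimage {α β : Type*} [TopologicalSpace α] [MeasurableSpace α]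
    [BorelSpace α] [TopologicalSpace β] [MeasurableSpace β] [BorelSpace β] {f : α → β} {t : Set α}
    {s : Set β} (hf : ContinuousOn f t) (ht : MeasurableSet t) (hs : MeasurableSet s) :
    MeasurableSet (t ∩ f ⁻¹' s) := by
  have h := (continuousOn_iff_continuous_domRestrict.1 hf).measurable hs
  have h2 := ht.subtype_image h
  convert h2 using 1
  ext x
  simp [and_comm]

theorem measurableSet_image_chart {s : Set X} (hs : MeasurableSet s) (hse : s ⊆ e.source) :
    MeasurableSet (e '' s) := by
  rw [← inter_eq_left.2 hse, image_inter_source, inter_comm]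
  exact measurableSet_inter_preimage e.continuousOn_symm e.open_target.measurableSet hs

theorem measurableSet_source_inter_preimage {B : Set Plane} (hB : MeasurableSet B) :
    MeasurableSet (e.source ∩ e ⁻¹' B) :=
  measurableSet_inter_preimage e.continuousOn e.open_source.measurableSet hB

theorem chartMeasure_apply {s : Set X} (hs : MeasurableSet s) :
    chartMeasure e s = ∫⁻ u in e '' (s ∩ e.source), ENNReal.ofReal (density e u) := by
  rw [chartMeasure, Measure.map_apply_of_aemeasurable
    ((aemeasurable_symm e).mono_ac (withDensity_absolutelyContinuous _ _)) hs,
    withDensity_apply', Measure.restrict_restrict' e.open_target.measurableSet, image_inter_source]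

theorem chartMeasure_of_subset {s : Set X} (hs : MeasurableSet s) (hse : s ⊆ e.source) :
    chartMeasure e s = ∫⁻ u in e '' s, ENNReal.ofReal (density e u) := by
  rw [chartMeasure_apply hs, inter_eq_left.2 hse]

/-- The density is positive, so both measures have the same null sets. As `s` is arbitrary, the
argument passes to measurable null supersets. -/
theorem volume_image_eq_zero_iff (he : e ∈ IsManifold.maximalAtlas 𝓘₂ ∞ X) {s : Set X}
    (hse : s ⊆ e.source) : volume (e '' s) = 0 ↔ chartMeasure e s = 0 := by
  constructor
  · intro h
    obtain ⟨B, hB, hBm, hB0⟩ := exists_measurable_superset_of_null h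
    have hsub : s ⊆ e.source ∩ e ⁻¹' B := fun p hp => ⟨hse hp, hB (mem_image_of_mem e hp)⟩
    refine measure_mono_null hsub ?_
    rw [chartMeasure_of_subset (measurableSet_source_inter_preimage hBm) inter_subset_left]
    refine setLIntegral_measure_zero _ _ (measure_mono_null ?_ hB0)
    rintro _ ⟨p, hp, rfl⟩
    exact hp.2
  · intro h
    obtain ⟨t, hst, htm, ht0⟩ := exists_measurable_superset_of_null h
    have htm' := htm.inter e.open_source.measurableSet
    have h1 : chartMeasure e (t ∩ e.source) = 0 := measure_mono_null inter_subset_left ht0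
    have hmi := measurableSet_image_chart htm' inter_subset_right
    rw [chartMeasure_of_subset htm' inter_subset_right, lintegral_eq_zero_iff' ?_] at h1
    · rw [EventuallyEq, ae_restrict_iff' hmi] at h1
      refine measure_mono_null (image_mono (subset_inter hst hse)) ?_
      refine measure_mono_null (fun u hu => ?_) h1
      simp only [mem_compl_iff, mem_ofPred_eq]
      intro h2
      obtain ⟨p, hp, rfl⟩ := hu
      have := h2 (mem_image_of_mem e hp)
      simp only [Pi.zero_apply, ENNReal.ofReal_eq_zero] at this
      exact (density_pos he (e.map_source hp.2)).not_ge this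
    · refine ((continuousOn_density he).mono ?_).aemeasurable hmi |>.ennreal_ofReal
      rintro _ ⟨p, hp, rfl⟩
      exact e.map_source hp.2

end ChartMeasure

/-! ### The area formula in charts -/

section AreaFormula

variable {X : Type*} [EMetricSpace X] [ChartedSpace Plane X] [IsManifold 𝓘₂ ∞ X]
  [RiemannianBundle (fun x : X => TangentSpace 𝓘₂ x)]
  [IsContMDiffRiemannianBundle 𝓘₂ ∞ Plane (fun x : X => TangentSpace 𝓘₂ x)]
  [MeasurableSpace X] [BorelSpace X]
  {Y : Type*} [EMetricSpace Y] [ChartedSpace Plane Y] [IsManifold 𝓘₂ ∞ Y]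
  [RiemannianBundle (fun y : Y => TangentSpace 𝓘₂ y)]
  [IsContMDiffRiemannianBundle 𝓘₂ ∞ Plane (fun y : Y => TangentSpace 𝓘₂ y)]
  [MeasurableSpace Y] [BorelSpace Y]
  {e : OpenPartialHomeomorph X Plane} {e' : OpenPartialHomeomorph Y Plane}

/-- The expression of a differential in charts. -/
def chartDeriv (e : OpenPartialHomeomorph X Plane) (e' : OpenPartialHomeomorph Y Plane) (φ : X → Y)
    (T : ∀ p : X, TangentSpace 𝓘₂ p →L[ℝ] TangentSpace 𝓘₂ (φ p)) (u : Plane) : Plane →L[ℝ] Plane :=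
  (mfderiv 𝓘₂ 𝓘₂ e' (φ (e.symm u)) : Plane →L[ℝ] Plane).comp
    ((T (e.symm u) : Plane →L[ℝ] Plane).comp (coordFrame e u : Plane →L[ℝ] Plane))

theorem hasFDerivWithinAt_chart (he : e ∈ IsManifold.maximalAtlas 𝓘₂ ∞ X)
    (he' : e' ∈ IsManifold.maximalAtlas 𝓘₂ ∞ Y) {φ : X → Y} {A : Set X} (hA : A ⊆ e.source)
    (hφ : MapsTo φ A e'.source)
    {T : ∀ p : X, TangentSpace 𝓘₂ p →L[ℝ] TangentSpace 𝓘₂ (φ p)} {u : Plane} (hu : u ∈ e '' A)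
    (hT : HasMFDerivWithinAt 𝓘₂ 𝓘₂ φ A (e.symm u) (T (e.symm u))) :
    HasFDerivWithinAt (e' ∘ φ ∘ e.symm) (chartDeriv e e' φ T u) (e '' A) u := by
  have hut : u ∈ e.target := by
    obtain ⟨p, hp, rfl⟩ := hu
    exact e.map_source (hA hp)
  have hmaps : MapsTo e.symm (e '' A) A := by
    rintro _ ⟨p, hp, rfl⟩
    rwa [e.left_inv (hA hp)]
  have h1 : HasMFDerivWithinAt 𝓘₂ 𝓘₂ e.symm (e '' A) u (coordFrame e u) :=
    (hasMFDerivAt_symm he hut).hasMFDerivWithinAt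
  have h2 := hT.comp u h1 hmaps
  have h3 := ((mdifferentiable_of_mem_maximalAtlas he').mdifferentiableAt
    (hφ (hmaps hu))).hasMFDerivAt
  exact (h3.comp_hasMFDerivWithinAt u h2).hasFDerivWithinAt

theorem normDet_mul_density (he' : e' ∈ IsManifold.maximalAtlas 𝓘₂ ∞ Y) {φ : X → Y}
    (T : ∀ p : X, TangentSpace 𝓘₂ p →L[ℝ] TangentSpace 𝓘₂ (φ p)) {u : Plane}
    (hu : φ (e.symm u) ∈ e'.source) :
    density e u * (T (e.symm u)).toLinearMap.normDet =
      density e' (e' (φ (e.symm u))) * |(chartDeriv e e' φ T u).det| := by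
  have h := normDet_eq_density_mul he' hu ((T (e.symm u)).comp (coordFrame e u))
  rw [chartDeriv]
  refine Eq.trans ?_ h
  rw [density, ContinuousLinearMap.toLinearMap_comp, LinearMap.normDet_comp_of_finrank_eq, mul_comm]
  rfl

/-- The area formula on a piece of a surface which is mapped to the domain of a chart. -/
theorem lintegral_normDet_chart (he : e ∈ IsManifold.maximalAtlas 𝓘₂ ∞ X)
    (he' : e' ∈ IsManifold.maximalAtlas 𝓘₂ ∞ Y) {φ : X → Y} {A : Set X} (hAm : MeasurableSet A)
    (hA : A ⊆ e.source) (hφ : MapsTo φ A e'.source)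
    (T : ∀ p : X, TangentSpace 𝓘₂ p →L[ℝ] TangentSpace 𝓘₂ (φ p))
    (hT : ∀ p ∈ A, HasMFDerivWithinAt 𝓘₂ 𝓘₂ φ A p (T p)) {Q : Set Y} (hQ : MeasurableSet Q)
    (hQ0 : chartMeasure e' Q = 0) (hinj : InjOn φ (A \ φ ⁻¹' Q)) :
    NullMeasurableSet (e' '' (φ '' A)) ∧
    AEMeasurable (fun u => ENNReal.ofReal (T (e.symm u)).toLinearMap.normDet)
      (volume.restrict (e '' A)) ∧
    ∫⁻ u in e '' A, ENNReal.ofReal (density e u) *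
        ENNReal.ofReal (T (e.symm u)).toLinearMap.normDet
      = ∫⁻ z in e' '' (φ '' A), ENNReal.ofReal (density e' z) := by
  set F : Plane → Plane := e' ∘ φ ∘ e.symm with hF
  have hsymm : ∀ u ∈ e '' A, e.symm u ∈ A := by
    rintro _ ⟨p, hp, rfl⟩
    rwa [e.left_inv (hA hp)]
  have htarget : e '' A ⊆ e.target := by
    rintro _ ⟨p, hp, rfl⟩
    exact e.map_source (hA hp)
  have hFder : ∀ u ∈ e '' A, HasFDerivWithinAt F (chartDeriv e e' φ T u) (e '' A) u :=
    fun u hu => hasFDerivWithinAt_chart he he' hA hφ hu (hT _ (hsymm u hu))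
  have hFimage : F '' (e '' A) = e' '' (φ '' A) := by
    rw [image_image, image_image]
    refine image_congr fun p hp => ?_
    simp [hF, e.left_inv (hA hp)]
  have hAe := measurableSet_image_chart hAm hA
  have hQe : MeasurableSet (e' '' (Q ∩ e'.source)) :=
    measurableSet_image_chart (hQ.inter e'.open_source.measurableSet) inter_subset_right
  have hQe0 : volume (e' '' (Q ∩ e'.source)) = 0 :=
    (volume_image_eq_zero_iff he' inter_subset_right).2 (measure_mono_null inter_subset_left hQ0)
  have hFinj : InjOn F (e '' A \ F ⁻¹' (e' '' (Q ∩ e'.source))) := by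
    have hmem : ∀ u ∈ e '' A \ F ⁻¹' (e' '' (Q ∩ e'.source)), e.symm u ∈ A \ φ ⁻¹' Q :=
      fun u hu => ⟨hsymm u hu.1, fun h => hu.2 ⟨φ (e.symm u), ⟨h, hφ (hsymm u hu.1)⟩, rfl⟩⟩
    intro u hu v hv huv
    have h1 := e'.injOn (hφ (hsymm u hu.1)) (hφ (hsymm v hv.1)) huv
    exact e.symm.injOn (htarget hu.1) (htarget hv.1) (hinj (hmem u hu) (hmem v hv) h1)
  obtain ⟨h1, h2⟩ := lintegral_image_of_injOn_diff_null hAe hQe hQe0 hFder hFinj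
    (fun z => ENNReal.ofReal (density e' z))
  rw [hFimage] at h1 h2
  have hdet : AEMeasurable (fun u => ENNReal.ofReal |(chartDeriv e e' φ T u).det|)
      (volume.restrict (e '' A)) := aemeasurable_ofReal_abs_det_fderivWithin volume hAe hFder
  have hden : AEMeasurable (fun u => ENNReal.ofReal (density e u)) (volume.restrict (e '' A)) :=
    (((continuousOn_density he).mono htarget).aemeasurable hAe).ennreal_ofReal
  have hFc : ContinuousOn F (e '' A) := fun u hu => (hFder u hu).continuousWithinAt
  have hden' : AEMeasurable (fun u => ENNReal.ofReal (density e' (F u)))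
      (volume.restrict (e '' A)) := by
    refine (((continuousOn_density he').comp hFc fun u hu => ?_).aemeasurable hAe).ennreal_ofReal
    exact e'.map_source (hφ (hsymm u hu))
  have hprod : ∀ u ∈ e '' A, ENNReal.ofReal (density e u) *
      ENNReal.ofReal (T (e.symm u)).toLinearMap.normDet
      = ENNReal.ofReal |(chartDeriv e e' φ T u).det| * ENNReal.ofReal (density e' (F u)) := by
    intro u hu
    rw [← ENNReal.ofReal_mul (density_nonneg e u), normDet_mul_density he' T (hφ (hsymm u hu)),
      ENNReal.ofReal_mul (density_nonneg e' _), mul_comm]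
    rfl
  refine ⟨h1, ?_, ?_⟩
  -- Planar measurability concerns the determinant in charts; the intrinsic Jacobian is recovered by
  -- dividing by the source density, which is positive and finite.
  · refine AEMeasurable.congr (f := fun u => (ENNReal.ofReal |(chartDeriv e e' φ T u).det| *
      ENNReal.ofReal (density e' (F u))) / ENNReal.ofReal (density e u))
      ((hdet.mul hden').div hden) ?_
    filter_upwards [self_mem_ae_restrict hAe] with u hu
    rw [← hprod u hu, mul_comm, ENNReal.mul_div_cancel_right]
    · simpa using density_pos he (htarget hu)
    · exact ENNReal.ofReal_ne_top
  · rw [← h2]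
    exact setLIntegral_congr_fun hAe hprod

end AreaFormula


/-! ### The global area measure -/

section Area

variable {X : Type*} [EMetricSpace X] [ChartedSpace Plane X] [IsManifold 𝓘₂ ∞ X]
  [RiemannianBundle (fun x : X => TangentSpace 𝓘₂ x)]
  [IsContMDiffRiemannianBundle 𝓘₂ ∞ Plane (fun x : X => TangentSpace 𝓘₂ x)]
  [MeasurableSpace X] [BorelSpace X]
  {e e' : OpenPartialHomeomorph X Plane}

theorem chartMeasure_inter_source {s : Set X} (hs : MeasurableSet s) :
    chartMeasure e (s ∩ e.source) = chartMeasure e s := by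
  rw [chartMeasure_apply hs, chartMeasure_apply (hs.inter e.open_source.measurableSet), inter_assoc,
    inter_self]

/-- Independence of the chart is the area formula for the identity map, whose Jacobian is `1`. -/
theorem chartMeasure_eq_of_subset (he : e ∈ IsManifold.maximalAtlas 𝓘₂ ∞ X)
    (he' : e' ∈ IsManifold.maximalAtlas 𝓘₂ ∞ X) {A : Set X} (hAm : MeasurableSet A)
    (hA : A ⊆ e.source) (hA' : A ⊆ e'.source) : chartMeasure e A = chartMeasure e' A := by
  have h := (lintegral_normDet_chart he he' (φ := id) hAm hA hA'
    (fun p => ContinuousLinearMap.id ℝ (TangentSpace 𝓘₂ p))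
    (fun p _ => (hasMFDerivAt_id p).hasMFDerivWithinAt) MeasurableSet.empty measure_empty
    (injOn_id _)).2.2
  rw [image_id] at h
  rw [chartMeasure_of_subset hAm hA, chartMeasure_of_subset hAm hA', ← h]
  congr 1
  ext u
  have : (ContinuousLinearMap.id ℝ (TangentSpace 𝓘₂ (e.symm u))).toLinearMap.normDet = 1 :=
    LinearMap.normDet_id
  simp only [id] at this ⊢
  rw [this, ENNReal.ofReal_one, mul_one]

theorem area_of_subset_chartAt {x₀ : X} {A : Set X} (hAm : MeasurableSet A)
    (hA : A ⊆ (chartAt Plane x₀).source) : area X A = chartMeasure (chartAt Plane x₀) A := by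
  apply le_antisymm
  · set S := (chartAt Plane x₀).source with hS
    have hSm : MeasurableSet S := (chartAt Plane x₀).open_source.measurableSet
    -- A supremum of measures is not computed set by set. It is bounded by exhibiting a measure
    -- above every `chartArea`: the given chart measure on `S` plus the area itself off `S`.
    have key : area X ≤ chartMeasure (chartAt Plane x₀) + (area X).restrict Sᶜ := by
      refine iSup_le fun x₁ => Measure.le_iff.2 fun s hs => ?_
      rw [chartArea_eq_chartMeasure, Measure.add_apply, Measure.restrict_apply hs,
        ← measure_inter_add_sdiff s hSm]
      refine add_le_add ?_ ?_
      · set S₁ := (chartAt Plane x₁).source with hS₁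
        have hS₁m : MeasurableSet S₁ := (chartAt Plane x₁).open_source.measurableSet
        rw [← chartMeasure_inter_source (hs.inter hSm),
          chartMeasure_eq_of_subset (chartAt_mem_smoothAtlas x₁) (chartAt_mem_smoothAtlas x₀)
            ((hs.inter hSm).inter hS₁m) inter_subset_right (inter_subset_left.trans inter_subset_right)]
        exact measure_mono (inter_subset_left.trans inter_subset_left)
      · rw [← chartArea_eq_chartMeasure, sdiff_eq]
        exact Measure.le_iff'.1 (le_iSup (chartArea X) x₁) _
    refine (Measure.le_iff'.1 key A).trans ?_
    rw [Measure.add_apply, Measure.restrict_apply hAm, ← sdiff_eq, sdiff_eq_empty.2 hA, measure_empty,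
      add_zero]
  · rw [← chartArea_eq_chartMeasure]
    exact Measure.le_iff'.1 (le_iSup (chartArea X) x₀) _

variable [SecondCountableTopology X]

variable (X) in
/-- A surface is partitioned into countably many Borel pieces, each of them in a chart. -/
theorem exists_chart_partition [Nonempty X] : ∃ (c : ℕ → OpenPartialHomeomorph X Plane) (B : ℕ → Set X),
    (∀ n, MeasurableSet (B n)) ∧ Pairwise (Function.onFun Disjoint B) ∧ (⋃ n, B n) = univ ∧
    (∀ n, B n ⊆ (c n).source) ∧ (∀ n, c n ∈ IsManifold.maximalAtlas 𝓘₂ ∞ X) ∧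
    ∀ n, ∀ A ⊆ (c n).source, MeasurableSet A → area X A = chartMeasure (c n) A := by
  obtain ⟨s, hs, hsU⟩ := TopologicalSpace.countable_cover_nhds
    (fun x : X => chart_source_mem_nhds Plane x)
  have hsne : s.Nonempty := by
    rw [nonempty_iff_ne_empty]
    rintro rfl
    simp only [biUnion_empty] at hsU
    exact empty_ne_univ hsU
  obtain ⟨x, hx⟩ := hs.exists_eq_range hsne
  refine ⟨fun n => chartAt Plane (x n), disjointed fun n => (chartAt Plane (x n)).source,
    fun n => MeasurableSet.disjointed (fun n => (chartAt Plane (x n)).open_source.measurableSet) n,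
    disjoint_disjointed _, ?_, fun n => disjointed_subset _ n,
    fun n => chartAt_mem_smoothAtlas _, fun n A hA hAm => area_of_subset_chartAt hAm hA⟩
  rw [iUnion_disjointed, ← hsU, hx, biUnion_range]

/-- Extends the formula from preferred charts to the whole maximal atlas, which supplies the charts
that straighten the boundary. -/
theorem area_of_subset_source (he : e ∈ IsManifold.maximalAtlas 𝓘₂ ∞ X) {A : Set X}
    (hAm : MeasurableSet A) (hA : A ⊆ e.source) : area X A = chartMeasure e A := by
  rcases isEmpty_or_nonempty X with hX | hX
  · rw [eq_empty_of_isEmpty A, measure_empty, measure_empty]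
  obtain ⟨c, B, hBm, hBd, hBU, hBc, hc, hcarea⟩ := exists_chart_partition X
  have hA' : A = ⋃ n, A ∩ B n := by rw [← inter_iUnion, hBU, inter_univ]
  have hd : Pairwise (Function.onFun Disjoint fun n => A ∩ B n) := fun i j hij =>
    (hBd hij).mono inter_subset_right inter_subset_right
  have hm : ∀ n, MeasurableSet (A ∩ B n) := fun n => hAm.inter (hBm n)
  rw [hA', measure_iUnion hd hm, measure_iUnion hd hm]
  congr 1
  ext n
  have h : A ∩ B n ⊆ (c n).source := inter_subset_right.trans (hBc n)
  rw [hcarea n _ h (hm n)]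
  exact chartMeasure_eq_of_subset (hc n) he (hm n) h (inter_subset_left.trans hA)

theorem area_restrict_source (he : e ∈ IsManifold.maximalAtlas 𝓘₂ ∞ X) :
    (area X).restrict e.source = chartMeasure e := by
  ext s hs
  rw [Measure.restrict_apply hs, area_of_subset_source he (hs.inter e.open_source.measurableSet)
    inter_subset_right, chartMeasure_inter_source hs]

theorem area_restrict (he : e ∈ IsManifold.maximalAtlas 𝓘₂ ∞ X) {A : Set X}
    (hAm : MeasurableSet A) (hA : A ⊆ e.source) :
    (area X).restrict A = ((volume.restrict (e '' A)).withDensity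
      fun u => ENNReal.ofReal (density e u)).map e.symm := by
  rw [← Measure.restrict_restrict_of_subset hA, area_restrict_source he, chartMeasure,
    Measure.restrict_map_of_aemeasurable
      ((aemeasurable_symm e).mono_ac (withDensity_absolutelyContinuous _ _)) hAm,
    restrict_withDensity', Measure.restrict_restrict' e.open_target.measurableSet,
    ← image_inter_source, inter_eq_left.2 hA]

/-- Sets in the domain of a chart are null sets if and only if their images are. -/
theorem volume_image_chart_eq_zero_iff (he : e ∈ IsManifold.maximalAtlas 𝓘₂ ∞ X) {s : Set X}
    (hse : s ⊆ e.source) : volume (e '' s) = 0 ↔ area X s = 0 := by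
  rw [volume_image_eq_zero_iff he hse, ← area_restrict_source he,
    Measure.restrict_apply' e.open_source.measurableSet, inter_eq_left.2 hse]

theorem ae_restrict_iff_chart (he : e ∈ IsManifold.maximalAtlas 𝓘₂ ∞ X) {A : Set X}
    (hAm : MeasurableSet A) (hA : A ⊆ e.source) {P : X → Prop} :
    (∀ᵐ p ∂(area X).restrict A, P p) ↔ ∀ᵐ u : Plane, u ∈ e '' A → P (e.symm u) := by
  rw [ae_restrict_iff' hAm, ae_iff, ae_iff, ← volume_image_chart_eq_zero_iff he (fun p hp => ?_)]
  · congr! 2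
    ext u
    constructor
    · rintro ⟨p, hp, rfl⟩
      simp only [mem_ofPred_eq, Classical.not_imp] at hp ⊢
      refine ⟨mem_image_of_mem e hp.1, ?_⟩
      rw [e.left_inv (hA hp.1)]
      exact hp.2
    · intro hu
      simp only [mem_ofPred_eq, Classical.not_imp] at hu
      obtain ⟨⟨p, hp, rfl⟩, hu⟩ := hu
      rw [e.left_inv (hA hp)] at hu
      exact ⟨p, by simp [hp, hu], rfl⟩
  · simp only [mem_ofPred_eq, Classical.not_imp] at hp
    exact hA hp.1

theorem aemeasurable_iff_chart (he : e ∈ IsManifold.maximalAtlas 𝓘₂ ∞ X) {A : Set X}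
    (hAm : MeasurableSet A) (hA : A ⊆ e.source) {β : Type*} [MeasurableSpace β] [Nonempty β] {h : X → β}
    (hh : AEMeasurable (fun u => h (e.symm u)) (volume.restrict (e '' A))) :
    AEMeasurable h ((area X).restrict A) := by
  have hAe := measurableSet_image_chart hAm hA
  obtain ⟨g, hg, hgh⟩ := hh
  have he1 : AEMeasurable e ((area X).restrict A) :=
    (e.continuousOn.mono hA).aemeasurable hAm
  refine (hg.comp_aemeasurable he1).congr ?_
  rw [EventuallyEq, ae_restrict_iff_chart he hAm hA]
  rw [EventuallyEq, ae_restrict_iff' hAe] at hgh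
  filter_upwards [hgh] with u hu huA
  rw [hu huA, Function.comp_apply, e.right_inv]
  obtain ⟨p, hp, rfl⟩ := huA
  exact e.map_source (hA hp)

theorem setLIntegral_chart (he : e ∈ IsManifold.maximalAtlas 𝓘₂ ∞ X) {A : Set X}
    (hAm : MeasurableSet A) (hA : A ⊆ e.source) {h : X → ℝ≥0∞}
    (hh : AEMeasurable (fun u => h (e.symm u)) (volume.restrict (e '' A))) :
    ∫⁻ p in A, h p ∂(area X) = ∫⁻ u in e '' A, ENNReal.ofReal (density e u) * h (e.symm u) := by
  have hAe := measurableSet_image_chart hAm hA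
  have hst : e '' A ⊆ e.target := by
    rintro _ ⟨p, hp, rfl⟩
    exact e.map_source (hA hp)
  have h1 := aemeasurable_iff_chart he hAm hA hh
  have h2 : AEMeasurable (fun u => ENNReal.ofReal (density e u)) (volume.restrict (e '' A)) :=
    (((continuousOn_density he).mono hst).aemeasurable hAe).ennreal_ofReal
  have h3 : AEMeasurable e.symm (volume.restrict (e '' A)) :=
    (aemeasurable_symm e).mono_measure (Measure.restrict_mono hst le_rfl)
  rw [area_restrict he hAm hA] at h1 ⊢
  rw [lintegral_map' h1 (h3.mono_ac (withDensity_absolutelyContinuous _ _)),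
    lintegral_withDensity_eq_lintegral_mul₀ h2 hh]
  rfl

theorem area_pos_of_isOpen {U : Set X} (hU : IsOpen U) (hne : U.Nonempty) : 0 < area X U := by
  obtain ⟨x, hx⟩ := hne
  rw [pos_iff_ne_zero]
  intro h
  have h1 := (volume_image_chart_eq_zero_iff (chartAt_mem_smoothAtlas x)
    (s := (chartAt Plane x).source ∩ U) inter_subset_left).2 (measure_mono_null inter_subset_right h)
  have h2 := (chartAt Plane x).isOpen_image_source_inter hU
  exact (h2.measure_pos volume ⟨_, mem_image_of_mem _ ⟨mem_chart_source Plane x, hx⟩⟩).ne' h1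

theorem area_lt_top_of_isCompact {K : Set X} (hK : IsCompact K) : area X K < ⊤ := by
  refine hK.measure_lt_top_of_nhdsWithin fun x _ => ?_
  set e := chartAt Plane x with he'
  have he : e ∈ IsManifold.maximalAtlas 𝓘₂ ∞ X := chartAt_mem_smoothAtlas x
  have hx : x ∈ e.source := mem_chart_source Plane x
  obtain ⟨B, hB, hBt, hBc⟩ := local_compact_nhds (e.open_target.mem_nhds (e.map_source hx))
  have hBo : e.source ∩ e ⁻¹' B ∈ 𝓝 x :=
    inter_mem (e.open_source.mem_nhds hx) ((e.continuousAt hx) hB)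
  refine ⟨e.source ∩ e ⁻¹' B, mem_nhdsWithin_of_mem_nhds hBo, ?_⟩
  have hsub : e '' (e.source ∩ e ⁻¹' B) ⊆ B := by
    rintro _ ⟨p, hp, rfl⟩
    exact hp.2
  rw [area_of_subset_source he (measurableSet_source_inter_preimage hBc.measurableSet)
    inter_subset_left, chartMeasure_of_subset
    (measurableSet_source_inter_preimage hBc.measurableSet) inter_subset_left]
  refine (lintegral_mono_set hsub).trans_lt ?_
  have h := ((continuousOn_density he).mono hBt).integrableOn_compact (μ := volume) hBc
  exact h.lintegral_lt_top

end Area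


/-! ### The area formula between surfaces -/

section GlobalAreaFormula

variable {X : Type*} [EMetricSpace X] [ChartedSpace Plane X] [IsManifold 𝓘₂ ∞ X]
  [RiemannianBundle (fun x : X => TangentSpace 𝓘₂ x)]
  [IsContMDiffRiemannianBundle 𝓘₂ ∞ Plane (fun x : X => TangentSpace 𝓘₂ x)]
  [MeasurableSpace X] [BorelSpace X] [SecondCountableTopology X]
  {Y : Type*} [EMetricSpace Y] [ChartedSpace Plane Y] [IsManifold 𝓘₂ ∞ Y]
  [RiemannianBundle (fun y : Y => TangentSpace 𝓘₂ y)]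
  [IsContMDiffRiemannianBundle 𝓘₂ ∞ Plane (fun y : Y => TangentSpace 𝓘₂ y)]
  [MeasurableSpace Y] [BorelSpace Y] [SecondCountableTopology Y]
  {e : OpenPartialHomeomorph X Plane} {e' : OpenPartialHomeomorph Y Plane}

/-- A Borel set can be cut into countably many Borel pieces, each of which lies in the domain of a
chart and is mapped to the domain of a chart by a given continuous map. -/
theorem exists_chart_partition_of_continuousOn {φ : X → Y} {A : Set X} (hA : MeasurableSet A)
    (hφ : ContinuousOn φ A) (hne : A.Nonempty) :
    ∃ (c : ℕ × ℕ → OpenPartialHomeomorph X Plane) (c' : ℕ × ℕ → OpenPartialHomeomorph Y Plane)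
      (P : ℕ × ℕ → Set X), (∀ i, MeasurableSet (P i)) ∧ Pairwise (Function.onFun Disjoint P) ∧
      (⋃ i, P i) = A ∧ (∀ i, P i ⊆ (c i).source) ∧ (∀ i, MapsTo φ (P i) (c' i).source) ∧
      (∀ i, c i ∈ IsManifold.maximalAtlas 𝓘₂ ∞ X) ∧ ∀ i, c' i ∈ IsManifold.maximalAtlas 𝓘₂ ∞ Y := by
  obtain ⟨p, -⟩ := hne
  have : Nonempty X := ⟨p⟩
  have : Nonempty Y := ⟨φ p⟩
  obtain ⟨c, B, hBm, hBd, hBU, hBc, hc, -⟩ := exists_chart_partition X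
  obtain ⟨c', B', hBm', hBd', hBU', hBc', hc', -⟩ := exists_chart_partition Y
  refine ⟨fun i => c i.1, fun i => c' i.2, fun i => (A ∩ φ ⁻¹' B' i.2) ∩ B i.1,
    fun i => (measurableSet_inter_preimage hφ hA (hBm' _)).inter (hBm _), ?_, ?_,
    fun i => inter_subset_right.trans (hBc _), fun i q hq => hBc' _ hq.1.2, fun i => hc _,
    fun i => hc' _⟩
  · rintro ⟨i, j⟩ ⟨i', j'⟩ hij
    rw [Function.onFun, disjoint_left]
    rintro q ⟨⟨-, h1⟩, h2⟩ ⟨⟨-, h3⟩, h4⟩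
    apply hij
    have e1 : i = i' := by
      by_contra h
      exact disjoint_left.1 (hBd h) h2 h4
    have e2 : j = j' := by
      by_contra h
      exact disjoint_left.1 (hBd' h) h1 h3
    rw [e1, e2]
  · ext q
    simp only [mem_iUnion, mem_inter_iff, mem_preimage]
    constructor
    · rintro ⟨-, ⟨h, -⟩, -⟩
      exact h
    · intro h
      obtain ⟨i, hi⟩ := mem_iUnion.1 (hBU.symm ▸ mem_univ q)
      obtain ⟨j, hj⟩ := mem_iUnion.1 (hBU'.symm ▸ mem_univ (φ q))
      exact ⟨(i, j), ⟨h, hj⟩, hi⟩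

/-- Images of Borel pieces are only known to be measurable up to null sets in a chart; this carries
the information back to the surface. -/
theorem nullMeasurableSet_of_image_chart (he : e ∈ IsManifold.maximalAtlas 𝓘₂ ∞ X) {s : Set X}
    (hs : s ⊆ e.source) (h : NullMeasurableSet (e '' s) volume) :
    NullMeasurableSet s (area X) ∧
      area X s = ∫⁻ u in e '' s, ENNReal.ofReal (density e u) := by
  obtain ⟨t, hst, htm, htae⟩ := h.exists_measurable_superset_ae_eq
  set s' := e.source ∩ e ⁻¹' t with hs'
  have hs'm : MeasurableSet s' := measurableSet_source_inter_preimage htm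
  have hss' : s ⊆ s' := fun p hp => ⟨hs hp, hst (mem_image_of_mem e hp)⟩
  have hs't : e '' s' ⊆ t := by
    rintro _ ⟨p, hp, rfl⟩
    exact hp.2
  have h1 : volume (t \ e '' s) = 0 := (ae_le_set.1 htae.le)
  have h2 : area X (s' \ s) = 0 := by
    rw [← volume_image_chart_eq_zero_iff he (sdiff_subset.trans inter_subset_left)]
    refine measure_mono_null ?_ h1
    rintro _ ⟨p, hp, rfl⟩
    refine ⟨hs't (mem_image_of_mem e hp.1), ?_⟩
    rintro ⟨p', hp', h⟩
    exact hp.2 (e.injOn (hs hp') hp.1.1 h ▸ hp')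
  have h3 : s' =ᵐ[area X] s := (ae_le_set.2 h2).antisymm (Eventually.of_forall hss')
  have h4 : (e '' s' : Set Plane) =ᵐ[volume] (e '' s : Set Plane) :=
    (ae_le_set.2 (measure_mono_null (sdiff_subset_sdiff_left hs't) h1)).antisymm
      (Eventually.of_forall (image_mono hss'))
  refine ⟨hs'm.nullMeasurableSet.congr h3, ?_⟩
  rw [← measure_congr h3, area_of_subset_source he hs'm inter_subset_left,
    chartMeasure_of_subset hs'm inter_subset_left]
  exact setLIntegral_congr h4

/-- The **area formula** for almost everywhere injective maps between surfaces. -/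
theorem lintegral_normDet_eq_area_image {φ : X → Y} {A : Set X} (hA : MeasurableSet A)
    {T : ∀ p : X, TangentSpace 𝓘₂ p →L[ℝ] TangentSpace 𝓘₂ (φ p)}
    (hT : ∀ p ∈ A, HasMFDerivWithinAt 𝓘₂ 𝓘₂ φ A p (T p))
    (hinj : ∀ᵐ q ∂(area Y), (A ∩ φ ⁻¹' {q}).Subsingleton) :
    AEMeasurable (fun p => ENNReal.ofReal (T p).toLinearMap.normDet) ((area X).restrict A) ∧
      ∫⁻ p in A, ENNReal.ofReal (T p).toLinearMap.normDet ∂(area X) = area Y (φ '' A) := by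
  rcases A.eq_empty_or_nonempty with rfl | hne
  · simp
  have hφ : ContinuousOn φ A := fun p hp => (hT p hp).continuousWithinAt
  obtain ⟨Q, hQ, hQ0, hQinj⟩ := exists_null_injOn hinj
  obtain ⟨c, c', P, hPm, hPd, hPU, hPc, hPc', hc, hc'⟩ :=
    exists_chart_partition_of_continuousOn hA hφ hne
  have hPA : ∀ i, P i ⊆ A := fun i => hPU ▸ subset_iUnion P i
  have hpiece := fun i => lintegral_normDet_chart (hc i) (hc' i) (hPm i) (hPc i) (hPc' i) T
    (fun p hp => (hT p (hPA i hp)).mono (hPA i)) hQ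
    (by rw [← area_restrict_source (hc' i)]; exact Measure.absolutelyContinuous_of_le Measure.restrict_le_self hQ0)
    (hQinj.mono (sdiff_subset_sdiff_left (hPA i)))
  have him : ∀ i, φ '' P i ⊆ (c' i).source := fun i => (hPc' i).image_subset
  have hnull := fun i => nullMeasurableSet_of_image_chart (hc' i) (him i) (hpiece i).1
  refine ⟨?_, ?_⟩
  · rw [← hPU, aemeasurable_iUnion_iff]
    exact fun i => aemeasurable_iff_chart (hc i) (hPm i) (hPc i) (hpiece i).2.1
  -- Disjoint pieces can have overlapping images only inside the exceptional set `Q`, so the areas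
  -- of the images add up.
  · have hd : Pairwise (Function.onFun (AEDisjoint (area Y)) fun i => φ '' P i) := by
      intro i j hij
      refine measure_mono_null ?_ hQ0
      rintro _ ⟨⟨p, hp, rfl⟩, p', hp', h⟩
      by_contra hq
      have := hQinj ⟨hPA j hp', by simpa [h] using hq⟩ ⟨hPA i hp, hq⟩ h
      rw [this] at hp'
      exact disjoint_left.1 (hPd hij) hp hp'
    conv_lhs => rw [← hPU]
    rw [lintegral_iUnion hPm hPd, ← hPU, image_iUnion, measure_iUnion₀ hd fun i => (hnull i).1]
    congr 1
    ext i
    rw [setLIntegral_chart (hc i) (hPm i) (hPc i) (hpiece i).2.1, (hpiece i).2.2, (hnull i).2]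

theorem norm_apply_coordFrame (he' : e' ∈ IsManifold.maximalAtlas 𝓘₂ ∞ Y) {φ : X → Y}
    (T : ∀ p : X, TangentSpace 𝓘₂ p →L[ℝ] TangentSpace 𝓘₂ (φ p)) {u : Plane}
    (hu : φ (e.symm u) ∈ e'.source) (v : Plane) :
    ‖T (e.symm u) (coordFrame e u v)‖ =
      ‖coordFrame e' (e' (φ (e.symm u))) (chartDeriv e e' φ T u v)‖ :=
  norm_eq_norm_coordFrame he' hu _

/-- The operator norm as a supremum over countably many coordinate vectors. It makes the largest
singular value measurable although the tangent planes vary with the point. -/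
theorem ofReal_singularValue_zero {V W : Type*} [NormedAddCommGroup V] [InnerProductSpace ℝ V]
    [FiniteDimensional ℝ V] [NormedAddCommGroup W] [InnerProductSpace ℝ W] [FiniteDimensional ℝ W]
    (hV : Module.finrank ℝ V = 2) (T : V →L[ℝ] W) (L : Plane ≃L[ℝ] V) :
    ENNReal.ofReal (T.toLinearMap.singularValues 0) = ⨆ n : ℕ,
      ENNReal.ofReal ‖T (L (TopologicalSpace.denseSeq Plane n))‖ /
        ENNReal.ofReal ‖L (TopologicalSpace.denseSeq Plane n)‖ := by
  have h0 : 0 ≤ T.toLinearMap.singularValues 0 := T.toLinearMap.singularValues_nonneg 0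
  have hle : (⨆ n : ℕ, ENNReal.ofReal ‖T (L (TopologicalSpace.denseSeq Plane n))‖ /
        ENNReal.ofReal ‖L (TopologicalSpace.denseSeq Plane n)‖)
        ≤ ENNReal.ofReal (T.toLinearMap.singularValues 0) := by
    refine iSup_le fun n => ENNReal.div_le_of_le_mul ?_
    rw [← ENNReal.ofReal_mul h0]
    exact ENNReal.ofReal_le_ofReal ((singularValues_zero_le_iff hV _ h0).1 le_rfl _)
  refine le_antisymm ?_ hle
  set S := ⨆ n : ℕ, ENNReal.ofReal ‖T (L (TopologicalSpace.denseSeq Plane n))‖ /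
        ENNReal.ofReal ‖L (TopologicalSpace.denseSeq Plane n)‖ with hS
  have hSt : S ≠ ⊤ := (hle.trans_lt ENNReal.ofReal_lt_top).ne
  rw [← ENNReal.ofReal_toReal hSt]
  refine ENNReal.ofReal_le_ofReal ((singularValues_zero_le_iff hV _ ENNReal.toReal_nonneg).2 ?_)
  have key : ∀ v : Plane, ‖T (L v)‖ ≤ S.toReal * ‖L v‖ := by
    have hcl : IsClosed {v : Plane | ‖T (L v)‖ ≤ S.toReal * ‖L v‖} :=
      isClosed_le (T.continuous.comp L.continuous).norm (continuous_const.mul L.continuous.norm)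
    have hd := TopologicalSpace.denseRange_denseSeq Plane
    refine fun v => hd.induction_on v hcl fun n => ?_
    by_cases hz : L (TopologicalSpace.denseSeq Plane n) = 0
    · simp [hz]
    · have h1 : ENNReal.ofReal ‖T (L (TopologicalSpace.denseSeq Plane n))‖ /
        ENNReal.ofReal ‖L (TopologicalSpace.denseSeq Plane n)‖ ≤ S := le_iSup
          (fun n => ENNReal.ofReal ‖T (L (TopologicalSpace.denseSeq Plane n))‖ /
            ENNReal.ofReal ‖L (TopologicalSpace.denseSeq Plane n)‖) n
      have hpos : 0 < ‖L (TopologicalSpace.denseSeq Plane n)‖ := norm_pos_iff.2 hz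
      rw [← ENNReal.ofReal_div_of_pos hpos, ENNReal.ofReal_le_iff_le_toReal hSt,
        div_le_iff₀ hpos] at h1
      exact h1
  intro v
  have := key (L.symm v)
  rwa [L.apply_symm_apply] at this

theorem aemeasurable_norm_coordFrame (he : e ∈ IsManifold.maximalAtlas 𝓘₂ ∞ X) {B : Set Plane}
    (hB : MeasurableSet B) {F : Plane → Plane} (hF : ContinuousOn F B) (hFB : MapsTo F B e.target)
    {w : Plane → Plane} (hw : AEMeasurable w (volume.restrict B)) :
    AEMeasurable (fun u => ‖coordFrame e (F u) (w u)‖) (volume.restrict B) := by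
  have hgram : ∀ v v' : Plane, AEMeasurable (fun u => inner ℝ
      (coordFrame e (F u) v) (coordFrame e (F u) v')) (volume.restrict B) := by
    intro v v'
    have h1 : ContinuousOn (fun z => inner ℝ (coordFrame e z v) (coordFrame e z v')) e.target :=
      fun z hz => (contDiffAt_inner_coordFrame he hz v v').continuousAt.continuousWithinAt
    exact (h1.comp hF hFB).aemeasurable hB
  have hw' : ∀ k : Fin 2, AEMeasurable (fun u => w u k) (volume.restrict B) := fun k =>
    (EuclideanSpace.proj k : Plane →L[ℝ] ℝ).continuous.measurable.comp_aemeasurable hw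
  have h2 : AEMeasurable (fun u => ‖coordFrame e (F u) (w u)‖ ^ 2) (volume.restrict B) := by
    simp only [norm_sq_coordFrame]
    exact ((((hw' 0).pow_const 2).mul (hgram _ _)).add ((((hw' 0).mul (hw' 1)).const_mul 2).mul
      (hgram _ _))).add (((hw' 1).pow_const 2).mul (hgram _ _))
  exact h2.sqrt.congr (Eventually.of_forall fun u => Real.sqrt_sq (norm_nonneg _))

theorem aemeasurable_singularValue_zero {φ : X → Y} {A : Set X} (hA : MeasurableSet A)
    {T : ∀ p : X, TangentSpace 𝓘₂ p →L[ℝ] TangentSpace 𝓘₂ (φ p)}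
    (hT : ∀ p ∈ A, HasMFDerivWithinAt 𝓘₂ 𝓘₂ φ A p (T p)) :
    AEMeasurable (fun p => (T p).toLinearMap.singularValues 0) ((area X).restrict A) := by
  rcases A.eq_empty_or_nonempty with rfl | hne
  · simp
  have hφ : ContinuousOn φ A := fun p hp => (hT p hp).continuousWithinAt
  obtain ⟨c, c', P, hPm, hPd, hPU, hPc, hPc', hc, hc'⟩ :=
    exists_chart_partition_of_continuousOn hA hφ hne
  have hPA : ∀ i, P i ⊆ A := fun i => hPU ▸ subset_iUnion P i
  rw [← hPU, aemeasurable_iUnion_iff]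
  intro i
  refine aemeasurable_iff_chart (hc i) (hPm i) (hPc i) ?_
  have hm := measurableSet_image_chart (hPm i) (hPc i)
  have hsymm : ∀ u ∈ c i '' P i, (c i).symm u ∈ P i := by
    rintro _ ⟨p, hp, rfl⟩
    rwa [(c i).left_inv (hPc i hp)]
  have htarget : c i '' P i ⊆ (c i).target := by
    rintro _ ⟨p, hp, rfl⟩
    exact (c i).map_source (hPc i hp)
  have hder : ∀ u ∈ c i '' P i, HasFDerivWithinAt (c' i ∘ φ ∘ (c i).symm)
      (chartDeriv (c i) (c' i) φ T u) (c i '' P i) u := fun u hu =>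
    hasFDerivWithinAt_chart (hc i) (hc' i) (hPc i) (hPc' i) hu
      ((hT _ (hPA i (hsymm u hu))).mono (hPA i))
  have hD := aemeasurable_fderivWithin volume hm hder
  have hFc : ContinuousOn (c' i ∘ φ ∘ (c i).symm) (c i '' P i) :=
    fun u hu => (hder u hu).continuousWithinAt
  have hb : ∀ v : Plane, AEMeasurable (fun u => ‖coordFrame (c i) u v‖)
      (volume.restrict (c i '' P i)) := fun v =>
    aemeasurable_norm_coordFrame (hc i) hm continuousOn_id htarget aemeasurable_const
  have ha : ∀ v : Plane, AEMeasurable (fun u => ‖T ((c i).symm u) (coordFrame (c i) u v)‖)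
      (volume.restrict (c i '' P i)) := by
    intro v
    have hDv : AEMeasurable (fun u => chartDeriv (c i) (c' i) φ T u v)
        (volume.restrict (c i '' P i)) :=
      (ContinuousLinearMap.apply ℝ Plane v).continuous.measurable.comp_aemeasurable hD
    refine (aemeasurable_norm_coordFrame (hc' i) hm hFc
      (fun u hu => (c' i).map_source (hPc' i (hsymm u hu))) hDv).congr ?_
    filter_upwards [self_mem_ae_restrict hm] with u hu
    exact (norm_apply_coordFrame (hc' i) T (hPc' i (hsymm u hu)) v).symm
  have h3 : AEMeasurable (fun u => (⨆ n : ℕ, ENNReal.ofReal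
      ‖T ((c i).symm u) (coordFrame (c i) u (TopologicalSpace.denseSeq Plane n))‖ /
      ENNReal.ofReal ‖coordFrame (c i) u (TopologicalSpace.denseSeq Plane n)‖).toReal)
      (volume.restrict (c i '' P i)) :=
    (AEMeasurable.iSup fun n => (ha _).ennreal_ofReal.div (hb _).ennreal_ofReal).ennreal_toReal
  refine h3.congr ?_
  filter_upwards [self_mem_ae_restrict hm] with u hu
  obtain ⟨L, hL⟩ := exists_coordFrame_equiv (hc i) (htarget hu)
  have h4 := ofReal_singularValue_zero (finrank_tangentPlane ((c i).symm u)) (T ((c i).symm u)) L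
  have h5 : 0 ≤ (T ((c i).symm u)).toLinearMap.singularValues 0 :=
    (T ((c i).symm u)).toLinearMap.singularValues_nonneg 0
  rw [← ENNReal.toReal_ofReal h5, h4]
  simp only [hL]

end GlobalAreaFormula


/-! ### Riemannian distance and Euclidean distance in charts -/

section ChartDistance

open Metric

variable {X : Type*} [EMetricSpace X] [ChartedSpace Plane X] [IsManifold 𝓘₂ ∞ X]
  [RiemannianBundle (fun x : X => TangentSpace 𝓘₂ x)]
  [IsContMDiffRiemannianBundle 𝓘₂ ∞ Plane (fun x : X => TangentSpace 𝓘₂ x)]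
  [IsRiemannianManifold 𝓘₂ X]
  {e : OpenPartialHomeomorph X Plane}

/-- The parametrization given by a chart is Lipschitz on balls. -/
theorem edist_symm_le (he : e ∈ IsManifold.maximalAtlas 𝓘₂ ∞ X) {u₀ : Plane} {R c C ℓ : ℝ}
    (hR : ball u₀ R ⊆ e.target)
    (hq : PlaneMetric (fun u v => ‖coordFrame e u v‖ ^ 2) (ball u₀ R) c C ℓ) {u u' : Plane}
    (hu : u ∈ ball u₀ R) (hu' : u' ∈ ball u₀ R) :
    edist (e.symm u) (e.symm u') ≤ ENNReal.ofReal C * edist u u' := by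
  rw [IsRiemannianManifold.out (I := 𝓘₂) (e.symm u) (e.symm u')]
  -- The Riemannian distance is at most the length of the image of the straight segment.
  set η : ℝ → Plane := fun t => u + t • (u' - u) with hη
  have hηball : ∀ t ∈ Icc (0 : ℝ) 1, η t ∈ ball u₀ R := by
    intro t ht
    have h := (convex_ball u₀ R).add_smul_sub_mem hu hu' ht
    exact h
  have hηd : ∀ t, HasDerivAt η (u' - u) t := fun t => by
    have h := ((hasDerivAt_id t).smul_const (u' - u)).const_add u
    rw [one_smul] at h
    exact h
  have hηc : ContDiff ℝ 1 η := contDiff_const.add (contDiff_id.smul contDiff_const)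
  have hγ : ContMDiffOn 𝓘(ℝ, ℝ) 𝓘₂ 1 (e.symm ∘ η) (Icc 0 1) :=
    ((contMDiffOn_symm_of_mem_maximalAtlas he).of_le one_le_smooth).comp
      hηc.contMDiff.contMDiffOn fun t ht => hR (hηball t ht)
  refine (riemannianEDist_le_pathELength hγ (x := e.symm u) (y := e.symm u') (by simp [hη])
    (by simp [hη]) zero_le_one).trans ?_
  rw [pathELength_eq_lintegral_mfderiv_Icc]
  have hpt : ∀ t ∈ Icc (0 : ℝ) 1, ‖mfderiv 𝓘(ℝ, ℝ) 𝓘₂ (e.symm ∘ η) t (1 : ℝ)‖ₑ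
      ≤ ENNReal.ofReal C * edist u u' := by
    intro t ht
    have h1 := (hasMFDerivAt_symm he (hR (hηball t ht))).comp t (hηd t).hasFDerivAt.hasMFDerivAt
    have h2 : mfderiv 𝓘(ℝ, ℝ) 𝓘₂ (e.symm ∘ η) t (1 : ℝ) = coordFrame e (η t) (u' - u) := by
      rw [h1.mfderiv]
      have h3 : (ContinuousLinearMap.toSpanSingleton ℝ (u' - u)) (1 : ℝ) = u' - u := by simp
      exact congrArg (coordFrame e (η t)) h3
    rw [h2, ← ofReal_norm, edist_comm, edist_dist, dist_eq_norm,
      ← ENNReal.ofReal_mul hq.C_pos.le]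
    refine ENNReal.ofReal_le_ofReal (abs_le_of_sq_le_sq' ?_ ?_).2
    · rw [mul_pow]
      exact hq.upper _ (hηball t ht) _
    · exact mul_nonneg hq.C_pos.le (norm_nonneg _)
  refine (setLIntegral_mono' measurableSet_Icc hpt).trans ?_
  simp

theorem enorm_deriv_chart_le (he : e ∈ IsManifold.maximalAtlas 𝓘₂ ∞ X) {U : Set Plane}
    {c C ℓ : ℝ} (hq : PlaneMetric (fun u v => ‖coordFrame e u v‖ ^ 2) U c C ℓ) {γ : ℝ → X} {t : ℝ}
    (hγ : MDifferentiableAt 𝓘(ℝ, ℝ) 𝓘₂ γ t) (hs : γ t ∈ e.source) (hU : e (γ t) ∈ U) :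
    DifferentiableAt ℝ (e ∘ γ) t ∧
    ENNReal.ofReal c * ‖deriv (e ∘ γ) t‖ₑ ≤ ‖mfderiv 𝓘(ℝ, ℝ) 𝓘₂ γ t (1 : ℝ)‖ₑ := by
  set D : ℝ →L[ℝ] Plane := (mfderiv 𝓘₂ 𝓘₂ e (γ t) : Plane →L[ℝ] Plane).comp
    (mfderiv 𝓘(ℝ, ℝ) 𝓘₂ γ t : ℝ →L[ℝ] Plane) with hD
  have h1 : HasFDerivAt (e ∘ γ) D t :=
    (((mdifferentiable_of_mem_maximalAtlas he).mdifferentiableAt hs).hasMFDerivAt.comp t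
      hγ.hasMFDerivAt).hasFDerivAt
  refine ⟨h1.differentiableAt, ?_⟩
  have h2 : deriv (e ∘ γ) t =
      mfderiv 𝓘₂ 𝓘₂ e (γ t) (mfderiv 𝓘(ℝ, ℝ) 𝓘₂ γ t (1 : ℝ)) := h1.hasDerivAt.deriv
  have h3 := norm_eq_norm_coordFrame he hs (mfderiv 𝓘(ℝ, ℝ) 𝓘₂ γ t (1 : ℝ))
  have h4 : ‖coordFrame e (e (γ t)) (deriv (e ∘ γ) t)‖
      = ‖mfderiv 𝓘(ℝ, ℝ) 𝓘₂ γ t (1 : ℝ)‖ := by rw [h3, h2]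
  rw [← ofReal_norm, ← ofReal_norm, ← ENNReal.ofReal_mul hq.c_pos.le, ← h4]
  refine ENNReal.ofReal_le_ofReal (abs_le_of_sq_le_sq' ?_ (norm_nonneg _)).2
  rw [mul_pow]
  exact hq.lower _ hU _

/-- A path which stays in a small ball in a chart moves at most by its length in the chart. -/
theorem norm_chart_sub_lt (he : e ∈ IsManifold.maximalAtlas 𝓘₂ ∞ X) {u : Plane} {ρ : ℝ}
    {U : Set Plane} {c C ℓ : ℝ} (hU : U ⊆ e.target)
    (hq : PlaneMetric (fun u v => ‖coordFrame e u v‖ ^ 2) U c C ℓ) {γ : ℝ → X}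
    (hγ : ContMDiff 𝓘(ℝ, ℝ) 𝓘₂ 1 γ) {t₁ : ℝ} (ht₁ : 0 ≤ t₁)
    (hin : ∀ t ∈ Icc 0 t₁, γ t ∈ e.symm '' U) (h0 : γ 0 = e.symm u) (hu : u ∈ e.target)
    (hlen : pathELength 𝓘₂ γ 0 t₁ < ENNReal.ofReal (c * ρ)) : ‖e (γ t₁) - u‖ < ρ := by
  have hsrc : ∀ t ∈ Icc 0 t₁, γ t ∈ e.source ∧ e (γ t) ∈ U := by
    intro t ht
    obtain ⟨w, hw, hwt⟩ := hin t ht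
    rw [← hwt, e.right_inv (hU hw)]
    exact ⟨e.map_target (hU hw), hw⟩
  have hpt := fun t ht => enorm_deriv_chart_le he hq
    ((hγ.mdifferentiable one_ne_zero) t) (hsrc t ht).1 (hsrc t ht).2
  have hcd : ContDiffOn ℝ 1 (e ∘ γ) (Icc 0 t₁) := by
    rw [← contMDiffOn_iff_contDiffOn]
    exact ((contMDiffOn_of_mem_maximalAtlas he).of_le one_le_smooth).comp hγ.contMDiffOn
      fun t ht => (hsrc t ht).1
  have h1 := enorm_sub_le_lintegral_derivWithin_Icc_of_contDiffOn_Icc hcd ht₁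
  have h2 : ENNReal.ofReal c * ‖(e ∘ γ) t₁ - (e ∘ γ) 0‖ₑ ≤ pathELength 𝓘₂ γ 0 t₁ := by
    refine (mul_le_mul_right h1 (ENNReal.ofReal c)).trans ?_
    rw [← lintegral_const_mul' _ _ ENNReal.ofReal_ne_top, pathELength_eq_lintegral_mfderiv_Icc]
    rcases ht₁.eq_or_lt with rfl | ht₁
    · simp
    · refine setLIntegral_mono' measurableSet_Icc fun t ht => ?_
      rw [(hpt t ht).1.derivWithin (uniqueDiffOn_Icc ht₁ t ht)]
      exact (hpt t ht).2
  have h3 := h2.trans_lt hlen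
  rw [← ofReal_norm, ← ENNReal.ofReal_mul hq.c_pos.le, ENNReal.ofReal_lt_ofReal_iff_of_nonneg
    (mul_nonneg hq.c_pos.le (norm_nonneg _))] at h3
  have h4 := lt_of_mul_lt_mul_left h3 hq.c_pos.le
  rwa [Function.comp_apply, Function.comp_apply, h0, e.right_inv hu] at h4

/-- Charts are Lipschitz on small balls. -/
theorem le_edist_symm (he : e ∈ IsManifold.maximalAtlas 𝓘₂ ∞ X) {u₀ : Plane} {R c C ℓ : ℝ}
    (hR : ball u₀ R ⊆ e.target)
    (hq : PlaneMetric (fun u v => ‖coordFrame e u v‖ ^ 2) (ball u₀ R) c C ℓ) {u u' : Plane}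
    (hu : u ∈ ball u₀ (R / 3)) (hu' : u' ∈ ball u₀ (R / 3)) :
    ENNReal.ofReal c * edist u u' ≤ edist (e.symm u) (e.symm u') := by
  by_contra! hlt
  rw [IsRiemannianManifold.out (I := 𝓘₂) (e.symm u) (e.symm u')] at hlt
  set ρ := dist u u' with hρ
  rw [edist_dist, ← ENNReal.ofReal_mul hq.c_pos.le] at hlt
  -- Here `ρ < 2R/3` and `u` is within `R/3` of the centre, which explains the radius `R/3`.
  have hball : closedBall u ρ ⊆ ball u₀ R := by
    intro w hw
    rw [mem_ball] at hu hu' ⊢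
    rw [mem_closedBall] at hw
    have h1 := dist_triangle w u u₀
    have h2 := dist_triangle_right u u' u₀
    linarith
  have hρ0 : 0 < ρ := by
    by_contra! h
    have : c * ρ ≤ 0 := mul_nonpos_of_nonneg_of_nonpos hq.c_pos.le h
    rw [ENNReal.ofReal_of_nonpos this] at hlt
    exact not_lt_zero hlt
  have hut : u ∈ e.target := hR (hball (mem_closedBall_self hρ0.le))
  obtain ⟨γ, hγ0, hγ1, hγ, hlen, -⟩ := exists_lt_locally_constant_of_riemannianEDist_lt hlt
    zero_lt_one
  have hest : ∀ t₁ ∈ Icc (0 : ℝ) 1, Icc 0 t₁ ⊆ γ ⁻¹' (e.symm '' closedBall u ρ) →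
      ‖e (γ t₁) - u‖ < ρ := fun t₁ ht₁ h =>
    norm_chart_sub_lt he (hball.trans hR) (hq.mono hball) hγ ht₁.1 h hγ0 hut
      ((pathELength_mono le_rfl ht₁.2).trans_lt hlen)
  have hclosed : IsClosed (γ ⁻¹' (e.symm '' closedBall u ρ) ∩ Icc 0 1) := by
    refine IsClosed.inter (IsClosed.preimage hγ.continuous ?_) isClosed_Icc
    exact ((isCompact_closedBall u ρ).image_of_continuousOn
      (e.continuousOn_symm.mono (hball.trans hR))).isClosed
  -- Continuous induction: as long as the short path stays in the closed ball, its length keeps it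
  -- strictly inside, so it cannot leave. In particular it cannot reach `u'`, at distance exactly
  -- `ρ`.
  have hall : Icc (0 : ℝ) 1 ⊆ γ ⁻¹' (e.symm '' closedBall u ρ) := by
    refine hclosed.Icc_subset_of_forall_mem_nhdsGT_of_Icc_subset
      ⟨u, mem_closedBall_self hρ0.le, hγ0.symm⟩ fun t₁ ht₁ h => ?_
    have h1 := hest t₁ ⟨ht₁.1, ht₁.2.le⟩ h
    obtain ⟨w, hw, hwt⟩ := h ⟨ht₁.1, le_rfl⟩
    have hwt' := hR (hball hw)
    rw [← hwt, e.right_inv hwt', ← dist_eq_norm] at h1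
    have hopen : IsOpen (e.symm '' ball u ρ) :=
      e.symm.isOpen_image_of_subset_source isOpen_ball
        ((ball_subset_closedBall.trans hball).trans hR)
    refine hγ.continuous.continuousWithinAt ?_
    refine mem_of_superset (hopen.mem_nhds ?_) (image_mono ball_subset_closedBall)
    exact ⟨w, h1, hwt⟩
  have h1 := hest 1 ⟨zero_le_one, le_rfl⟩ hall
  rw [hγ1, e.right_inv, ← dist_eq_norm, dist_comm] at h1
  · exact lt_irrefl _ h1
  · refine hR (hball ?_)
    rw [mem_closedBall, dist_comm]

variable {Y : Type*} [EMetricSpace Y] [ChartedSpace Plane Y] [IsManifold 𝓘₂ ∞ Y]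
  [RiemannianBundle (fun y : Y => TangentSpace 𝓘₂ y)]
  [IsContMDiffRiemannianBundle 𝓘₂ ∞ Plane (fun y : Y => TangentSpace 𝓘₂ y)]
  [IsRiemannianManifold 𝓘₂ Y]
  {e' : OpenPartialHomeomorph Y Plane}

/-- Lipschitz maps between surfaces are locally Lipschitz in charts. -/
theorem exists_lipschitzOnWith_chart (he : e ∈ IsManifold.maximalAtlas 𝓘₂ ∞ X)
    (he' : e' ∈ IsManifold.maximalAtlas 𝓘₂ ∞ Y) {M : Set X} {φ : X → Y} {K : ℝ≥0}
    (hφ : LipschitzOnWith K φ M) {p : X} (hpM : p ∈ M) (hp : p ∈ e.source)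
    (hp' : φ p ∈ e'.source) {ε : ℝ} (hε : 0 < ε) :
    ∃ R > 0, ball (e p) R ⊆ e.target ∧ ∃ K' : ℝ≥0,
      LipschitzOnWith K' (e' ∘ φ ∘ e.symm) (e.symm ⁻¹' M ∩ ball (e p) R) ∧
      MapsTo (φ ∘ e.symm) (e.symm ⁻¹' M ∩ ball (e p) R) e'.source ∧
      MapsTo (e' ∘ φ ∘ e.symm) (e.symm ⁻¹' M ∩ ball (e p) R) (ball (e' (φ p)) ε) := by
  obtain ⟨R₁, hR₁, hR₁t, c, C, ℓ, hq⟩ := exists_planeMetric he (e.map_source hp)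
  obtain ⟨R₂, hR₂, hR₂t, c', C', ℓ', hq'⟩ := exists_planeMetric he' (e'.map_source hp')
  set V : Set Y := e'.source ∩ e' ⁻¹' ball (e' (φ p)) (min ε (R₂ / 3)) with hV
  have hVn : V ∈ 𝓝 (φ p) := inter_mem (e'.open_source.mem_nhds hp')
    (e'.continuousAt hp' (ball_mem_nhds _ (by positivity)))
  have h1 : φ ⁻¹' V ∈ 𝓝[M] p := hφ.continuousOn p hpM hVn
  obtain ⟨O, hO, hOV⟩ := mem_nhdsWithin_iff_exists_mem_nhds_inter.1 h1
  have h2 : e.symm ⁻¹' O ∈ 𝓝 (e p) := by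
    refine e.continuousAt_symm (e.map_source hp) ?_
    rwa [e.left_inv hp]
  obtain ⟨R₃, hR₃, hR₃O⟩ := Metric.mem_nhds_iff.1 h2
  have hVu : ∀ u ∈ e.symm ⁻¹' M ∩ ball (e p) (min R₁ R₃), φ (e.symm u) ∈ V := fun u hu =>
    hOV ⟨hR₃O (ball_subset_ball (min_le_right _ _) hu.2), hu.1⟩
  refine ⟨min R₁ R₃, lt_min hR₁ hR₃, (ball_subset_ball (min_le_left _ _)).trans hR₁t,
    (K * C.toNNReal) / c'.toNNReal, ?_, fun u hu => (hVu u hu).1, fun u hu =>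
      ball_subset_ball (min_le_left _ _) (hVu u hu).2⟩
  intro u hu v hv
  have a1 := le_edist_symm he' hR₂t hq' (ball_subset_ball (min_le_right _ _) (hVu u hu).2)
    (ball_subset_ball (min_le_right _ _) (hVu v hv).2)
  rw [e'.left_inv (hVu u hu).1, e'.left_inv (hVu v hv).1] at a1
  have a2 := hφ hu.1 hv.1
  have a3 := edist_symm_le he hR₁t hq (ball_subset_ball (min_le_left _ _) hu.2)
    (ball_subset_ball (min_le_left _ _) hv.2)
  have a4 := a1.trans (a2.trans (mul_le_mul_right a3 (K : ℝ≥0∞)))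
  have hc0 : c'.toNNReal ≠ 0 := (Real.toNNReal_pos.2 hq'.c_pos).ne'
  have hc1 : (c'.toNNReal : ℝ≥0∞) ≠ 0 := by exact_mod_cast hc0
  have a5 : edist (e' (φ (e.symm u))) (e' (φ (e.symm v)))
      ≤ (K : ℝ≥0∞) * (ENNReal.ofReal C * edist u v) / c'.toNNReal := by
    rw [ENNReal.le_div_iff_mul_le (Or.inl hc1) (Or.inl ENNReal.coe_ne_top), mul_comm]
    exact a4
  refine a5.trans_eq ?_
  rw [ENNReal.coe_div hc0, ENNReal.coe_mul, div_eq_mul_inv, div_eq_mul_inv]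
  change _ * (ENNReal.ofReal C * _) * _ = _ * ENNReal.ofReal C * _ * _
  ring

end ChartDistance


/-! ### Lipschitz maps between surfaces: differentiability and Jacobians -/

section LipschitzMaps

open Metric

variable {X : Type*} [EMetricSpace X] [ChartedSpace Plane X] [IsManifold 𝓘₂ ∞ X]
  [RiemannianBundle (fun x : X => TangentSpace 𝓘₂ x)]
  [IsContMDiffRiemannianBundle 𝓘₂ ∞ Plane (fun x : X => TangentSpace 𝓘₂ x)]
  {Y : Type*} [EMetricSpace Y] [ChartedSpace Plane Y] [IsManifold 𝓘₂ ∞ Y]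
  [RiemannianBundle (fun y : Y => TangentSpace 𝓘₂ y)]
  [IsContMDiffRiemannianBundle 𝓘₂ ∞ Plane (fun y : Y => TangentSpace 𝓘₂ y)]
  {e : OpenPartialHomeomorph X Plane} {e' : OpenPartialHomeomorph Y Plane}

/-- Differentiability in charts gives differentiability. -/
theorem exists_hasMFDerivWithinAt_of_chart (he : e ∈ IsManifold.maximalAtlas 𝓘₂ ∞ X)
    (he' : e' ∈ IsManifold.maximalAtlas 𝓘₂ ∞ Y) {M : Set X} {φ : X → Y} {O : Set Plane} {p : X}
    (hpM : p ∈ M) (hp : p ∈ e.source) (hO : O ∈ 𝓝 (e p))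
    (hmaps : MapsTo (φ ∘ e.symm) (e.symm ⁻¹' M ∩ O) e'.source) {A : Plane →L[ℝ] Plane}
    (hA : HasFDerivWithinAt (e' ∘ φ ∘ e.symm) A (e.symm ⁻¹' M ∩ O) (e p)) :
    ∃ T : TangentSpace 𝓘₂ p →L[ℝ] TangentSpace 𝓘₂ (φ p), HasMFDerivWithinAt 𝓘₂ 𝓘₂ φ M p T ∧
      ∀ w : TangentSpace 𝓘₂ p,
        ‖T w‖ = ‖coordFrame e' (e' (φ p)) (A (mfderiv 𝓘₂ 𝓘₂ e p w))‖ := by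
  have hO' : e ⁻¹' O ∩ e.source ∈ 𝓝 p :=
    inter_mem (e.continuousAt hp hO) (e.open_source.mem_nhds hp)
  have hFe : ∀ q ∈ M ∩ (e ⁻¹' O ∩ e.source), φ q ∈ e'.source ∧
      (e'.symm ∘ (e' ∘ φ ∘ e.symm) ∘ e) q = φ q := by
    rintro q ⟨hqM, hqO, hq⟩
    have h1 : e.symm (e q) = q := e.left_inv hq
    have h2 := hmaps (x := e q) ⟨by rwa [mem_preimage, h1], hqO⟩
    simp only [Function.comp_apply, h1] at h2 ⊢
    exact ⟨h2, e'.left_inv h2⟩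
  have hpin : p ∈ M ∩ (e ⁻¹' O ∩ e.source) := ⟨hpM, mem_of_mem_nhds hO'⟩
  have hp' := (hFe p hpin).1
  have h1 : HasMFDerivWithinAt 𝓘₂ 𝓘₂ e (M ∩ (e ⁻¹' O ∩ e.source)) p (mfderiv 𝓘₂ 𝓘₂ e p) :=
    ((mdifferentiable_of_mem_maximalAtlas he).mdifferentiableAt hp).hasMFDerivAt.hasMFDerivWithinAt
  have h2 : HasMFDerivWithinAt 𝓘₂ 𝓘₂ (e' ∘ φ ∘ e.symm) (e.symm ⁻¹' M ∩ O) (e p) A :=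
    hA.hasMFDerivWithinAt
  have h3 : HasMFDerivAt 𝓘₂ 𝓘₂ e'.symm ((e' ∘ φ ∘ e.symm) (e p))
      (coordFrame e' ((e' ∘ φ ∘ e.symm) (e p))) := by
    refine hasMFDerivAt_symm he' ?_
    simp only [Function.comp_apply, e.left_inv hp]
    exact e'.map_source hp'
  have h4 := (h3.comp_hasMFDerivWithinAt (e p) h2).comp p h1 (by
    rintro q ⟨hqM, hqO, hq⟩
    refine ⟨?_, hqO⟩
    rwa [mem_preimage, e.left_inv hq])
  have h5 := h4.congr_of_eventuallyEq (f₁ := φ)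
    (eventually_nhdsWithin_of_forall fun q hq => ((hFe q hq).2).symm) (hFe p hpin).2.symm
  refine ⟨_, h5.mono_of_mem_nhdsWithin ?_, fun w => ?_⟩
  · exact inter_mem self_mem_nhdsWithin (mem_nhdsWithin_of_mem_nhds hO')
  · rw [norm_eq_norm_coordFrame he' hp']
    have h6 := (mdifferentiable_of_mem_maximalAtlas he').comp_symm_deriv (e'.map_source hp')
    rw [e'.left_inv hp'] at h6
    have h7 : (e' ∘ φ ∘ e.symm) (e p) = e' (φ p) := by simp [e.left_inv hp]
    have h8 := DFunLike.congr_fun h6 (A (mfderiv 𝓘₂ 𝓘₂ e p w))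
    refine congrArg (fun v : Plane => ‖coordFrame e' (e' (φ p)) v‖) ?_
    rw [h7]
    exact h8

variable [IsRiemannianManifold 𝓘₂ X] [IsRiemannianManifold 𝓘₂ Y]
  [MeasurableSpace X] [BorelSpace X] [SecondCountableTopology X]

/-- **Rademacher's theorem** for Lipschitz maps between surfaces. -/
theorem ae_mdifferentiableWithinAt {M : Set X} (hM : MeasurableSet M) {φ : X → Y} {K : ℝ≥0}
    (hφ : LipschitzOnWith K φ M) :
    ∀ᵐ p ∂(area X).restrict M, MDifferentiableWithinAt 𝓘₂ 𝓘₂ φ M p := by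
  rw [ae_restrict_iff' hM, ae_iff]
  refine measure_null_of_locally_null _ fun p hp => ?_
  simp only [Classical.not_imp, mem_ofPred_eq] at hp
  have he := chartAt_mem_smoothAtlas p
  have he' := chartAt_mem_smoothAtlas (φ p)
  have hps := mem_chart_source Plane p
  set e := chartAt Plane p
  set e' := chartAt Plane (φ p)
  obtain ⟨R, hR, hRt, K', hF, hmaps, -⟩ := exists_lipschitzOnWith_chart he he' hφ hp.1 hps
    (mem_chart_source Plane (φ p)) one_pos
  refine ⟨{q | ¬ (q ∈ M → MDifferentiableWithinAt 𝓘₂ 𝓘₂ φ M q)} ∩ (e.source ∩ e ⁻¹' ball (e p) R),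
    inter_mem_nhdsWithin _ (inter_mem (e.open_source.mem_nhds hps)
      (e.continuousAt hps (ball_mem_nhds _ hR))), ?_⟩
  -- The bad set is locally null: in charts it is contained in the null set given by the planar
  -- Rademacher theorem.
  rw [← volume_image_chart_eq_zero_iff he (inter_subset_right.trans inter_subset_left)]
  refine measure_mono_null ?_ (ae_iff.1 hF.ae_differentiableWithinAt_of_mem)
  rintro _ ⟨q, ⟨hq, hqs, hqb⟩, rfl⟩
  simp only [Classical.not_imp, mem_ofPred_eq] at hq ⊢
  refine ⟨⟨by rw [mem_preimage, e.left_inv hqs]; exact hq.1, hqb⟩, fun hd => hq.2 ?_⟩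
  obtain ⟨T, hT, -⟩ := exists_hasMFDerivWithinAt_of_chart he he' hq.1 hqs
    (isOpen_ball.mem_nhds hqb) hmaps hd.hasFDerivWithinAt
  exact hT.mdifferentiableWithinAt

variable [MeasurableSpace Y] [BorelSpace Y] [SecondCountableTopology Y]

/-- The area formula needs a differential at every point of a Borel set. A set `G` of full area
provides it, and restriction to `G` keeps the same linear maps. -/
theorem exists_measurableSet_mdifferentiable {M : Set X} (hM : MeasurableSet M) {φ : X → Y} {K : ℝ≥0}
    (hφ : LipschitzOnWith K φ M) : ∃ G ⊆ M, MeasurableSet G ∧ G =ᵐ[area X] M ∧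
      ∀ p ∈ G, HasMFDerivWithinAt 𝓘₂ 𝓘₂ φ G p (mfderivWithin 𝓘₂ 𝓘₂ φ M p) := by
  have h := ae_mdifferentiableWithinAt hM hφ
  rw [ae_restrict_iff' hM, ae_iff] at h
  obtain ⟨t, ht, htm, ht0⟩ := exists_measurable_superset_of_null h
  refine ⟨M \ t, sdiff_subset, hM.diff htm, ?_, fun p hp => ?_⟩
  · exact sdiff_null_ae_eq_self ht0
  · have h1 : MDifferentiableWithinAt 𝓘₂ 𝓘₂ φ M p := by
      by_contra h2
      exact hp.2 (ht (by simpa using ⟨hp.1, h2⟩))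
    exact h1.hasMFDerivWithinAt.mono sdiff_subset

theorem normDet_eq_sigma_mul (M : Set X) (φ : X → Y) (p : X) :
    (mfderivWithin 𝓘₂ 𝓘₂ φ M p).toLinearMap.normDet = sigma M φ 0 p * sigma M φ 1 p :=
  normDet_eq_mul_singularValues (finrank_tangentPlane p) _

theorem sigma_nonneg (M : Set X) (φ : X → Y) (i : ℕ) (p : X) : 0 ≤ sigma M φ i p :=
  LinearMap.singularValues_nonneg _ _

theorem sigma_one_le (M : Set X) (φ : X → Y) (p : X) : sigma M φ 1 p ≤ sigma M φ 0 p :=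
  LinearMap.singularValues_antitone _ zero_le_one

/-- The larger singular value is a countable supremum, the smaller one is the Jacobian divided by
the larger. Where the larger vanishes so does the smaller, in accordance with division by zero. -/
theorem aemeasurable_sigma {M : Set X} (hM : MeasurableSet M) {φ : X → Y} {K : ℝ≥0}
    (hφ : LipschitzOnWith K φ M)
    (hinj : ∀ᵐ q ∂(area Y), (M ∩ φ ⁻¹' {q}).Subsingleton) :
    AEMeasurable (sigma M φ 0) ((area X).restrict M) ∧
      AEMeasurable (sigma M φ 1) ((area X).restrict M) := by
  obtain ⟨G, hGM, hGm, hGae, hG⟩ := exists_measurableSet_mdifferentiable hM hφ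
  rw [← Measure.restrict_congr_set hGae]
  have h0 : AEMeasurable (sigma M φ 0) ((area X).restrict G) :=
    aemeasurable_singularValue_zero (T := fun p => mfderivWithin 𝓘₂ 𝓘₂ φ M p) hGm hG
  refine ⟨h0, ?_⟩
  have hJ := (lintegral_normDet_eq_area_image (T := fun p => mfderivWithin 𝓘₂ 𝓘₂ φ M p) hGm hG
    (hinj.mono fun q hq => hq.anti (inter_subset_inter_left _ hGM))).1
  refine (hJ.ennreal_toReal.div h0).congr (Eventually.of_forall fun p => ?_)
  simp only [Pi.div_apply]
  rw [ENNReal.toReal_ofReal (LinearMap.normDet_nonneg _), normDet_eq_sigma_mul]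
  rcases (sigma_nonneg M φ 0 p).eq_or_lt with h | h
  · rw [← h, div_zero]
    exact le_antisymm (sigma_nonneg M φ 1 p) (h ▸ sigma_one_le M φ p)
  · field_simp

/-- The image of the discarded null set is simply dropped. An inequality is enough, because `F_f` is
decreasing on `(0, 1]`. -/
theorem lintegral_sigma_mul_le {M : Set X} (hM : MeasurableSet M) {φ : X → Y} {K : ℝ≥0}
    (hφ : LipschitzOnWith K φ M)
    (hinj : ∀ᵐ q ∂(area Y), (M ∩ φ ⁻¹' {q}).Subsingleton) :
    ∫⁻ p in M, ENNReal.ofReal (sigma M φ 0 p * sigma M φ 1 p) ∂(area X) ≤ area Y (φ '' M) := by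
  obtain ⟨G, hGM, hGm, hGae, hG⟩ := exists_measurableSet_mdifferentiable hM hφ
  have hJ := (lintegral_normDet_eq_area_image (T := fun p => mfderivWithin 𝓘₂ 𝓘₂ φ M p) hGm hG
    (hinj.mono fun q hq => hq.anti (inter_subset_inter_left _ hGM))).2
  rw [← Measure.restrict_congr_set hGae]
  simp only [normDet_eq_sigma_mul] at hJ
  rw [hJ]
  exact measure_mono (image_mono hGM)

theorem lintegral_sigma_mul_eq {M : Set X} (hM : MeasurableSet M) {φ : X → Y}
    (hφ : MDifferentiableOn 𝓘₂ 𝓘₂ φ M)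
    (hinj : ∀ᵐ q ∂(area Y), (M ∩ φ ⁻¹' {q}).Subsingleton) :
    ∫⁻ p in M, ENNReal.ofReal (sigma M φ 0 p * sigma M φ 1 p) ∂(area X) = area Y (φ '' M) := by
  have hJ := (lintegral_normDet_eq_area_image (T := fun p => mfderivWithin 𝓘₂ 𝓘₂ φ M p) hM
    (fun p hp => (hφ p hp).hasMFDerivWithinAt) hinj).2
  simpa only [normDet_eq_sigma_mul] using hJ

end LipschitzMaps


/-! ### Rigidity of almost everywhere homothetic maps -/

section Rigidity

open Metric

/-- Near each of its points, a closed domain with Lipschitz boundary is the region above the graph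
of a Lipschitz function, in a suitable chart. -/
theorem exists_graph_chart {X : Type*} [TopologicalSpace X] [ChartedSpace Plane X]
    [IsManifold 𝓘₂ ∞ X] {M : Set X} (hb : HasLipschitzBoundary M) {p : X}
    (hp : p ∈ M) : ∃ e ∈ IsManifold.maximalAtlas 𝓘₂ ∞ X, p ∈ e.source ∧
      ∃ (γ : ℝ → ℝ) (Γ : ℝ≥0) (R : ℝ), LipschitzWith Γ γ ∧ 0 < R ∧ ball (e p) R ⊆ e.target ∧
        ∀ u ∈ ball (e p) R, (e.symm u ∈ M ↔ γ (u 0) ≤ u 1) := by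
  by_cases hint : p ∈ interior M
  · have hps := mem_chart_source Plane p
    refine ⟨chartAt Plane p, IsManifold.chart_mem_maximalAtlas p, hps, ?_⟩
    set e := chartAt Plane p
    have h1 : e.target ∩ e.symm ⁻¹' (interior M) ∈ 𝓝 (e p) := by
      refine inter_mem (e.open_target.mem_nhds (e.map_source hps)) ?_
      refine e.continuousAt_symm (e.map_source hps) ?_
      rw [e.left_inv hps]
      exact isOpen_interior.mem_nhds hint
    obtain ⟨R, hR, hRs⟩ := Metric.mem_nhds_iff.1 h1
    -- At an interior point a horizontal line below the ball serves as the graph, so interior and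
    -- boundary points are treated alike.
    refine ⟨fun _ => e p 1 - R, 0, R, LipschitzWith.const _, hR, hRs.trans inter_subset_left,
      fun u hu => iff_of_true (interior_subset (hRs hu).2) ?_⟩
    rw [mem_ball, dist_eq_norm] at hu
    have h2 := (PiLp.norm_apply_le (u - e p) 1).trans hu.le
    rw [PiLp.sub_apply, Real.norm_eq_abs] at h2
    linarith [(abs_le.1 h2).1]
  · obtain ⟨e, he, hps, γ, Γ, hγ, hgr⟩ := hb p ⟨subset_closure hp, hint⟩
    obtain ⟨R, hR, hRs⟩ := Metric.mem_nhds_iff.1 (e.open_target.mem_nhds (e.map_source hps))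
    refine ⟨e, he, hps, γ, Γ, R, hγ, hR, hRs, fun u hu => ?_⟩
    rw [hgr _ (e.map_target (hRs hu)), e.right_inv (hRs hu)]

variable {X : Type*} [EMetricSpace X] [ChartedSpace Plane X] [IsManifold 𝓘₂ ∞ X]
  [RiemannianBundle (fun x : X => TangentSpace 𝓘₂ x)]
  [IsContMDiffRiemannianBundle 𝓘₂ ∞ Plane (fun x : X => TangentSpace 𝓘₂ x)]
  [IsRiemannianManifold 𝓘₂ X] [MeasurableSpace X] [BorelSpace X] [SecondCountableTopology X]
  {Y : Type*} [EMetricSpace Y] [ChartedSpace Plane Y] [IsManifold 𝓘₂ ∞ Y]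
  [RiemannianBundle (fun y : Y => TangentSpace 𝓘₂ y)]
  [IsContMDiffRiemannianBundle 𝓘₂ ∞ Plane (fun y : Y => TangentSpace 𝓘₂ y)]
  [IsRiemannianManifold 𝓘₂ Y] [MeasurableSpace Y] [BorelSpace Y] [SecondCountableTopology Y]

theorem uniqueMDiffWithinAt_of_lipschitzBoundary {M : Set X}
    (hb : HasLipschitzBoundary M) {p : X} (hp : p ∈ M) : UniqueMDiffWithinAt 𝓘₂ M p := by
  obtain ⟨e, he, hps, γ, Γ, R, hγ, hR, hRt, hgr⟩ := exists_graph_chart hb hp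
  have h1 : UniqueDiffWithinAt ℝ (e.symm ⁻¹' M) (e p) :=
    uniqueDiffWithinAt_of_graph hR hγ (by rwa [mem_preimage, e.left_inv hps]) hgr
  have h2 := h1.uniqueMDiffWithinAt.preimage_openPartialHomeomorph
    (mdifferentiable_of_mem_maximalAtlas he).symm (e.map_source hps)
  rw [OpenPartialHomeomorph.symm_symm, e.left_inv hps] at h2
  refine h2.mono ?_
  rintro q ⟨hq1, hq2⟩
  rw [mem_preimage, mem_preimage, e.left_inv hq1] at hq2
  exact hq2

/-- Lipschitz maps which are almost everywhere infinitesimally homothetic, with a fixed ratio, and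
almost everywhere injective are differentiable with homothetic differential. -/
theorem exists_hasMFDerivWithinAt_of_ae_homothetic {M : Set X} (hM : IsClosed M)
    (hb : HasLipschitzBoundary M) {φ : X → Y} {K : ℝ≥0} (hφ : LipschitzOnWith K φ M)
    (hinj : ∀ᵐ q ∂(area Y), (M ∩ φ ⁻¹' {q}).Subsingleton) {r : ℝ} (hr : 0 < r)
    (h : ∀ᵐ p ∂(area X).restrict M, sigma M φ 0 p = r ∧ sigma M φ 1 p = r) {p : X} (hp : p ∈ M) :
    ∃ T : TangentSpace 𝓘₂ p →L[ℝ] TangentSpace 𝓘₂ (φ p), HasMFDerivWithinAt 𝓘₂ 𝓘₂ φ M p T ∧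
      ∀ w, ‖T w‖ = r * ‖w‖ := by
  obtain ⟨e, he, hps, γ, Γ, R₀, hγ, hR₀, hR₀t, hgr⟩ := exists_graph_chart hb hp
  have he' := chartAt_mem_smoothAtlas (φ p)
  have hps' := mem_chart_source Plane (φ p)
  set e' := chartAt Plane (φ p)
  obtain ⟨R₁, hR₁, hR₁t, c, C, ℓ, hq⟩ := exists_planeMetric he (e.map_source hps)
  obtain ⟨R₂, hR₂, hR₂t, c', C', ℓ', hq'⟩ := exists_planeMetric he' (e'.map_source hps')
  obtain ⟨R₃, hR₃, hR₃t, K', hF, hmaps, hmaps'⟩ :=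
    exists_lipschitzOnWith_chart he he' hφ hp hps hps' hR₂
  set R := min R₀ (min R₁ R₃) with hRdef
  have hR : 0 < R := lt_min hR₀ (lt_min hR₁ hR₃)
  have hb0 : ball (e p) R ⊆ ball (e p) R₀ := ball_subset_ball (min_le_left _ _)
  have hb1 : ball (e p) R ⊆ ball (e p) R₁ :=
    ball_subset_ball ((min_le_right _ _).trans (min_le_left _ _))
  have hb3 : ball (e p) R ⊆ ball (e p) R₃ :=
    ball_subset_ball ((min_le_right _ _).trans (min_le_right _ _))
  have hRt : ball (e p) R ⊆ e.target := hb0.trans hR₀t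
  set S : Set Plane := e.symm ⁻¹' M with hS
  have hSb : S ∩ ball (e p) R ⊆ S ∩ ball (e p) R₃ := inter_subset_inter_right _ hb3
  have hpS : e p ∈ S := by rwa [hS, mem_preimage, e.left_inv hps]
  -- the piece of `M` which is parametrized
  set A₀ : Set X := e.source ∩ e ⁻¹' (S ∩ ball (e p) R) with hA₀
  have hA₀e : e '' A₀ = S ∩ ball (e p) R := by
    rw [hA₀, e.image_source_inter_eq']
    ext u
    constructor
    · rintro ⟨h1, h2⟩
      rwa [mem_preimage, mem_preimage, e.right_inv h1] at h2
    · intro h1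
      refine ⟨hRt h1.2, ?_⟩
      rwa [mem_preimage, mem_preimage, e.right_inv (hRt h1.2)]
  have hA₀M : A₀ ⊆ M := by
    rintro q ⟨h1, h2, -⟩
    rwa [hS, mem_preimage, e.left_inv h1] at h2
  have hA₀φ : MapsTo φ A₀ e'.source := by
    rintro q ⟨h1, h2⟩
    have := hmaps (hSb h2)
    rwa [Function.comp_apply, e.left_inv h1] at this
  have hder : ∀ᵐ u : Plane, u ∈ S ∩ ball (e p) R → ∃ A : Plane →L[ℝ] Plane,
      HasFDerivWithinAt (e' ∘ φ ∘ e.symm) A S u ∧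
      ∀ w, ‖coordFrame e' ((e' ∘ φ ∘ e.symm) u) (A w)‖ ^ 2 = r ^ 2 * ‖coordFrame e u w‖ ^ 2 := by
    have h1 := h.and (ae_mdifferentiableWithinAt hM.measurableSet hφ)
    rw [ae_restrict_iff' hM.measurableSet, ae_iff] at h1
    have h2 := (volume_image_chart_eq_zero_iff he (s := e.source ∩ _) inter_subset_left).2
      (measure_mono_null inter_subset_right h1)
    filter_upwards [measure_eq_zero_iff_ae_notMem.1 h2] with u hu huS
    have hut := hRt huS.2
    have h3 : (sigma M φ 0 (e.symm u) = r ∧ sigma M φ 1 (e.symm u) = r) ∧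
        MDifferentiableWithinAt 𝓘₂ 𝓘₂ φ M (e.symm u) := by
      by_contra hcon
      refine hu ⟨e.symm u, ⟨e.map_target hut, ?_⟩, e.right_inv hut⟩
      simp only [mem_ofPred_eq, Classical.not_imp]
      exact ⟨huS.1, hcon⟩
    have h4 := hasFDerivWithinAt_chart he he' (A := A₀) inter_subset_left hA₀φ
      (T := fun q => mfderivWithin 𝓘₂ 𝓘₂ φ M q) (u := u) (by rwa [hA₀e])
      (h3.2.hasMFDerivWithinAt.mono hA₀M)
    rw [hA₀e] at h4
    refine ⟨_, h4.mono_of_mem_nhdsWithin (inter_mem_nhdsWithin _ (isOpen_ball.mem_nhds huS.2)),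
      fun w => ?_⟩
    have h5 := norm_apply_coordFrame he' (fun q => mfderivWithin 𝓘₂ 𝓘₂ φ M q)
      (hmaps (hSb huS)) w
    have h6 := (singularValues_eq_iff (finrank_tangentPlane (e.symm u))
      (mfderivWithin 𝓘₂ 𝓘₂ φ M (e.symm u)).toLinearMap hr.le).1 h3.1 (coordFrame e u w)
    rw [← mul_pow, ← h6]
    exact congrArg (· ^ 2) h5.symm
  have hinj' : ∀ᵐ z : Plane,
      ((S ∩ ball (e p) R) ∩ (e' ∘ φ ∘ e.symm) ⁻¹' {z}).Subsingleton := by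
    have h2 := (volume_image_chart_eq_zero_iff he' (s := e'.source ∩ _) inter_subset_left).2
      (measure_mono_null inter_subset_right (ae_iff.1 hinj))
    filter_upwards [measure_eq_zero_iff_ae_notMem.1 h2] with z hz
    rintro u ⟨hu, huz⟩ v ⟨hv, hvz⟩
    rw [mem_preimage, mem_singleton_iff] at huz hvz
    have h3 := e'.injOn (hmaps (hSb hu)) (hmaps (hSb hv)) (huz.trans hvz.symm)
    by_contra huv
    refine hz ⟨φ (e.symm u), ⟨hmaps (hSb hu), ?_⟩, huz⟩
    intro hsub
    exact huv (e.symm.injOn (hRt hu.2) (hRt hv.2) (hsub ⟨hu.1, rfl⟩ ⟨hv.1, h3.symm⟩))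
  -- Multiplying the source metric by `r ^ 2` turns the homothety condition into an isometry
  -- condition.
  obtain ⟨A, hA, hAn⟩ := exists_hasFDerivWithinAt_of_ae_isometric hR hγ hpS
    (fun u hu => hgr u (hb0 hu)) ((hq.mono hb1).const_mul hr) hq' (hmaps'.mono_left hSb)
    (hF.mono hSb) hder hinj'
  obtain ⟨T, hT, hTn⟩ := exists_hasMFDerivWithinAt_of_chart he he' hp hps (ball_mem_nhds (e p) hR)
    (hmaps.mono_left hSb) (hA.mono inter_subset_left)
  refine ⟨T, hT, fun w => ?_⟩
  have h1 := hAn (mfderiv 𝓘₂ 𝓘₂ e p w)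
  have h2 : (e' ∘ φ ∘ e.symm) (e p) = e' (φ p) := by simp [e.left_inv hps]
  rw [h2] at h1
  have h3 := norm_eq_norm_coordFrame he hps w
  rw [hTn, h3, ← sq_eq_sq₀ (norm_nonneg _) (mul_nonneg hr.le (norm_nonneg _)), mul_pow]
  exact h1

/-- Unique differentiability on the domain identifies the differential found by rigidity with
`mfderivWithin`, and polarization turns norms into inner products. -/
theorem isHomothety_of_ae_sigma_eq {M : Set X} (hM : IsClosed M)
    (hb : HasLipschitzBoundary M) {φ : X → Y} {K : ℝ≥0} (hφ : LipschitzOnWith K φ M)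
    (hinj : ∀ᵐ q ∂(area Y), (M ∩ φ ⁻¹' {q}).Subsingleton) {r : ℝ} (hr : 0 < r)
    (h : ∀ᵐ p ∂(area X).restrict M, sigma M φ 0 p = r ∧ sigma M φ 1 p = r) :
    IsHomothety M φ := by
  have key := fun p (hp : p ∈ M) => exists_hasMFDerivWithinAt_of_ae_homothetic hM hb hφ hinj hr h hp
  refine ⟨fun p hp => ?_, r, hr, fun p hp v w => ?_⟩
  · obtain ⟨T, hT, -⟩ := key p hp
    exact hT.mdifferentiableWithinAt
  · obtain ⟨T, hT, hTn⟩ := key p hp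
    rw [hT.mfderivWithin (uniqueMDiffWithinAt_of_lipschitzBoundary hb hp)]
    exact inner_map_eq_of_norm_map_eq T.toLinearMap hTn v w

theorem IsHomothety.sigma_eq {M : Set X} {φ : X → Y} (h : IsHomothety M φ) :
    ∃ r : ℝ, 0 < r ∧ ∀ p ∈ M, sigma M φ 0 p = r ∧ sigma M φ 1 p = r := by
  obtain ⟨-, r, hr, h⟩ := h
  exact ⟨r, hr, fun p hp => (singularValues_eq_iff (finrank_tangentPlane p) _ hr.le).2
    (norm_map_eq_of_inner_map_eq _ hr.le (h p hp))⟩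

end Rigidity


/-! ### Topology and area of compact domains -/

section Domains

open Metric

/-- Moving a point upwards in a graph chart brings it strictly above the graph, hence into the
interior. Domains therefore have positive area, and closed subsets of full area exhaust them. -/
theorem subset_closure_interior {X : Type*} [TopologicalSpace X] [ChartedSpace Plane X]
    [IsManifold 𝓘₂ ∞ X] {M : Set X} (hb : HasLipschitzBoundary M) : M ⊆ closure (interior M) := by
  intro p hp
  obtain ⟨e, he, hps, γ, Γ, R, hγ, hR, hRt, hgr⟩ := exists_graph_chart hb hp
  set W : Set Plane := {u | γ (u 0) < u 1} ∩ ball (e p) R with hW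
  have hWo : IsOpen W := by
    refine IsOpen.inter (isOpen_lt (hγ.continuous.comp ?_) ?_) isOpen_ball <;> fun_prop
  have hWM : e.symm '' W ⊆ interior M := by
    refine interior_maximal ?_ (e.symm.isOpen_image_of_subset_source hWo
      (inter_subset_right.trans hRt))
    rintro _ ⟨u, hu, rfl⟩
    exact (hgr u hu.2).2 (le_of_lt hu.1)
  have hpγ : γ (e p 0) ≤ e p 1 :=
    (hgr _ (mem_ball_self hR)).1 (by rwa [e.left_inv hps])
  have hcl : e p ∈ closure W := by
    rw [Metric.mem_closure_iff]
    intro ε hε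
    set t := min ε R / 2 with ht
    have ht0 : 0 < t := half_pos (lt_min hε hR)
    have hd : dist (e p) (e p + t • vert) = t := by
      rw [dist_eq_norm, sub_add_cancel_left, norm_neg, norm_smul, norm_vert, mul_one,
        Real.norm_of_nonneg ht0.le]
    have hlt : t < min ε R := half_lt_self (lt_min hε hR)
    refine ⟨e p + t • vert, ⟨?_, ?_⟩, by rw [hd]; exact hlt.trans_le (min_le_left _ _)⟩
    · exact ball_add_vert_subset hγ hpγ (mem_ball_self (by positivity))
    · rw [mem_ball, dist_comm, hd]
      exact hlt.trans_le (min_le_right _ _)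
  have h1 := (e.continuousAt_symm (e.map_source hps)).continuousWithinAt.mem_closure_image hcl
  rw [e.left_inv hps] at h1
  exact closure_mono hWM h1

variable {X : Type*} [EMetricSpace X] [ChartedSpace Plane X] [IsManifold 𝓘₂ ∞ X]
  [RiemannianBundle (fun x : X => TangentSpace 𝓘₂ x)]
  [IsContMDiffRiemannianBundle 𝓘₂ ∞ Plane (fun x : X => TangentSpace 𝓘₂ x)]
  [MeasurableSpace X] [BorelSpace X] [SecondCountableTopology X] {M : Set X}

theorem IsCompactDomain.area_pos (hM : IsCompactDomain M) : 0 < area X M := by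
  have h : (interior M).Nonempty :=
    closure_nonempty_iff.1 (hM.isConnected.nonempty.mono
      (subset_closure_interior hM.lipschitzBoundary))
  exact (area_pos_of_isOpen isOpen_interior h).trans_le (measure_mono interior_subset)

theorem IsCompactDomain.area_lt_top (hM : IsCompactDomain M) : area X M < ⊤ :=
  area_lt_top_of_isCompact hM.isCompact

/-- A closed subset of full area of a domain is the whole domain. -/
theorem IsCompactDomain.subset_of_area_diff_eq_zero (hM : IsCompactDomain M) {A : Set X}
    (hA : IsClosed A) (h : area X (M \ A) = 0) : M ⊆ A := by
  have h1 : interior M ⊆ A := by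
    by_contra hcon
    obtain ⟨p, hp, hpA⟩ := not_subset.1 hcon
    have h2 := area_pos_of_isOpen (isOpen_interior.inter hA.isOpen_compl) ⟨p, hp, hpA⟩
    refine h2.ne' (measure_mono_null ?_ h)
    exact fun q hq => ⟨interior_subset hq.1, hq.2⟩
  exact (subset_closure_interior hM.lipschitzBoundary).trans (closure_minimal h1 hA)

end Domains

/-! ### Energy bounds and their equality cases -/

section Energy

variable {X : Type*} [EMetricSpace X] [ChartedSpace Plane X] [IsManifold 𝓘₂ ∞ X]
  [RiemannianBundle (fun x : X => TangentSpace 𝓘₂ x)]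
  [IsContMDiffRiemannianBundle 𝓘₂ ∞ Plane (fun x : X => TangentSpace 𝓘₂ x)]
  [IsRiemannianManifold 𝓘₂ X] [MeasurableSpace X] [BorelSpace X] [SecondCountableTopology X]
  {Y : Type*} [EMetricSpace Y] [ChartedSpace Plane Y] [IsManifold 𝓘₂ ∞ Y]
  [RiemannianBundle (fun y : Y => TangentSpace 𝓘₂ y)]
  [IsContMDiffRiemannianBundle 𝓘₂ ∞ Plane (fun y : Y => TangentSpace 𝓘₂ y)]
  [IsRiemannianManifold 𝓘₂ Y] [MeasurableSpace Y] [BorelSpace Y] [SecondCountableTopology Y]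
  {M : Set X} {N : Set Y} {φ : X → Y} {f g : ℝ → ℝ}

/-- Points outside `N` have no preimage in `M`, so the condition holds almost everywhere in all of
`Y`. -/
theorem IsLipInj.ae_subsingleton (hφ : IsLipInj M N φ) (hN : MeasurableSet N) :
    ∀ᵐ q ∂(area Y), (M ∩ φ ⁻¹' {q}).Subsingleton := by
  have h := hφ.injective_ae
  rw [ae_restrict_iff' hN] at h
  filter_upwards [h] with q hq
  by_cases hqN : q ∈ N
  · exact hq hqN
  · rintro p ⟨hp, hpq⟩
    rw [mem_preimage, mem_singleton_iff] at hpq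
    exact absurd (hpq ▸ hφ.mapsTo hp) hqN

/-- The mean Jacobian. -/
def meanJacobian (M : Set X) (φ : X → Y) : ℝ :=
  ((∫⁻ p in M, ENNReal.ofReal (sigma M φ 0 p * sigma M φ 1 p) ∂(area X)) / area X M).toReal

variable (hg : IsProfile g) (hf : ∀ x, 0 < x → f x = g (Real.log x))
include hg hf

/-- The energy is bounded below in terms of the mean Jacobian; if the bound is attained, the
differential is almost everywhere homothetic with a fixed ratio. -/
theorem lowerBound_meanJacobian_le (hM : MeasurableSet M) (hM0 : 0 < area X M)
    (hMt : area X M < ⊤) {K : ℝ≥0} (hφ : LipschitzOnWith K φ M)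
    (hinj : ∀ᵐ q ∂(area Y), (M ∩ φ ⁻¹' {q}).Subsingleton)
    (hle : area Y (φ '' M) ≤ area X M) :
    lowerBound f (meanJacobian M φ) ≤ energy f M φ ∧
      (0 < meanJacobian M φ → energy f M φ = lowerBound f (meanJacobian M φ) →
        ∀ᵐ p ∂(area X).restrict M,
          sigma M φ 0 p = √(meanJacobian M φ) ∧ sigma M φ 1 p = √(meanJacobian M φ)) := by
  obtain ⟨hs0, hs1⟩ := aemeasurable_sigma hM hφ hinj
  have hI := (lintegral_sigma_mul_le hM hφ hinj).trans hle
  set I := ∫⁻ p in M, ENNReal.ofReal (sigma M φ 0 p * sigma M φ 1 p) ∂(area X) with hIdef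
  set V := area X M with hV
  set m := meanJacobian M φ with hm
  have hIV : I / V ≠ ⊤ := ENNReal.div_ne_top (hI.trans_lt hMt).ne hM0.ne'
  have hI' : I = ENNReal.ofReal m * V := by
    rw [hm, meanJacobian, ENNReal.ofReal_toReal hIV, ENNReal.div_mul_cancel hM0.ne' hMt.ne]
  have hm1 : m ≤ 1 := by
    rw [hm, meanJacobian]
    refine ENNReal.toReal_le_of_le_ofReal zero_le_one ?_
    rw [ENNReal.ofReal_one]
    exact ENNReal.div_le_of_le_mul (by rwa [one_mul])
  have hm0 : 0 ≤ m := ENNReal.toReal_nonneg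
  have hcost : ∀ i, AEMeasurable (sigma M φ i) ((area X).restrict M) →
      AEMeasurable (fun p => cost f (sigma M φ i p)) ((area X).restrict M) := fun i hi =>
    (measurable_cost hg hf).comp_aemeasurable hi
  have hJ : AEMeasurable (fun p => ENNReal.ofReal (sigma M φ 0 p * sigma M φ 1 p))
      ((area X).restrict M) := (hs0.mul hs1).ennreal_ofReal
  have hC : AEMeasurable (fun p => cost f (sigma M φ 0 p) + cost f (sigma M φ 1 p))
      ((area X).restrict M) := (hcost 0 hs0).add (hcost 1 hs1)
  -- If the mean Jacobian is zero, the smaller singular value vanishes almost everywhere and the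
  -- energy is infinite.
  rcases hm0.eq_or_lt with h0 | hmpos
  · refine ⟨?_, fun h => absurd h0 h.ne⟩
    suffices h : energy f M φ = ⊤ by rw [h]; exact le_top
    rw [← h0, ENNReal.ofReal_zero, zero_mul, hIdef,
      lintegral_eq_zero_iff' hJ] at hI'
    have h1 : ∀ᵐ p ∂(area X).restrict M,
        cost f (sigma M φ 0 p) + cost f (sigma M φ 1 p) = ⊤ := by
      filter_upwards [hI'] with p hp
      simp only [Pi.zero_apply, ENNReal.ofReal_eq_zero] at hp
      have h2 : sigma M φ 1 p = 0 := by
        by_contra hne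
        have h3 := (sigma_nonneg M φ 1 p).lt_of_ne' hne
        exact (mul_pos (h3.trans_le (sigma_one_le M φ p)) h3).not_ge hp
      rw [h2, cost_zero hg hf, add_top]
    rw [energy, lintegral_congr_ae h1, lintegral_const, Measure.restrict_apply_univ,
      ENNReal.top_mul hM0.ne', ENNReal.top_div_of_ne_top hMt.ne]
  · obtain ⟨k, hk, htilt⟩ := exists_tilt hg hf hmpos hm1
    have htilt := fun p => htilt (sigma M φ 0 p) (sigma M φ 1 p) (sigma_nonneg M φ 0 p)
      (sigma_nonneg M φ 1 p)
    have hfm : 0 ≤ 2 * f (√m) := mul_nonneg zero_le_two (f_nonneg hg hf (Real.sqrt_pos.2 hmpos))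
    rw [lowerBound_eq hg hf hmpos hm1]
    set E := ∫⁻ p in M, (cost f (sigma M φ 0 p) + cost f (sigma M φ 1 p)) ∂(area X) with hE
    have hsum : ∫⁻ p in M, (cost f (sigma M φ 0 p) + cost f (sigma M φ 1 p)
        + ENNReal.ofReal (k * (sigma M φ 0 p * sigma M φ 1 p))) ∂(area X)
        = E + ENNReal.ofReal (k * m) * V := by
      rw [lintegral_add_left' hC]
      congr 1
      simp only [ENNReal.ofReal_mul hk]
      rw [lintegral_const_mul' _ _ ENNReal.ofReal_ne_top, ← hIdef, hI', mul_assoc]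
    have hconst : ∫⁻ _ in M, ENNReal.ofReal (2 * f (√m) + k * m) ∂(area X)
        = ENNReal.ofReal (2 * f (√m)) * V + ENNReal.ofReal (k * m) * V := by
      rw [lintegral_const, Measure.restrict_apply_univ, ENNReal.ofReal_add hfm
        (mul_nonneg hk hm0), add_mul]
    have hkV : ENNReal.ofReal (k * m) * V ≠ ⊤ := ENNReal.mul_ne_top ENNReal.ofReal_ne_top hMt.ne
    -- Since `m` is the mean of the Jacobian, the integrated tilt is `k m V` on both sides; being
    -- finite, it cancels.
    have hmain : ENNReal.ofReal (2 * f (√m)) * V ≤ E := by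
      have h1 := lintegral_mono (μ := (area X).restrict M) fun p => (htilt p).1
      rw [hsum, hconst] at h1
      exact (ENNReal.add_le_add_iff_right hkV).1 h1
    refine ⟨?_, fun _ heq => ?_⟩
    · rw [energy, ENNReal.le_div_iff_mul_le (Or.inl hM0.ne') (Or.inl hMt.ne)]
      exact hmain
    · have hE' : E = ENNReal.ofReal (2 * f (√m)) * V := by
        rw [← heq, energy, ENNReal.div_mul_cancel hM0.ne' hMt.ne]
      -- Equal finite integrals in a pointwise inequality force equality almost everywhere, and the
      -- equality case of the tilt determines both singular values.
      have h2 := ae_eq_of_ae_le_of_lintegral_le (μ := (area X).restrict M)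
        (Eventually.of_forall fun p => (htilt p).1)
        (by rw [hconst]
            exact ENNReal.add_ne_top.2 ⟨ENNReal.mul_ne_top ENNReal.ofReal_ne_top hMt.ne, hkV⟩)
        (hC.add ((hs0.mul hs1).const_mul k).ennreal_ofReal)
        (by rw [hsum, hconst, hE'])
      filter_upwards [h2] with p hp
      exact (htilt p).2 hp.symm

/-- The area of the image and the energy of a homothety. -/
theorem IsHomothety.energy_eq (hM : MeasurableSet M) (hM0 : 0 < area X M) (hMt : area X M < ⊤)
    (hinj : ∀ᵐ q ∂(area Y), (M ∩ φ ⁻¹' {q}).Subsingleton)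
    (hle : area Y (φ '' M) ≤ area X M) (h : IsHomothety M φ) :
    0 < area Y (φ '' M) ∧
      energy f M φ = lowerBound f (area Y (φ '' M) / area X M).toReal := by
  obtain ⟨r, hr, hσ⟩ := h.sigma_eq
  have harea : area Y (φ '' M) = ENNReal.ofReal (r * r) * area X M := by
    rw [← lintegral_sigma_mul_eq hM h.1 hinj, ← setLIntegral_const]
    exact setLIntegral_congr_fun hM fun p hp => by simp only [(hσ p hp).1, (hσ p hp).2]
  have hs : (area Y (φ '' M) / area X M).toReal = r * r := by
    rw [harea, ENNReal.mul_div_cancel_right hM0.ne' hMt.ne, ENNReal.toReal_ofReal (by positivity)]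
  have hs1 : r * r ≤ 1 := by
    rw [← hs]
    refine ENNReal.toReal_le_of_le_ofReal zero_le_one ?_
    rw [ENNReal.ofReal_one]
    exact ENNReal.div_le_of_le_mul (by rwa [one_mul])
  refine ⟨?_, ?_⟩
  · rw [harea]
    exact ENNReal.mul_pos (by simpa using mul_pos hr hr) hM0.ne'
  · have h1 : ∫⁻ p in M, (cost f (sigma M φ 0 p) + cost f (sigma M φ 1 p)) ∂(area X)
        = ENNReal.ofReal (2 * f r) * area X M := by
      rw [← setLIntegral_const]
      refine setLIntegral_congr_fun hM fun p hp => ?_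
      have hfr := f_nonneg hg hf hr
      simp only [(hσ p hp).1, (hσ p hp).2, cost_of_pos hr]
      rw [← ENNReal.ofReal_add hfr hfr, two_mul]
    rw [hs, lowerBound_eq hg hf (mul_pos hr hr) hs1, Real.sqrt_mul_self hr.le, energy, h1,
      ENNReal.mul_div_cancel_right hM0.ne' hMt.ne]

/-- The energy is bounded below in terms of the area of the image, with equality exactly for
homotheties. -/
theorem lowerBound_area_image_le (hM : IsCompactDomain M) (hN : MeasurableSet N)
    (hφ : IsLipInj M N φ) (hle : area Y (φ '' M) ≤ area X M) :
    lowerBound f (area Y (φ '' M) / area X M).toReal ≤ energy f M φ ∧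
      (0 < area Y (φ '' M) →
        (energy f M φ = lowerBound f (area Y (φ '' M) / area X M).toReal ↔ IsHomothety M φ)) := by
  have hMm := hM.isCompact.isClosed.measurableSet
  have hM0 := hM.area_pos
  have hMt := hM.area_lt_top
  obtain ⟨K, hK⟩ := hφ.lipschitz
  have hinj := hφ.ae_subsingleton hN
  obtain ⟨h1, h2⟩ := lowerBound_meanJacobian_le hg hf hMm hM0 hMt hK hinj hle
  have hat : area Y (φ '' M) / area X M ≠ ⊤ :=
    ENNReal.div_ne_top (hle.trans_lt hMt).ne hM0.ne'
  have hms : meanJacobian M φ ≤ (area Y (φ '' M) / area X M).toReal :=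
    ENNReal.toReal_mono hat (ENNReal.div_le_div_right (lintegral_sigma_mul_le hMm hK hinj) _)
  have hs1 : (area Y (φ '' M) / area X M).toReal ≤ 1 := by
    refine ENNReal.toReal_le_of_le_ofReal zero_le_one ?_
    rw [ENNReal.ofReal_one]
    exact ENNReal.div_le_of_le_mul (by rwa [one_mul])
  have h3 := lowerBound_anti hg hf hms hs1
  refine ⟨h3.trans h1, fun hpos => ⟨fun heq => ?_, fun h => ?_⟩⟩
  · have hs0 : 0 < (area Y (φ '' M) / area X M).toReal :=
      ENNReal.toReal_pos (ENNReal.div_pos hpos.ne' hMt.ne).ne' hat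
    -- The energy is squeezed between `F_f` at the mean Jacobian, from below, and `F_f` at the ratio
    -- of areas, which is no larger. As the latter is finite, the mean Jacobian cannot be zero.
    have h4 : energy f M φ = lowerBound f (meanJacobian M φ) :=
      le_antisymm (heq ▸ h3) h1
    have hm0 : 0 < meanJacobian M φ := by
      by_contra! hm
      rw [heq, lowerBound_of_nonpos hm, lowerBound_eq hg hf hs0 hs1] at h4
      exact ENNReal.ofReal_ne_top h4
    exact isHomothety_of_ae_sigma_eq hM.isCompact.isClosed hM.lipschitzBoundary hK hinj
      (Real.sqrt_pos.2 hm0) (h2 hm0 h4)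
  · exact (h.energy_eq hg hf hMm hM0 hMt hinj hle).2

/-- The energy is bounded below in terms of the area of the target, with equality exactly for
surjective homotheties. -/
theorem lowerBound_area_target_le (hM : IsCompactDomain M) (hN : IsCompactDomain N)
    (hle : area Y N ≤ area X M) (hφ : IsLipInj M N φ) :
    lowerBound f (area Y N / area X M).toReal ≤ energy f M φ ∧
      (energy f M φ = lowerBound f (area Y N / area X M).toReal ↔
        IsHomothety M φ ∧ φ '' M = N) := by
  have hNm := hN.isCompact.isClosed.measurableSet
  have hM0 := hM.area_pos
  have hMt := hM.area_lt_top
  have hsub : φ '' M ⊆ N := hφ.mapsTo.image_subset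
  have haN : area Y (φ '' M) ≤ area Y N := measure_mono hsub
  obtain ⟨h1, h2⟩ := lowerBound_area_image_le hg hf hM hNm hφ (haN.trans hle)
  have hNt : area Y N / area X M ≠ ⊤ := ENNReal.div_ne_top (hle.trans_lt hMt).ne hM0.ne'
  have hst : (area Y (φ '' M) / area X M).toReal ≤ (area Y N / area X M).toReal :=
    ENNReal.toReal_mono hNt (ENNReal.div_le_div_right haN _)
  have ht1 : (area Y N / area X M).toReal ≤ 1 := by
    refine ENNReal.toReal_le_of_le_ofReal zero_le_one ?_
    rw [ENNReal.ofReal_one]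
    exact ENNReal.div_le_of_le_mul (by rwa [one_mul])
  have h3 := lowerBound_anti hg hf hst ht1
  refine ⟨h3.trans h1, fun heq => ?_, ?_⟩
  · have ht0 : 0 < (area Y N / area X M).toReal :=
      ENNReal.toReal_pos (ENNReal.div_pos hN.area_pos.ne' hMt.ne).ne' hNt
    have h4 : energy f M φ = lowerBound f (area Y (φ '' M) / area X M).toReal :=
      le_antisymm (heq ▸ h3) h1
    have hs0 : 0 < (area Y (φ '' M) / area X M).toReal := by
      by_contra! hs
      rw [heq, lowerBound_of_nonpos hs, lowerBound_eq hg hf ht0 ht1] at h4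
      exact ENNReal.ofReal_ne_top h4
    -- Strict monotonicity of `F_f` excludes an image of smaller area than the target.
    have hst' : (area Y (φ '' M) / area X M).toReal = (area Y N / area X M).toReal := by
      by_contra hne
      have h5 := lowerBound_strictAnti hg hf hs0 (lt_of_le_of_ne hst hne) ht1
      rw [← heq, h4] at h5
      exact lt_irrefl _ h5
    have hpos : 0 < area Y (φ '' M) := by
      rw [pos_iff_ne_zero]
      intro h
      simp [h] at hs0
    have hareq : area Y (φ '' M) = area Y N := by
      have h5 := (ENNReal.toReal_eq_toReal_iff'
        (ENNReal.div_ne_top (haN.trans_lt hN.area_lt_top).ne hM0.ne') hNt).1 hst'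
      rw [← ENNReal.div_mul_cancel (b := area Y (φ '' M)) hM0.ne' hMt.ne, h5,
        ENNReal.div_mul_cancel hM0.ne' hMt.ne]
    obtain ⟨K, hK⟩ := hφ.lipschitz
    have hcl : IsClosed (φ '' M) := (hM.isCompact.image_of_continuousOn hK.continuousOn).isClosed
    refine ⟨(h2 hpos).1 h4, hsub.antisymm (hN.subset_of_area_diff_eq_zero hcl ?_)⟩
    rw [measure_sdiff hsub hcl.measurableSet.nullMeasurableSet
      (haN.trans_lt hN.area_lt_top).ne, hareq, tsub_self]
  · rintro ⟨h, hsurj⟩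
    have hpos : 0 < area Y (φ '' M) := hsurj ▸ hN.area_pos
    have h4 := (h2 hpos).2 h
    rwa [hsurj] at h4

end Energy

end

end SurfaceDistortion

/-! ### The main theorem -/

open SurfaceDistortion in
theorem theorem1p10
    {X : Type*} [EMetricSpace X] [SecondCountableTopology X] [MeasurableSpace X] [BorelSpace X]
    [ChartedSpace Plane X] [IsManifold 𝓘₂ ∞ X] [OrientedAtlas X]
    [RiemannianBundle (fun x : X => TangentSpace 𝓘₂ x)]
    [IsContMDiffRiemannianBundle 𝓘₂ ∞ Plane (fun x : X => TangentSpace 𝓘₂ x)]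
    [IsRiemannianManifold 𝓘₂ X]
    {Y : Type*} [EMetricSpace Y] [SecondCountableTopology Y] [MeasurableSpace Y] [BorelSpace Y]
    [ChartedSpace Plane Y] [IsManifold 𝓘₂ ∞ Y] [OrientedAtlas Y]
    [RiemannianBundle (fun y : Y => TangentSpace 𝓘₂ y)]
    [IsContMDiffRiemannianBundle 𝓘₂ ∞ Plane (fun y : Y => TangentSpace 𝓘₂ y)]
    [IsRiemannianManifold 𝓘₂ Y]
    (M : Set X) (hM : IsCompactDomain M) (N : Set Y) (hN : IsCompactDomain N)
    (g : ℝ → ℝ) (hg_nonneg : ∀ x, 0 ≤ g x) (hg_cont : Continuous g)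
    (hg_anti : StrictAntiOn g (Iic 0)) (hg_conv : StrictConvexOn ℝ (Iic 0) g)
    (hg_mono : StrictMonoOn g (Ici 0)) (hg_zero : g 0 = 0)
    (f : ℝ → ℝ) (hf : ∀ x, 0 < x → f x = g (Real.log x)) :
    -- the minimum that defines `F_f` is attained
    (∀ s : ℝ, 0 < s →
      ∃ x y : ℝ, 0 < x ∧ 0 < y ∧ x * y = s ∧ lowerBound f s = ENNReal.ofReal (f x + f y)) ∧
    -- the bound in terms of the area of the image, and its equality case
    (∀ φ : X → Y, IsLipInj M N φ → area Y (φ '' M) ≤ area X M →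
      lowerBound f (area Y (φ '' M) / area X M).toReal ≤ energy f M φ ∧
      (0 < area Y (φ '' M) →
        (energy f M φ = lowerBound f (area Y (φ '' M) / area X M).toReal ↔
          IsHomothety M φ))) ∧
    -- homotheties minimize among the maps whose images have the same area
    (∀ φ : X → Y, IsLipInj M N φ → IsHomothety M φ → area Y (φ '' M) ≤ area X M →
      ∀ ψ : X → Y, IsLipInj M N ψ → area Y (ψ '' M) = area Y (φ '' M) →
        energy f M φ ≤ energy f M ψ) ∧
    -- the bound in terms of the area of the target, and its equality case
    (area Y N ≤ area X M →
      (∀ φ : X → Y, IsLipInj M N φ →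
        lowerBound f (area Y N / area X M).toReal ≤ energy f M φ ∧
        (energy f M φ = lowerBound f (area Y N / area X M).toReal ↔
          IsHomothety M φ ∧ φ '' M = N)) ∧
      -- surjective homotheties, if there are any, are exactly the minimizers
      ((∃ φ : X → Y, IsLipInj M N φ ∧ IsHomothety M φ ∧ φ '' M = N) →
        ∀ φ : X → Y, IsLipInj M N φ →
          ((∀ ψ : X → Y, IsLipInj M N ψ → energy f M φ ≤ energy f M ψ) ↔
            IsHomothety M φ ∧ φ '' M = N))) := by
  have hg : IsProfile g := ⟨hg_nonneg, hg_cont, hg_anti, hg_conv, hg_mono, hg_zero⟩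
  have hMm := hM.isCompact.isClosed.measurableSet
  have hNm := hN.isCompact.isClosed.measurableSet
  refine ⟨fun s hs => lowerBound_attained hg hf hs,
    fun φ hφ hle => lowerBound_area_image_le hg hf hM hNm hφ hle,
    fun φ hφ hhom hle ψ hψ harea => ?_,
    fun hle => ⟨fun φ hφ => lowerBound_area_target_le hg hf hM hN hle hφ, ?_⟩⟩
  · rw [(hhom.energy_eq hg hf hMm hM.area_pos hM.area_lt_top (hφ.ae_subsingleton hNm) hle).2,
      ← harea]
    exact (lowerBound_area_image_le hg hf hM hNm hψ (harea.trans_le hle)).1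
  · rintro ⟨φ₀, hφ₀, h₀⟩ φ hφ
    have hbound := fun (ψ : X → Y) (hψ : IsLipInj M N ψ) =>
      lowerBound_area_target_le hg hf hM hN hle hψ
    refine ⟨fun hmin => (hbound φ hφ).2.1 (le_antisymm ?_ (hbound φ hφ).1), fun h ψ hψ => ?_⟩
    -- The given surjective homothety attains the lower bound, so every minimizer attains it as well
    -- and falls under the equality case.
    · exact (hmin φ₀ hφ₀).trans_eq ((hbound φ₀ hφ₀).2.2 h₀)
    · exact ((hbound φ hφ).2.2 h).trans_le (hbound ψ hψ).1
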